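/- \textbf{Setting.} Fix $\zeta\in\mathbb T$. A $\mathbb T$-$C^*$-algebra is a unital $C^*$-algebra $B$ with a point-norm continuous action $\beta$ of $\mathbb T$ by $*$-automorphisms. For $\mathbb T$-$C^*$-algebras $B,C$, represented covariantly on Hilbert spaces $L,K$ with orthonormal bases $(\lambda_a)$, $(\kappa_b)$ of $\mathbb T$-eigenvectors of degrees $l_a,k_b\in\mathbb Z$, put $j_1(b)=b\otimes 1$ and $j_2(c)=\mathcal B(c\otimes 1)\mathcal B^*$ on $L\otimes K$, where $\mathcal B\colon K\otimes L\to L\otimes K$, $\mathcal B(\kappa_b\otimes\lambda_a)=\zeta^{k_b l_a}\lambda_a\otimes\kappa_b$. The braided tensor product $B\boxtimes_\zeta C$ is the $C^*$-algebra generated by $j_1(B)$ and $j_2(C)$ in the spatial norm (the supremum over all covariant representations $L,K$; any pair of faithful ones gives the same norm); threefold products are defined in the same way. A braided compact quantum group over $\mathbb T$ is a triple $\mathbb G=(B,\beta,\Delta)$ of a $\mathbb T$-$C^*$-algebra $(B,\beta)$ and a unital $*$-homomorphism $\Delta\colon B\to B\boxtimes_\zeta B$ that is $\mathbb T$-equivariant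 for the diagonal action, coassociative, and for which $\Delta(B)j_2(B)$ and $j_1(B)\Delta(B)$ have dense linear span in $B\boxtimes_\zeta B$. A $\mathbb T$-equivariant Hopf $*$-homomorphism $f\colon(B,\beta,\Delta)\to(B',\beta',\Delta')$ is a $\mathbb T$-equivariant unital $*$-homomorphism with $\Delta'\circ f=(f\boxtimes f)\circ\Delta$. Let $V$ be a finite-dimensional Hilbert space with a continuous unitary representation $\pi$ of $\mathbb T$. A representation of $\mathbb G$ on $(V,\pi)$ is a unitary $U\in\mathbb B(V)\otimes B$ with $(\mathrm{Ad}\,\pi_z\otimes\beta_z)(U)=U$ for all $z\in\mathbb T$ and $(\mathrm{id}\otimes\Delta)(U)=(\mathrm{id}\otimes j_1)(U)\,(\mathrm{id}\otimes j_2)(U)$. Its tensor square is $U\mathbin{\top}U=\mathcal B_{23}U_{12}\mathcal B_{23}^*U_{23}\in\mathbb B(V\otimes V)\otimes B$, where $\mathcal B(b\otimes 1)\mathcal B^*=\sum_{k\in\mathbb Z}P_k\otimes\beta_{\zeta^k}(b)$ and $P_k$ is the orthogonal projection onto $V_k=\{v\in V:\pi_z v=z^kv \text{ for all } z\in\mathbb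 T\}$. A vector $\omega\in V\otimes V$ is $d$-homogeneous if $(\pi_z\otimes\pi_z)\omega=z^d\omega$ for all $z\in\mathbb T$, and $\mathbb G$-invariant if $(U\mathbin{\top}U)(\omega\otimes 1)=\omega\otimes 1$. Let $d\in\mathbb Z$ and let $\omega\in V\otimes V$ be $d$-homogeneous. Let $e_1,\dots,e_n$ be an orthonormal basis of $V$ with $\pi_z e_i=z^{d_i}e_i$, write $\omega=\sum_{i,j}\omega_{ij}\,e_i\otimes e_j$ and $\Omega=(\omega_{ij})$, and assume that there is $c\in\mathbb C\setminus\{0\}$ with $\overline{\Omega}\,\Omega=c\cdot\mathrm{diag}(\zeta^{d d_1},\dots,\zeta^{d d_n})$. (This condition does not depend on the choice of the basis.) Let $A_o(V,\pi,\omega)$ be the universal unital $C^*$-algebra with generators $u_{ij}$, $1\le i,j\le n$, and the relations \[ \sum_k u_{ki}^*u_{kj}=\delta_{ij},\qquad \sum_k u_{ik}u_{jk}^*=\delta_{ij},\qquad \zeta^{d_jd_i}\sum_k\omega_{ik}u_{jk}=\zeta^{d_j(d-d_j)}\sum_k\omega_{kj}u_{ki}^* \] for $1\le i,j\le n$. Let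 $u=\sum_{i,j}e_{ij}\otimes u_{ij}\in\mathbb B(V)\otimes A_o(V,\pi,\omega)$, where $e_{ij}$ are the matrix units of the basis. \textbf{Theorem.} (1) There is a unique structure of braided compact quantum group $(\beta,\Delta)$ over $\mathbb T$ on $A_o(V,\pi,\omega)$ with $\beta_z(u_{ik})=z^{d_k-d_i}u_{ik}$ and $\Delta(u_{ik})=\sum_l j_1(u_{il})j_2(u_{lk})$. With this structure, $u$ is a representation on $(V,\pi)$ for which $\omega$ is $d$-homogeneous and invariant. (2) $A_o(V,\pi,\omega)$ is universal with this property: if $\mathbb G=(B,\beta,\Delta)$ is a braided compact quantum group over $\mathbb T$ and $U\in\mathbb B(V)\otimes B$ is a representation of $\mathbb G$ on $(V,\pi)$ for which $\omega$ is $d$-homogeneous and $\mathbb G$-invariant, then there is a unique $\mathbb T$-equivariant Hopf $*$-homomorphism $f\colon A_o(V,\pi,\omega)\to B$ with $(\mathrm{id}\otimes f)(u)=U$. (3) Up to isomorphism, the braided quantum group $A_o(V,\pi,\omega)$ does not depend on the choice of the basis: if $A_o(V,\pi,\omega)'$, with the representation $u'$, is built from another orthonormal basis of $\mathbb T$-eigenvectors,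 then there is a unique $\mathbb T$-equivariant Hopf $*$-isomorphism $\Phi\colon A_o(V,\pi,\omega)\to A_o(V,\pi,\omega)'$ with $(\mathrm{id}\otimes\Phi)(u)=u'$. (4) More generally, let $(V_1,\pi_1,\omega_1)$ and $(V_2,\pi_2,\omega_2)$ be two triples as above (for the same $\zeta$), and let $\varphi\colon V_1\to V_2$ be a $\mathbb T$-equivariant unitary with $(\varphi\otimes\varphi)(\omega_1)=\omega_2$. Then there is a unique $\mathbb T$-equivariant Hopf $*$-isomorphism $\Phi\colon A_o(V_1,\pi_1,\omega_1)\to A_o(V_2,\pi_2,\omega_2)$ with $(\mathrm{Ad}\,\varphi\otimes\Phi)(u_1)=u_2$. -/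

import Mathlib

open scoped TensorProduct ComplexConjugate

universe u v w

noncomputable section

namespace BraidedOrth

/-! ### Free `*`-algebras -/

/-- The free unital complex `*`-algebra on a set `X` of generators: its elements are
noncommutative polynomials in the symbols `x` (`Sum.inl x`) and `x*` (`Sum.inr x`). -/
def FreeStarAlg (X : Type u) : Type u := FreeAlgebra ℂ (X ⊕ X)

namespace FreeStarAlg

variable {X : Type u}

instance : Ring (FreeStarAlg X) := inferInstanceAs (Ring (FreeAlgebra ℂ (X ⊕ X)))
instance : Algebra ℂ (FreeStarAlg X) := inferInstanceAs (Algebra ℂ (FreeAlgebra ℂ (X ⊕ X)))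

/-- The symbols `x` and `x*` as elements of the free `*`-algebra. -/
def sym (s : X ⊕ X) : FreeStarAlg X := FreeAlgebra.ι ℂ s

/-- The generator `x`. -/
def gen (x : X) : FreeStarAlg X := sym (Sum.inl x)

/-- The opposite ring of the free algebra, with the complex conjugate scalar multiplication. -/
def ConjOp (X : Type u) : Type u := (FreeStarAlg X)ᵐᵒᵖ

instance : Ring (ConjOp X) := inferInstanceAs (Ring (FreeStarAlg X)ᵐᵒᵖ)

instance : Algebra ℂ (ConjOp X) :=
  RingHom.toAlgebra' (((algebraMap ℂ (FreeStarAlg X)ᵐᵒᵖ).comp (starRingEnd ℂ) :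
    ℂ →+* (FreeStarAlg X)ᵐᵒᵖ) : ℂ →+* ConjOp X)
    (fun c x => Algebra.commutes (A := (FreeStarAlg X)ᵐᵒᵖ) (starRingEnd ℂ c) x)

/-- The conjugate-linear anti-homomorphism that exchanges `x` and `x*`. -/
def starHom : FreeStarAlg X →+* (FreeStarAlg X)ᵐᵒᵖ :=
  ((FreeAlgebra.lift ℂ (A := ConjOp X) (fun s : X ⊕ X => MulOpposite.op (sym s.swap)) :
    FreeAlgebra ℂ (X ⊕ X) →ₐ[ℂ] ConjOp X) : FreeAlgebra ℂ (X ⊕ X) →+* ConjOp X)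

theorem starHom_sym (s : X ⊕ X) : starHom (sym s) = MulOpposite.op (sym s.swap) :=
  FreeAlgebra.lift_ι_apply (R := ℂ) (A := ConjOp X) _ _

theorem starHom_algebraMap (c : ℂ) : starHom (algebraMap ℂ (FreeStarAlg X) c)
    = MulOpposite.op (algebraMap ℂ (FreeStarAlg X) (starRingEnd ℂ c)) :=
  AlgHom.commutes (FreeAlgebra.lift ℂ (A := ConjOp X)
    (fun s : X ⊕ X => MulOpposite.op (sym s.swap))) c

@[elab_as_elim]
theorem induction {C : FreeStarAlg X → Prop} (hc : ∀ c : ℂ, C (algebraMap ℂ _ c))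
    (hs : ∀ s, C (sym s)) (hmul : ∀ a b, C a → C b → C (a * b))
    (hadd : ∀ a b, C a → C b → C (a + b)) (a : FreeStarAlg X) : C a :=
  FreeAlgebra.induction ℂ (X ⊕ X) hc hs hmul hadd a

instance : StarRing (FreeStarAlg X) where
  star a := (starHom a).unop
  star_involutive a := by
    induction a using induction with
    | hc c => simp [starHom_algebraMap]
    | hs s => simp [starHom_sym]
    | hmul a b ha hb => simp [ha, hb]
    | hadd a b ha hb => simp [ha, hb]
  star_mul a b := by simp
  star_add a b := by simp

theorem star_def (a : FreeStarAlg X) : star a = (starHom a).unop := rfl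

theorem star_sym (s : X ⊕ X) : star (sym s) = sym s.swap := by simp [star_def, starHom_sym]

instance : StarModule ℂ (FreeStarAlg X) where
  star_smul c a := by
    rw [Algebra.smul_def, star_mul, star_def (algebraMap ℂ _ c), starHom_algebraMap,
      Algebra.smul_def, MulOpposite.unop_op]
    exact (Algebra.commutes _ _).symm

section lift

variable {D : Type v} [Ring D] [StarRing D] [Algebra ℂ D]

/-- The algebra homomorphism underlying `lift`. -/
def liftAlg (f : X → D) : FreeStarAlg X →ₐ[ℂ] D :=
  (FreeAlgebra.lift ℂ (Sum.elim f (fun x => star (f x))) : FreeAlgebra ℂ (X ⊕ X) →ₐ[ℂ] D)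

theorem liftAlg_sym (f : X → D) (s : X ⊕ X) :
    liftAlg f (sym s) = Sum.elim f (fun x => star (f x)) s :=
  FreeAlgebra.lift_ι_apply _ _

/-- The `*`-homomorphism that is determined by its values on the generators. -/
def lift [StarModule ℂ D] (f : X → D) : FreeStarAlg X →⋆ₐ[ℂ] D where
  toAlgHom := liftAlg f
  map_star' a := by
    change liftAlg f (star a) = star (liftAlg f a)
    induction a using induction with
    | hc c =>
      rw [star_def, starHom_algebraMap, MulOpposite.unop_op, AlgHom.commutes, AlgHom.commutes]
      exact algebraMap_star_comm c
    | hs s =>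
      rw [star_sym, liftAlg_sym, liftAlg_sym]
      cases s <;> simp
    | hmul a b ha hb => rw [star_mul, map_mul, map_mul, star_mul, ha, hb]
    | hadd a b ha hb => rw [star_add, map_add, map_add, star_add, ha, hb]

theorem lift_gen [StarModule ℂ D] (f : X → D) (x : X) : lift f (gen x) = f x :=
  liftAlg_sym f (Sum.inl x)

theorem sym_inr (x : X) : (sym (Sum.inr x) : FreeStarAlg X) = star (gen x) := by
  rw [gen, star_sym]; rfl

theorem hom_ext {f g : FreeStarAlg X →⋆ₐ[ℂ] D} (h : ∀ x, f (gen x) = g (gen x)) : f = g := by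
  ext a
  induction a using induction with
  | hc c => exact (AlgHomClass.commutes f c).trans (AlgHomClass.commutes g c).symm
  | hs s =>
    rcases s with x | x
    · exact h x
    · rw [sym_inr, map_star, map_star, h]
  | hmul a b ha hb => rw [map_mul, map_mul, ha, hb]
  | hadd a b ha hb => rw [map_add, map_add, ha, hb]

end lift

end FreeStarAlg

/-! ### `C*`-seminorms and their completions -/

/-- A `C*`-seminorm on a unital complex `*`-algebra. -/
structure CStarSeminorm (A : Type u) [Ring A] [StarRing A] [Algebra ℂ A] extends
    Seminorm ℂ A where
  mul_le : ∀ a b, toFun (a * b) ≤ toFun a * toFun b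
  star_mul_self : ∀ a, toFun (star a * a) = toFun a * toFun a

namespace CStarSeminorm

variable {A : Type u} [Ring A] [StarRing A] [Algebra ℂ A]

instance : CoeFun (CStarSeminorm A) (fun _ => A → ℝ) := ⟨fun p => p.toSeminorm⟩

theorem map_star (p : CStarSeminorm A) (a : A) : p (star a) = p a := by
  have key : ∀ b : A, p b ≤ p (star b) := fun b => by
    have h1 : p b * p b ≤ p (star b) * p b := (p.star_mul_self b).symm.le.trans (p.mul_le _ _)
    have h0 : 0 ≤ p b := apply_nonneg p.toSeminorm b
    rcases h0.eq_or_lt with h | h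
    · rw [← h]; exact apply_nonneg p.toSeminorm _
    · exact le_of_mul_le_mul_right h1 h
  exact le_antisymm (by simpa using key (star a)) (key a)

/-- The `*`-algebra `A` with the topology of the seminorm `p`. -/
def Pre (_p : CStarSeminorm A) : Type u := A

variable (p : CStarSeminorm A)

instance : Ring p.Pre := inferInstanceAs (Ring A)
instance : StarRing p.Pre := inferInstanceAs (StarRing A)
instance : Algebra ℂ p.Pre := inferInstanceAs (Algebra ℂ A)
instance [StarModule ℂ A] : StarModule ℂ p.Pre := inferInstanceAs (StarModule ℂ A)

instance : SeminormedRing p.Pre where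
  __ := (inferInstance : Ring p.Pre)
  __ := p.toSeminorm.toAddGroupSeminorm.toSeminormedAddCommGroup
  norm_mul_le a b := p.mul_le a b

theorem pre_norm (a : p.Pre) : ‖a‖ = p a := rfl

instance : NormedAlgebra ℂ p.Pre where
  norm_smul_le c a := (map_smul_eq_mul p.toSeminorm c a).le

instance : NormedStarGroup p.Pre where
  norm_star_le a := (p.map_star a).le

end CStarSeminorm

/-- The `C*`-algebra completion of `A` in the `C*`-seminorm `p`. -/
def CStarCompletion {A : Type u} [Ring A] [StarRing A] [Algebra ℂ A] (p : CStarSeminorm A) :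
    Type u := UniformSpace.Completion p.Pre

namespace CStarCompletion

open UniformSpace

variable {A : Type u} [Ring A] [StarRing A] [Algebra ℂ A] (p : CStarSeminorm A)

instance : NormedRing (CStarCompletion p) := inferInstanceAs (NormedRing (Completion p.Pre))
instance : CompleteSpace (CStarCompletion p) := inferInstanceAs (CompleteSpace (Completion p.Pre))
instance : Algebra ℂ (CStarCompletion p) := inferInstanceAs (Algebra ℂ (Completion p.Pre))
instance : NormedAlgebra ℂ (CStarCompletion p) where
  norm_smul_le := norm_smul_le (α := ℂ) (β := Completion p.Pre)

/-- The canonical map of `A` into its completion, as a ring homomorphism. -/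
def coeHom : A →+* CStarCompletion p := (Completion.coeRingHom : p.Pre →+* Completion p.Pre)

theorem norm_coeHom (a : A) : ‖coeHom p a‖ = p a := Completion.norm_coe (E := p.Pre) a

theorem denseRange_coeHom : DenseRange (coeHom p) := Completion.denseRange_coe (α := p.Pre)

theorem continuous_starPre : UniformContinuous (star : p.Pre → p.Pre) :=
  (LipschitzWith.of_dist_le_mul (K := 1) fun a b => by
    rw [dist_eq_norm, dist_eq_norm, ← star_sub, NNReal.coe_one, one_mul]
    exact (p.map_star _).le).uniformContinuous

/-- The involution on the completion. -/
def starMap : CStarCompletion p → CStarCompletion p := Completion.map (star : p.Pre → p.Pre)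

theorem continuous_starMap : Continuous (starMap p) := Completion.continuous_map

theorem starMap_coeHom (a : A) : starMap p (coeHom p a) = coeHom p (star a) :=
  Completion.map_coe (continuous_starPre p) a

theorem induct {C : CStarCompletion p → Prop} (x : CStarCompletion p)
    (hc : IsClosed {x | C x}) (h : ∀ a, C (coeHom p a)) : C x :=
  (denseRange_coeHom p).induction_on x hc h

theorem starMap_mul (x y : CStarCompletion p) :
    starMap p (x * y) = starMap p y * starMap p x := by
  have hs := continuous_starMap p
  induction x using induct p with
  | hc =>
    exact isClosed_eq (hs.comp (continuous_id.mul continuous_const)) (continuous_const.mul hs)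
  | h a =>
    induction y using induct p with
    | hc =>
      exact isClosed_eq (hs.comp (continuous_const.mul continuous_id)) (hs.mul continuous_const)
    | h b => rw [← map_mul, starMap_coeHom, starMap_coeHom, starMap_coeHom, star_mul, map_mul]

theorem starMap_add (x y : CStarCompletion p) :
    starMap p (x + y) = starMap p x + starMap p y := by
  have hs := continuous_starMap p
  induction x using induct p with
  | hc =>
    exact isClosed_eq (hs.comp (continuous_id.add continuous_const)) (hs.add continuous_const)
  | h a =>
    induction y using induct p with
    | hc =>
      exact isClosed_eq (hs.comp (continuous_const.add continuous_id)) (continuous_const.add hs)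
    | h b => rw [← map_add, starMap_coeHom, starMap_coeHom, starMap_coeHom, star_add, map_add]

instance : StarRing (CStarCompletion p) where
  star := starMap p
  star_involutive x := by
    induction x using induct p with
    | hc => exact isClosed_eq ((continuous_starMap p).comp (continuous_starMap p)) continuous_id
    | h a => rw [starMap_coeHom, starMap_coeHom, star_star]
  star_mul := starMap_mul p
  star_add := starMap_add p

theorem star_coeHom (a : A) : star (coeHom p a) = coeHom p (star a) := starMap_coeHom p a

theorem continuous_star' : Continuous (star : CStarCompletion p → CStarCompletion p) :=
  continuous_starMap p

theorem coeHom_smul (c : ℂ) (a : A) : coeHom p (c • a) = c • coeHom p a :=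
  Completion.coe_smul (X := p.Pre) c a

instance : CStarRing (CStarCompletion p) where
  norm_mul_self_le x := by
    have hs := continuous_star' p
    induction x using induct p with
    | hc => exact isClosed_le (by fun_prop) (by fun_prop)
    | h a => rw [star_coeHom, ← map_mul, norm_coeHom, norm_coeHom]; exact (p.star_mul_self a).ge

instance [StarModule ℂ A] : StarModule ℂ (CStarCompletion p) where
  star_smul c x := by
    have hs := continuous_star' p
    induction x using induct p with
    | hc =>
      exact isClosed_eq (hs.comp (continuous_const_smul c)) ((continuous_const_smul (star c)).comp hs)
    | h a => rw [← coeHom_smul, star_coeHom, star_coeHom, star_smul, coeHom_smul]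

instance [StarModule ℂ A] : CStarAlgebra (CStarCompletion p) where

/-- The canonical `*`-homomorphism of `A` into its completion. -/
def of [StarModule ℂ A] : A →⋆ₐ[ℂ] CStarCompletion p where
  __ := coeHom p
  commutes' _ := rfl
  map_star' a := (star_coeHom p a).symm

theorem norm_of [StarModule ℂ A] (a : A) : ‖of p a‖ = p a := norm_coeHom p a

theorem denseRange_of [StarModule ℂ A] : DenseRange (of p) := denseRange_coeHom p

open scoped CStarAlgebra in
/-- Two `*`-homomorphisms that agree on the image of `A` are equal. -/
theorem hom_ext [StarModule ℂ A] {p : CStarSeminorm A} {D : Type v} [CStarAlgebra D] {f g : CStarCompletion p →⋆ₐ[ℂ] D}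
    (h : ∀ a, f (of p a) = g (of p a)) : f = g := by
  ext x
  induction x using induct p with
  | hc => exact isClosed_eq (map_continuous f) (map_continuous g)
  | h a => exact h a

section lift

variable {p : CStarSeminorm A} {D : Type v} [CStarAlgebra D]

/-- The map underlying `lift`. -/
def liftFun (f : A →⋆ₐ[ℂ] D) : CStarCompletion p → D :=
  Completion.extension (α := p.Pre) (fun a => f (show A from a))

theorem continuous_liftFun (f : A →⋆ₐ[ℂ] D) : Continuous (liftFun (p := p) f) :=
  Completion.continuous_extension

theorem liftFun_coeHom (f : A →⋆ₐ[ℂ] D) (hf : ∀ a, ‖f a‖ ≤ p a) (a : A) :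
    liftFun f (coeHom p a) = f a := by
  refine Completion.extension_coe (α := p.Pre) (f := fun a => f (show A from a)) ?_ a
  refine (LipschitzWith.of_dist_le_mul (K := 1) fun a b => ?_).uniformContinuous
  rw [dist_eq_norm, dist_eq_norm, NNReal.coe_one, one_mul]
  exact (congrArg norm (map_sub f (show A from a) (show A from b))).ge.trans (hf _)

/-- A `*`-homomorphism on `A` that is dominated by `p` extends to the completion. -/
def lift [StarModule ℂ A] (f : A →⋆ₐ[ℂ] D) (hf : ∀ a, ‖f a‖ ≤ p a) : CStarCompletion p →⋆ₐ[ℂ] D where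
  toFun := liftFun f
  map_one' := by rw [← map_one (coeHom p), liftFun_coeHom f hf, map_one]
  map_zero' := by rw [← map_zero (coeHom p), liftFun_coeHom f hf, map_zero]
  map_mul' x y := by
    have hs := continuous_liftFun (p := p) f
    induction x using induct p with
    | hc => exact isClosed_eq (by fun_prop) (by fun_prop)
    | h a =>
      induction y using induct p with
      | hc => exact isClosed_eq (by fun_prop) (by fun_prop)
      | h b => rw [← map_mul, liftFun_coeHom f hf, liftFun_coeHom f hf, liftFun_coeHom f hf, map_mul]
  map_add' x y := by
    have hs := continuous_liftFun (p := p) f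
    induction x using induct p with
    | hc => exact isClosed_eq (by fun_prop) (by fun_prop)
    | h a =>
      induction y using induct p with
      | hc => exact isClosed_eq (by fun_prop) (by fun_prop)
      | h b => rw [← map_add, liftFun_coeHom f hf, liftFun_coeHom f hf, liftFun_coeHom f hf, map_add]
  commutes' c := (liftFun_coeHom f hf (algebraMap ℂ A c)).trans (AlgHomClass.commutes f c)
  map_star' x := by
    have hs := continuous_liftFun (p := p) f
    have ht := continuous_star' p
    induction x using induct p with
    | hc => exact isClosed_eq (by fun_prop) (by fun_prop)
    | h a => rw [star_coeHom]; simp only [liftFun_coeHom f hf, map_star]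

theorem lift_of [StarModule ℂ A] (f : A →⋆ₐ[ℂ] D) (hf : ∀ a, ‖f a‖ ≤ p a) (a : A) : lift f hf (of p a) = f a :=
  liftFun_coeHom f hf a

end lift

end CStarCompletion

/-! ### Suprema of `C*`-seminorms -/

namespace CStarSeminorm

variable {A : Type u} [Ring A] [StarRing A] [Algebra ℂ A]

/-- The pointwise supremum of a pointwise bounded set of `C*`-seminorms. -/
def sup (S : Set (CStarSeminorm A)) (hS : ∀ a, BddAbove (Set.range fun p : S => p.1 a)) :
    CStarSeminorm A where
  toFun a := ⨆ p : S, p.1 a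
  map_zero' := by simp
  add_le' a b := by
    refine Real.iSup_le (fun p => ?_) (add_nonneg
      (Real.iSup_nonneg fun p => apply_nonneg p.1.toSeminorm a)
      (Real.iSup_nonneg fun p => apply_nonneg p.1.toSeminorm b))
    exact (map_add_le_add p.1.toSeminorm a b).trans
      (add_le_add (le_ciSup (hS a) p) (le_ciSup (hS b) p))
  neg' a := by simp
  smul' c a := by
    simp only [map_smul_eq_mul]
    exact (Real.mul_iSup_of_nonneg (norm_nonneg c) _).symm
  mul_le a b := by
    have ha := Real.iSup_nonneg fun p : S => apply_nonneg p.1.toSeminorm a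
    refine Real.iSup_le (fun p => ?_) (mul_nonneg ha
      (Real.iSup_nonneg fun p => apply_nonneg p.1.toSeminorm b))
    exact (p.1.mul_le a b).trans (mul_le_mul (le_ciSup (hS a) p) (le_ciSup (hS b) p)
      (apply_nonneg p.1.toSeminorm b) ha)
  star_mul_self a := by
    have ha := Real.iSup_nonneg fun p : S => apply_nonneg p.1.toSeminorm a
    have hs := Real.iSup_nonneg fun p : S => apply_nonneg p.1.toSeminorm (star a * a)
    have hp : ∀ p : S, p.1 (star a * a) = p.1 a * p.1 a := fun p => p.1.star_mul_self a
    apply le_antisymm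
    · refine Real.iSup_le (fun p => ?_) (mul_nonneg ha ha)
      exact (hp p).le.trans (mul_le_mul (le_ciSup (hS a) p) (le_ciSup (hS a) p)
        (apply_nonneg p.1.toSeminorm a) ha)
    · rw [← sq]
      refine (Real.le_sqrt ha hs).1 ?_
      refine Real.iSup_le (fun p => ?_) (Real.sqrt_nonneg _)
      refine Real.le_sqrt_of_sq_le ?_
      rw [sq, ← hp p]
      exact le_ciSup (hS (star a * a)) p

theorem le_sup {S : Set (CStarSeminorm A)} (hS : ∀ a, BddAbove (Set.range fun p : S => p.1 a))
    {p : CStarSeminorm A} (hp : p ∈ S) (a : A) : p a ≤ sup S hS a :=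
  le_ciSup (hS a) ⟨p, hp⟩

theorem sup_le {S : Set (CStarSeminorm A)} (hS : ∀ a, BddAbove (Set.range fun p : S => p.1 a))
    {a : A} {M : ℝ} (hM : 0 ≤ M) (h : ∀ p ∈ S, p a ≤ M) : sup S hS a ≤ M :=
  Real.iSup_le (fun p => h p.1 p.2) hM

/-- The `C*`-seminorm that a `*`-homomorphism into a `C*`-algebra induces. -/
def ofHom {D : Type v} [CStarAlgebra D] (f : A →⋆ₐ[ℂ] D) : CStarSeminorm A where
  toFun a := ‖f a‖
  map_zero' := by simp
  add_le' a b := by rw [map_add]; exact norm_add_le _ _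
  neg' a := by rw [map_neg, norm_neg]
  smul' c a := by rw [map_smul, norm_smul]
  mul_le a b := by rw [map_mul]; exact norm_mul_le _ _
  star_mul_self a := by rw [map_mul, StarHomClass.map_star]; exact CStarRing.norm_star_mul_self

theorem ofHom_apply {D : Type v} [CStarAlgebra D] (f : A →⋆ₐ[ℂ] D) (a : A) : ofHom f a = ‖f a‖ :=
  rfl

theorem map_one_le (p : CStarSeminorm A) : p 1 ≤ 1 := by
  have h := p.star_mul_self 1
  change p (star 1 * 1) = p 1 * p 1 at h
  rw [star_one, mul_one] at h
  nlinarith [sq_nonneg (p 1 - 1), apply_nonneg p.toSeminorm (1 : A)]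

/-- On a free `*`-algebra, `C*`-seminorms that are uniformly bounded on each generator are
uniformly bounded on each element. -/
theorem bddAbove_of_gen {X : Type u} {S : Set (CStarSeminorm (FreeStarAlg X))} (M : X → ℝ)
    (hM : ∀ p ∈ S, ∀ x, p (FreeStarAlg.gen x) ≤ M x) (a : FreeStarAlg X) :
    BddAbove (Set.range fun p : S => p.1 a) := by
  suffices h : ∃ C : ℝ, 0 ≤ C ∧ ∀ p ∈ S, p a ≤ C by
    obtain ⟨C, -, hC⟩ := h
    exact ⟨C, by rintro _ ⟨p, rfl⟩; exact hC p.1 p.2⟩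
  induction a using FreeStarAlg.induction with
  | hc c =>
    refine ⟨‖c‖, norm_nonneg c, fun p _ => ?_⟩
    rw [Algebra.algebraMap_eq_smul_one, map_smul_eq_mul]
    exact mul_le_of_le_one_right (norm_nonneg c) p.map_one_le
  | hs s =>
    rcases s with x | x
    · exact ⟨max (M x) 0, le_max_right _ _, fun p hp => (hM p hp x).trans (le_max_left _ _)⟩
    · refine ⟨max (M x) 0, le_max_right _ _, fun p hp => ?_⟩
      rw [FreeStarAlg.sym_inr, p.map_star]
      exact (hM p hp x).trans (le_max_left _ _)
  | hmul a b ha hb =>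
    obtain ⟨C, hC0, hC⟩ := ha
    obtain ⟨E, hE0, hE⟩ := hb
    exact ⟨C * E, mul_nonneg hC0 hE0, fun p hp => (p.mul_le a b).trans
      (mul_le_mul (hC p hp) (hE p hp) (apply_nonneg p.toSeminorm b) hC0)⟩
  | hadd a b ha hb =>
    obtain ⟨C, hC0, hC⟩ := ha
    obtain ⟨E, hE0, hE⟩ := hb
    exact ⟨C + E, add_nonneg hC0 hE0, fun p hp => (map_add_le_add p.toSeminorm a b).trans
      (add_le_add (hC p hp) (hE p hp))⟩

end CStarSeminorm

/-! ### Operators on `ℓ²` -/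

/-- The Hilbert space `ℓ²(ι)`. -/
abbrev Ell2 (ι : Type u) : Type u := lp (fun _ : ι => ℂ) 2

/-- The bounded operators on `ℓ²(ι)`. -/
abbrev BEll2 (ι : Type u) : Type u := Ell2 ι →L[ℂ] Ell2 ι

instance (ι : Type u) : CStarAlgebra (BEll2 ι) := inferInstance

namespace Ell2

variable {ι κ : Type u}

theorem memℓp_iff (f : ι → ℂ) : Memℓp f 2 ↔ Summable fun i => ‖f i‖ ^ 2 := by
  rw [memℓp_gen_iff (by norm_num)]
  simp

theorem summable_sq (f : Ell2 ι) : Summable fun i => ‖f i‖ ^ 2 := (memℓp_iff _).1 (lp.memℓp f)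

theorem norm_sq (f : Ell2 ι) : ‖f‖ ^ 2 = ∑' i, ‖f i‖ ^ 2 := by
  have h := lp.norm_rpow_eq_tsum (p := 2) (by norm_num) f
  simpa using h

/-- For a bijection `e : ι ≃ κ` and `w : κ → 𝕋`, the unitary that maps the basis vector `δ_i` to
`w (e i) • δ_{e i}`. -/
def monomial (e : ι ≃ κ) (w : κ → Circle) : Ell2 ι ≃ₗᵢ[ℂ] Ell2 κ where
  toFun f := ⟨fun k => (w k : ℂ) * f (e.symm k), (memℓp_iff _).2 (by
    simpa [Function.comp_def, Circle.norm_coe] using e.symm.summable_iff.2 (summable_sq f))⟩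
  invFun g := ⟨fun i => ((w (e i))⁻¹ : Circle) * g (e i), (memℓp_iff _).2 (by
    simpa [Function.comp_def, Circle.norm_coe] using e.summable_iff.2 (summable_sq g))⟩
  left_inv f := by ext i; simp
  right_inv g := by ext k; simp
  map_add' f g := by ext k; exact mul_add _ _ _
  map_smul' c f := by ext k; simp [mul_left_comm]
  norm_map' f := by
    refine (sq_eq_sq₀ (norm_nonneg _) (norm_nonneg _)).1 ?_
    rw [norm_sq, norm_sq, ← e.symm.tsum_eq]
    simp [Circle.norm_coe]

theorem monomial_apply (e : ι ≃ κ) (w : κ → Circle) (f : Ell2 ι) (k : κ) :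
    monomial e w f k = (w k : ℂ) * f (e.symm k) := rfl

/-- The vector `f(·, k)` in `ℓ²(ι)` for a vector `f` in `ℓ²(ι × κ)`. -/
def slice (k : κ) : Ell2 (ι × κ) →ₗ[ℂ] Ell2 ι where
  toFun f := ⟨fun i => f (i, k), (memℓp_iff _).2
    ((summable_sq f).comp_injective (Prod.mk_left_injective k))⟩
  map_add' f g := by ext i; rfl
  map_smul' c f := by ext i; simp

theorem slice_apply (k : κ) (f : Ell2 (ι × κ)) (i : ι) : slice k f i = f (i, k) := rfl

theorem summable_swap (f : Ell2 (ι × κ)) : Summable fun x : κ × ι => ‖f (x.2, x.1)‖ ^ 2 := by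
  have h := (Equiv.prodComm κ ι).summable_iff.2 (summable_sq f)
  exact h

theorem summable_slice (f : Ell2 (ι × κ)) : Summable fun k => ‖slice k f‖ ^ 2 := by
  simp only [norm_sq, slice_apply]
  exact (summable_swap f).prod

theorem norm_sq_slice (f : Ell2 (ι × κ)) : ‖f‖ ^ 2 = ∑' k, ‖slice k f‖ ^ 2 := by
  simp only [norm_sq, slice_apply]
  rw [← (Equiv.prodComm κ ι).tsum_eq]
  exact (summable_swap f).tsum_prod

theorem summable_amp (T : BEll2 ι) (f : Ell2 (ι × κ)) :
    Summable fun x : κ × ι => ‖T (slice x.1 f) x.2‖ ^ 2 := by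
  have h0 : ∀ k, ∑' i, ‖T (slice k f) i‖ ^ 2 = ‖T (slice k f)‖ ^ 2 :=
    fun k => (norm_sq (T (slice k f))).symm
  have h1 : ∀ k, ‖T (slice k f)‖ ^ 2 ≤ ‖T‖ ^ 2 * ‖slice k f‖ ^ 2 := fun k => by
    rw [← mul_pow]
    exact pow_le_pow_left₀ (norm_nonneg _) (T.le_opNorm _) 2
  have h2 : Summable fun k => ‖T (slice k f)‖ ^ 2 :=
    Summable.of_nonneg_of_le (fun k => sq_nonneg _) h1 ((summable_slice f).mul_left (‖T‖ ^ 2))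
  have h3 : ∀ k, Summable fun i => ‖T (slice k f) i‖ ^ 2 := fun k => summable_sq (T (slice k f))
  have h4 : Summable fun k => ∑' i, ‖T (slice k f) i‖ ^ 2 := by
    simpa only [h0] using h2
  exact (summable_prod_of_nonneg (f := fun x : κ × ι => ‖T (slice x.1 f) x.2‖ ^ 2)
    (fun x => sq_nonneg _)).2 ⟨h3, h4⟩

theorem memℓp_amp (T : BEll2 ι) (f : Ell2 (ι × κ)) :
    Memℓp (fun x : ι × κ => T (slice x.2 f) x.1) 2 := by
  rw [memℓp_iff]
  have h := (Equiv.prodComm ι κ).summable_iff.2 (summable_amp T f)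
  exact h

/-- The linear map underlying `amp`. -/
def ampLin (κ : Type u) (T : BEll2 ι) : Ell2 (ι × κ) →ₗ[ℂ] Ell2 (ι × κ) where
  toFun f := ⟨fun x => T (slice x.2 f) x.1, memℓp_amp T f⟩
  map_add' f g := by
    ext x
    have h : T (slice x.2 (f + g)) = T (slice x.2 f) + T (slice x.2 g) := by rw [map_add, map_add]
    exact congrArg (fun v : Ell2 ι => v x.1) h
  map_smul' c f := by
    ext x
    have h : T (slice x.2 (c • f)) = c • T (slice x.2 f) := by rw [map_smul, map_smul]
    exact congrArg (fun v : Ell2 ι => v x.1) h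

theorem slice_ampLin (T : BEll2 ι) (f : Ell2 (ι × κ)) (k : κ) :
    slice k (ampLin κ T f) = T (slice k f) := rfl

theorem norm_ampLin_le (T : BEll2 ι) (f : Ell2 (ι × κ)) : ‖ampLin κ T f‖ ≤ ‖T‖ * ‖f‖ := by
  refine (sq_le_sq₀ (norm_nonneg _) (mul_nonneg (norm_nonneg _) (norm_nonneg _))).1 ?_
  rw [mul_pow, norm_sq_slice, norm_sq_slice f, ← tsum_mul_left]
  refine Summable.tsum_le_tsum (fun k => ?_) (summable_slice _) ((summable_slice f).mul_left _)
  rw [slice_ampLin, ← mul_pow]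
  exact pow_le_pow_left₀ (norm_nonneg _) (T.le_opNorm _) 2

theorem ext_slice {f g : Ell2 (ι × κ)} (h : ∀ k, slice k f = slice k g) : f = g := by
  ext ⟨i, k⟩
  exact congrArg (fun v : Ell2 ι => v i) (h k)

theorem inner_slice (f g : Ell2 (ι × κ)) :
    inner ℂ f g = ∑' k, inner ℂ (slice k f) (slice k g) := by
  have hs : Summable fun x : κ × ι => inner ℂ (f (x.2, x.1)) (g (x.2, x.1)) := by
    have h := (Equiv.prodComm κ ι).summable_iff.2 (lp.summable_inner (𝕜 := ℂ) f g)
    exact h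
  simp only [lp.inner_eq_tsum, slice_apply]
  rw [← (Equiv.prodComm κ ι).tsum_eq]
  exact hs.tsum_prod

/-- The bounded operator underlying `amp`. -/
def ampCLM (κ : Type u) (T : BEll2 ι) : BEll2 (ι × κ) :=
  (ampLin κ T).mkContinuous ‖T‖ (norm_ampLin_le T)

theorem slice_ampCLM (T : BEll2 ι) (f : Ell2 (ι × κ)) (k : κ) :
    slice k (ampCLM κ T f) = T (slice k f) := slice_ampLin T f k

theorem ampCLM_ext {S : BEll2 ι} {R : BEll2 (ι × κ)}
    (h : ∀ f k, slice k (R f) = S (slice k f)) : ampCLM κ S = R :=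
  ContinuousLinearMap.ext fun f => ext_slice fun k => by rw [slice_ampCLM, h]

theorem ampCLM_star (T : BEll2 ι) : ampCLM κ (star T) = star (ampCLM κ T) := by
  rw [ContinuousLinearMap.star_eq_adjoint, ContinuousLinearMap.star_eq_adjoint,
    ContinuousLinearMap.eq_adjoint_iff]
  intro f g
  rw [inner_slice, inner_slice]
  have h : ∀ k, inner ℂ (slice k (ampCLM κ (ContinuousLinearMap.adjoint T) f)) (slice k g) =
      inner ℂ (slice k f) (slice k (ampCLM κ T g)) := fun k => by
    rw [slice_ampCLM, slice_ampCLM, ContinuousLinearMap.adjoint_inner_left]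
  exact tsum_congr h

theorem ampCLM_one : ampCLM κ (1 : BEll2 ι) = 1 := ampCLM_ext fun f k => by
    rw [one_apply_eq_self, one_apply_eq_self]

theorem ampCLM_mul (S T : BEll2 ι) : ampCLM κ (S * T) = ampCLM κ S * ampCLM κ T :=
  ampCLM_ext fun f k => by
    rw [mul_apply_eq_comp, mul_apply_eq_comp, slice_ampCLM, slice_ampCLM]

theorem ampCLM_add (S T : BEll2 ι) : ampCLM κ (S + T) = ampCLM κ S + ampCLM κ T :=
  ampCLM_ext fun f k => by
    rw [add_apply, add_apply, map_add, slice_ampCLM, slice_ampCLM]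

theorem ampCLM_smul_one (c : ℂ) : ampCLM κ (c • (1 : BEll2 ι)) = c • (1 : BEll2 (ι × κ)) :=
  ampCLM_ext fun f k => by
    rw [smul_apply, smul_apply, one_apply_eq_self, one_apply_eq_self, map_smul]

/-- The operator `T ⊗ 1` on `ℓ²(ι × κ) = ℓ²(ι) ⊗ ℓ²(κ)` for an operator `T` on `ℓ²(ι)`. -/
def amp (κ : Type u) : BEll2 ι →⋆ₐ[ℂ] BEll2 (ι × κ) where
  toFun T := ampCLM κ T
  map_one' := ampCLM_one
  map_mul' := ampCLM_mul
  map_zero' := by simpa using ampCLM_smul_one (ι := ι) (κ := κ) 0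
  map_add' := ampCLM_add
  commutes' c := by
    rw [Algebra.algebraMap_eq_smul_one, Algebra.algebraMap_eq_smul_one, ampCLM_smul_one]
  map_star' := ampCLM_star

theorem amp_apply (T : BEll2 ι) (f : Ell2 (ι × κ)) (i : ι) (k : κ) :
    amp κ T f (i, k) = T (slice k f) i :=
  congrArg (fun v : Ell2 ι => v i) (slice_ampCLM T f k)

end Ell2

/-! ### Universal `C*`-algebras -/

/-- The `C*`-algebra generated by `X` that is universal for the set `S` of `C*`-seminorms on the
free `*`-algebra: the completion in the supremum of all seminorms in `S`. -/
abbrev UnivAlg {X : Type u} (S : Set (CStarSeminorm (FreeStarAlg X)))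
    (hS : ∀ a, BddAbove (Set.range fun p : S => p.1 a)) : Type u :=
  CStarCompletion (CStarSeminorm.sup S hS)

namespace UnivAlg

variable {X : Type u} (S : Set (CStarSeminorm (FreeStarAlg X)))
  (hS : ∀ a, BddAbove (Set.range fun p : S => p.1 a))

/-- The canonical `*`-homomorphism from the free `*`-algebra. -/
def of : FreeStarAlg X →⋆ₐ[ℂ] UnivAlg S hS := CStarCompletion.of (CStarSeminorm.sup S hS)

theorem norm_of (a : FreeStarAlg X) : ‖of S hS a‖ = CStarSeminorm.sup S hS a :=
  CStarCompletion.norm_of _ a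

theorem of_eq_of {a b : FreeStarAlg X} (h : ∀ p ∈ S, p (a - b) = 0) : of S hS a = of S hS b := by
  rw [← sub_eq_zero, ← map_sub, ← norm_le_zero_iff, norm_of]
  exact CStarSeminorm.sup_le hS le_rfl fun p hp => (h p hp).le

/-- A map `f` from a `*`-algebra `B` to the generators induces a `*`-homomorphism on `B`
provided it does so in each of the seminorms in `S`. -/
def leg {B : Type v} [CStarAlgebra B] (f : B → X)
    (h : ∀ p ∈ S, ∃ (D : Type u) (_ : CStarAlgebra D) (H : FreeStarAlg X →⋆ₐ[ℂ] D)
      (g : B →⋆ₐ[ℂ] D), p = CStarSeminorm.ofHom H ∧ ∀ b, H (FreeStarAlg.gen (f b)) = g b) :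
    B →⋆ₐ[ℂ] UnivAlg S hS where
  toFun b := of S hS (FreeStarAlg.gen (f b))
  map_one' := by
    rw [← map_one (of S hS)]
    refine of_eq_of S hS fun p hp => ?_
    obtain ⟨D, _, H, g, rfl, hg⟩ := h p hp
    simp [CStarSeminorm.ofHom_apply, hg]
  map_mul' a b := by
    rw [← map_mul (of S hS)]
    refine of_eq_of S hS fun p hp => ?_
    obtain ⟨D, _, H, g, rfl, hg⟩ := h p hp
    simp [CStarSeminorm.ofHom_apply, hg]
  map_zero' := by
    rw [← map_zero (of S hS)]
    refine of_eq_of S hS fun p hp => ?_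
    obtain ⟨D, _, H, g, rfl, hg⟩ := h p hp
    simp [CStarSeminorm.ofHom_apply, hg]
  map_add' a b := by
    rw [← map_add (of S hS)]
    refine of_eq_of S hS fun p hp => ?_
    obtain ⟨D, _, H, g, rfl, hg⟩ := h p hp
    simp [CStarSeminorm.ofHom_apply, hg]
  commutes' c := by
    rw [← AlgHomClass.commutes (of S hS)]
    refine of_eq_of S hS fun p hp => ?_
    obtain ⟨D, _, H, g, rfl, hg⟩ := h p hp
    rw [CStarSeminorm.ofHom_apply, map_sub, hg, AlgHomClass.commutes, AlgHomClass.commutes,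
      sub_self, norm_zero]
  map_star' b := by
    rw [← map_star (of S hS)]
    refine of_eq_of S hS fun p hp => ?_
    obtain ⟨D, _, H, g, rfl, hg⟩ := h p hp
    rw [CStarSeminorm.ofHom_apply, map_sub, map_star, hg, hg, map_star, sub_self, norm_zero]

variable {S hS}

theorem leg_apply {B : Type v} [CStarAlgebra B] (f : B → X)
    (h : ∀ p ∈ S, ∃ (D : Type u) (_ : CStarAlgebra D) (H : FreeStarAlg X →⋆ₐ[ℂ] D)
      (g : B →⋆ₐ[ℂ] D), p = CStarSeminorm.ofHom H ∧ ∀ b, H (FreeStarAlg.gen (f b)) = g b)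
    (b : B) : leg S hS f h b = of S hS (FreeStarAlg.gen (f b)) := rfl

/-- The `*`-homomorphism with given values `f` on the generators. -/
def lift {D : Type v} [CStarAlgebra D] (f : X → D)
    (hf : ∀ a, ‖FreeStarAlg.lift f a‖ ≤ CStarSeminorm.sup S hS a) : UnivAlg S hS →⋆ₐ[ℂ] D :=
  CStarCompletion.lift (FreeStarAlg.lift f) hf

theorem lift_gen {D : Type v} [CStarAlgebra D] (f : X → D)
    (hf : ∀ a, ‖FreeStarAlg.lift f a‖ ≤ CStarSeminorm.sup S hS a) (x : X) :
    lift f hf (of S hS (FreeStarAlg.gen x)) = f x :=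
  (CStarCompletion.lift_of _ hf _).trans (FreeStarAlg.lift_gen f x)

theorem hom_ext {D : Type v} [CStarAlgebra D] {f g : UnivAlg S hS →⋆ₐ[ℂ] D}
    (h : ∀ x, f (of S hS (FreeStarAlg.gen x)) = g (of S hS (FreeStarAlg.gen x))) : f = g :=
  CStarCompletion.hom_ext (f := f) (g := g) fun a =>
    DFunLike.congr_fun (FreeStarAlg.hom_ext (f := f.comp (of S hS)) (g := g.comp (of S hS)) h) a

end UnivAlg

/-! ### Circle actions and covariant representations -/

/-- A continuous action of the circle group on a unital `C*`-algebra by `*`-automorphisms. -/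
structure CircleAction (B : Type u) [CStarAlgebra B] where
  /-- The automorphism by which an element of the circle acts. -/
  act : Circle → B →⋆ₐ[ℂ] B
  act_one : ∀ b, act 1 b = b
  act_mul : ∀ z w b, act (z * w) b = act z (act w b)
  continuous_act : ∀ b, Continuous fun z => act z b

/-- Equivariance of a `*`-homomorphism with respect to circle actions. -/
def Equivariant {B C : Type u} [CStarAlgebra B] [CStarAlgebra C] (β : CircleAction B)
    (γ : CircleAction C) (f : B →⋆ₐ[ℂ] C) : Prop :=
  ∀ z b, f (β.act z b) = γ.act z (f b)

theorem CircleAction.equivariant_act {B : Type u} [CStarAlgebra B] (β : CircleAction B)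
    (z : Circle) : Equivariant β β (β.act z) := fun w b => by
  rw [← β.act_mul, ← β.act_mul, mul_comm]

/-- The unitary representation `ρ` of the circle on `ℓ²(ι)` for which `δ_i` is homogeneous of
degree `deg i`: `ρ_z δ_i = z ^ deg i • δ_i`. -/
def rotation {ι : Type u} (deg : ι → ℤ) (z : Circle) : Ell2 ι ≃ₗᵢ[ℂ] Ell2 ι :=
  Ell2.monomial (Equiv.refl ι) fun i => z ^ deg i

/-- A covariant representation of a `C*`-algebra with circle action: a `*`-representation on a
Hilbert space with a representation of the circle that implements the action. The Hilbert space
is written as `ℓ²(ι)` through an orthonormal basis of homogeneous vectors. -/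
structure CovRep {B : Type u} [CStarAlgebra B] (β : CircleAction B) where
  /-- The index set of the orthonormal basis. -/
  ι : Type u
  /-- The degrees of the basis vectors. -/
  deg : ι → ℤ
  /-- The representation of the `C*`-algebra. -/
  rep : B →⋆ₐ[ℂ] BEll2 ι
  covariant : ∀ z b, rep (β.act z b) = (rotation deg z).conjStarAlgEquiv (rep b)

/-- The pullback of a covariant representation along an equivariant `*`-homomorphism. -/
def CovRep.comap {B C : Type u} [CStarAlgebra B] [CStarAlgebra C] {β : CircleAction B}
    {γ : CircleAction C} (R : CovRep γ) (f : B →⋆ₐ[ℂ] C) (hf : Equivariant β γ f) : CovRep β where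
  ι := R.ι
  deg := R.deg
  rep := R.rep.comp f
  covariant z b := by
    rw [StarAlgHom.comp_apply, hf, R.covariant, StarAlgHom.comp_apply]

/-! ### The braided tensor product -/

/-- The braiding unitary `ℓ²(κ) ⊗ ℓ²(ι) → ℓ²(ι) ⊗ ℓ²(κ)`,
`δ_k ⊗ δ_i ↦ ζ ^ (deg k * deg i) • δ_i ⊗ δ_k`. -/
def braiding (ζ : Circle) {ι κ : Type u} (l : ι → ℤ) (m : κ → ℤ) :
    Ell2 (κ × ι) ≃ₗᵢ[ℂ] Ell2 (ι × κ) :=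
  Ell2.monomial (Equiv.prodComm κ ι) fun x => ζ ^ (m x.2 * l x.1)

/-- The first leg in `ℓ²(ι) ⊗ ℓ²(κ)`: the operator `T ⊗ 1`. -/
def leg₁ {ι : Type u} (κ : Type u) : BEll2 ι →⋆ₐ[ℂ] BEll2 (ι × κ) := Ell2.amp κ

/-- The braided second leg in `ℓ²(ι) ⊗ ℓ²(κ)`: the operator `T ⊗ 1` on `ℓ²(κ) ⊗ ℓ²(ι)`, conjugated
by the braiding unitary. -/
def leg₂ (ζ : Circle) {ι κ : Type u} (l : ι → ℤ) (m : κ → ℤ) : BEll2 κ →⋆ₐ[ℂ] BEll2 (ι × κ) :=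
  ((braiding ζ l m).conjStarAlgEquiv : BEll2 (κ × ι) →⋆ₐ[ℂ] BEll2 (ι × κ)).comp (Ell2.amp ι)

section BraidedTensor

variable {B C : Type u} [CStarAlgebra B] [CStarAlgebra C]

/-- The joint representation of `B` and `C` on `ℓ²(ι) ⊗ ℓ²(κ)` for covariant representations of
`B` on `ℓ²(ι)` and of `C` on `ℓ²(κ)`. -/
def pairHom (ζ : Circle) {β : CircleAction B} {γ : CircleAction C} (R : CovRep β) (S : CovRep γ) :
    FreeStarAlg (B ⊕ C) →⋆ₐ[ℂ] BEll2 (R.ι × S.ι) :=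
  FreeStarAlg.lift (Sum.elim (fun b => leg₁ S.ι (R.rep b)) fun c => leg₂ ζ R.deg S.deg (S.rep c))

/-- The `C*`-seminorms that come from pairs of covariant representations. -/
def pairSeminorms (ζ : Circle) (β : CircleAction B) (γ : CircleAction C) :
    Set (CStarSeminorm (FreeStarAlg (B ⊕ C))) :=
  {p | ∃ (R : CovRep β) (S : CovRep γ), p = CStarSeminorm.ofHom (pairHom ζ R S)}

theorem bddAbove_pairSeminorms (ζ : Circle) (β : CircleAction B) (γ : CircleAction C) :
    ∀ a, BddAbove (Set.range fun p : pairSeminorms ζ β γ => p.1 a) := by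
  refine CStarSeminorm.bddAbove_of_gen (Sum.elim (fun b => ‖b‖) fun c => ‖c‖) ?_
  rintro p ⟨R, S, rfl⟩ (b | c)
  · rw [CStarSeminorm.ofHom_apply, pairHom, FreeStarAlg.lift_gen]
    exact NonUnitalStarAlgHom.norm_apply_le ((leg₁ S.ι).comp R.rep) b
  · rw [CStarSeminorm.ofHom_apply, pairHom, FreeStarAlg.lift_gen]
    exact NonUnitalStarAlgHom.norm_apply_le ((leg₂ ζ R.deg S.deg).comp S.rep) c

/-- The braided tensor product `B ⊠_ζ C` of two `C*`-algebras with circle actions: the `C*`-algebra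
generated by the two legs in the spatial norm, that is, the supremum of the norms in all joint
representations on `ℓ²(ι) ⊗ ℓ²(κ)` for covariant representations of `B` on `ℓ²(ι)` and of `C`
on `ℓ²(κ)`. -/
abbrev BraidedTensor (ζ : Circle) (β : CircleAction B) (γ : CircleAction C) : Type u :=
  UnivAlg (pairSeminorms ζ β γ) (bddAbove_pairSeminorms ζ β γ)

namespace BraidedTensor

variable (ζ : Circle) (β : CircleAction B) (γ : CircleAction C)

/-- The canonical embedding of the first factor. -/
def j₁ : B →⋆ₐ[ℂ] BraidedTensor ζ β γ :=
  UnivAlg.leg _ (bddAbove_pairSeminorms ζ β γ) Sum.inl (by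
    rintro p ⟨R, S, rfl⟩
    exact ⟨_, _, pairHom ζ R S, (leg₁ S.ι).comp R.rep, rfl, fun b => FreeStarAlg.lift_gen _ _⟩)

/-- The canonical embedding of the second factor. -/
def j₂ : C →⋆ₐ[ℂ] BraidedTensor ζ β γ :=
  UnivAlg.leg _ (bddAbove_pairSeminorms ζ β γ) Sum.inr (by
    rintro p ⟨R, S, rfl⟩
    exact ⟨_, _, pairHom ζ R S, (leg₂ ζ R.deg S.deg).comp S.rep, rfl,
      fun b => FreeStarAlg.lift_gen _ _⟩)

variable {β γ} {B' C' : Type u} [CStarAlgebra B'] [CStarAlgebra C'] {β' : CircleAction B'}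
  {γ' : CircleAction C'}

/-- The `*`-homomorphism `f ⊠ g` for equivariant `*`-homomorphisms `f` and `g`. -/
def map (f : B →⋆ₐ[ℂ] B') (hf : Equivariant β β' f) (g : C →⋆ₐ[ℂ] C') (hg : Equivariant γ γ' g) :
    BraidedTensor ζ β γ →⋆ₐ[ℂ] BraidedTensor ζ β' γ' :=
  UnivAlg.lift (S := pairSeminorms ζ β γ) (hS := bddAbove_pairSeminorms ζ β γ)
    (Sum.elim (fun b => j₁ ζ β' γ' (f b)) fun c => j₂ ζ β' γ' (g c)) (by
    intro a
    let F : FreeStarAlg (B ⊕ C) →⋆ₐ[ℂ] FreeStarAlg (B' ⊕ C') :=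
      FreeStarAlg.lift fun x => FreeStarAlg.gen (Sum.map f g x)
    have h1 : FreeStarAlg.lift (Sum.elim (fun b => j₁ ζ β' γ' (f b)) fun c => j₂ ζ β' γ' (g c)) =
        (UnivAlg.of _ (bddAbove_pairSeminorms ζ β' γ')).comp F := by
      refine FreeStarAlg.hom_ext fun x => ?_
      rw [FreeStarAlg.lift_gen, StarAlgHom.comp_apply, FreeStarAlg.lift_gen]
      rcases x with b | c <;> rfl
    rw [h1]
    refine (UnivAlg.norm_of _ (bddAbove_pairSeminorms ζ β' γ') (F a)).le.trans ?_
    refine CStarSeminorm.sup_le _ (apply_nonneg (CStarSeminorm.sup _ _).toSeminorm a) ?_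
    rintro p ⟨R, S, rfl⟩
    have h2 : (pairHom ζ R S).comp F = FreeStarAlg.lift
        (Sum.elim (fun b => leg₁ S.ι (R.rep (f b))) fun c => leg₂ ζ R.deg S.deg (S.rep (g c))) := by
      refine FreeStarAlg.hom_ext fun x => ?_
      rw [StarAlgHom.comp_apply, FreeStarAlg.lift_gen, pairHom, FreeStarAlg.lift_gen,
        FreeStarAlg.lift_gen]
      rcases x with b | c <;> rfl
    have h3 := CStarSeminorm.le_sup (bddAbove_pairSeminorms ζ β γ)
      (⟨R.comap f hf, S.comap g hg, rfl⟩ :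
        CStarSeminorm.ofHom (pairHom ζ (R.comap f hf) (S.comap g hg)) ∈ pairSeminorms ζ β γ) a
    have h4 := congrArg (fun H : FreeStarAlg (B ⊕ C) →⋆ₐ[ℂ] BEll2 (R.ι × S.ι) => ‖H a‖) h2
    exact h4.le.trans h3)

theorem map_j₁ (f : B →⋆ₐ[ℂ] B') (hf : Equivariant β β' f) (g : C →⋆ₐ[ℂ] C')
    (hg : Equivariant γ γ' g) (b : B) : map ζ f hf g hg (j₁ ζ β γ b) = j₁ ζ β' γ' (f b) :=
  UnivAlg.lift_gen (S := pairSeminorms ζ β γ) (hS := bddAbove_pairSeminorms ζ β γ) _ _ (Sum.inl b)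

theorem map_j₂ (f : B →⋆ₐ[ℂ] B') (hf : Equivariant β β' f) (g : C →⋆ₐ[ℂ] C')
    (hg : Equivariant γ γ' g) (c : C) : map ζ f hf g hg (j₂ ζ β γ c) = j₂ ζ β' γ' (g c) :=
  UnivAlg.lift_gen (S := pairSeminorms ζ β γ) (hS := bddAbove_pairSeminorms ζ β γ) _ _ (Sum.inr c)

end BraidedTensor

end BraidedTensor

/-- In a covariant representation, the braided second leg is `∑_i p_i ⊗ β_{ζ ^ l i}(b)` with the
projections `p_i` onto the basis vectors of the first factor. -/
theorem leg₂_rep_apply (ζ : Circle) {B : Type u} [CStarAlgebra B] {β : CircleAction B}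
    (R : CovRep β) {κ : Type u} (l : κ → ℤ) (b : B) (f : Ell2 (κ × R.ι)) (i : κ) (k : R.ι) :
    leg₂ ζ l R.deg (R.rep b) f (i, k) =
      R.rep (β.act (ζ ^ l i) b)
        (Ell2.slice i (Ell2.monomial (Equiv.prodComm κ R.ι) (fun _ => 1) f)) k := by
  rw [R.covariant]
  have h : Ell2.slice i ((braiding ζ l R.deg).symm f) = (rotation R.deg (ζ ^ l i)).symm
      (Ell2.slice i (Ell2.monomial (Equiv.prodComm κ R.ι) (fun _ => 1) f)) := by
    rw [LinearIsometryEquiv.eq_symm_apply]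
    ext m
    have h1 : (braiding ζ l R.deg) ((braiding ζ l R.deg).symm f) (i, m) = f (i, m) := by
      rw [LinearIsometryEquiv.apply_symm_apply]
    have h2 : ((ζ ^ (R.deg m * l i) : Circle) : ℂ) * (braiding ζ l R.deg).symm f (m, i) =
        f (i, m) := h1
    have h3 : ((1 : Circle) : ℂ) * f (i, m) = f (i, m) := by rw [Circle.coe_one, one_mul]
    have h4 : ζ ^ (R.deg m * l i) = (ζ ^ l i) ^ R.deg m := by rw [← zpow_mul, mul_comm]
    rw [h4] at h2
    exact h2.trans h3.symm
  change ((ζ ^ (R.deg k * l i) : Circle) : ℂ) *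
      R.rep b (Ell2.slice i ((braiding ζ l R.deg).symm f)) k =
    (((ζ ^ l i) ^ R.deg k : Circle) : ℂ) * R.rep b ((rotation R.deg (ζ ^ l i)).symm _) k
  rw [h, ← zpow_mul, mul_comm (l i)]

section BraidedTensor₃

variable {B C D : Type u} [CStarAlgebra B] [CStarAlgebra C] [CStarAlgebra D]

/-- The joint representation of `B`, `C` and `D` on `ℓ²(ι) ⊗ ℓ²(κ) ⊗ ℓ²(μ)` for three covariant
representations. The circle acts diagonally on `ℓ²(ι) ⊗ ℓ²(κ)`. -/
def tripleHom (ζ : Circle) {β : CircleAction B} {γ : CircleAction C} {δ : CircleAction D}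
    (R : CovRep β) (S : CovRep γ) (T : CovRep δ) :
    FreeStarAlg (B ⊕ C ⊕ D) →⋆ₐ[ℂ] BEll2 ((R.ι × S.ι) × T.ι) :=
  FreeStarAlg.lift (Sum.elim (fun b => leg₁ T.ι (leg₁ S.ι (R.rep b)))
    (Sum.elim (fun c => leg₁ T.ι (leg₂ ζ R.deg S.deg (S.rep c)))
      fun d => leg₂ ζ (fun x : R.ι × S.ι => R.deg x.1 + S.deg x.2) T.deg (T.rep d)))

/-- The `C*`-seminorms that come from triples of covariant representations. -/
def tripleSeminorms (ζ : Circle) (β : CircleAction B) (γ : CircleAction C) (δ : CircleAction D) :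
    Set (CStarSeminorm (FreeStarAlg (B ⊕ C ⊕ D))) :=
  {p | ∃ (R : CovRep β) (S : CovRep γ) (T : CovRep δ),
    p = CStarSeminorm.ofHom (tripleHom ζ R S T)}

theorem bddAbove_tripleSeminorms (ζ : Circle) (β : CircleAction B) (γ : CircleAction C)
    (δ : CircleAction D) :
    ∀ a, BddAbove (Set.range fun p : tripleSeminorms ζ β γ δ => p.1 a) := by
  refine CStarSeminorm.bddAbove_of_gen
    (Sum.elim (fun b => ‖b‖) (Sum.elim (fun c => ‖c‖) fun d => ‖d‖)) ?_
  rintro p ⟨R, S, T, rfl⟩ (b | c | d)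
  · rw [CStarSeminorm.ofHom_apply, tripleHom, FreeStarAlg.lift_gen]
    exact NonUnitalStarAlgHom.norm_apply_le ((leg₁ T.ι).comp ((leg₁ S.ι).comp R.rep)) b
  · rw [CStarSeminorm.ofHom_apply, tripleHom, FreeStarAlg.lift_gen]
    exact NonUnitalStarAlgHom.norm_apply_le ((leg₁ T.ι).comp ((leg₂ ζ R.deg S.deg).comp S.rep)) c
  · rw [CStarSeminorm.ofHom_apply, tripleHom, FreeStarAlg.lift_gen]
    exact NonUnitalStarAlgHom.norm_apply_le
      ((leg₂ ζ (fun x : R.ι × S.ι => R.deg x.1 + S.deg x.2) T.deg).comp T.rep) d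

/-- The threefold braided tensor product `B ⊠_ζ C ⊠_ζ D`. -/
abbrev BraidedTensor₃ (ζ : Circle) (β : CircleAction B) (γ : CircleAction C)
    (δ : CircleAction D) : Type u :=
  UnivAlg (tripleSeminorms ζ β γ δ) (bddAbove_tripleSeminorms ζ β γ δ)

namespace BraidedTensor₃

variable (ζ : Circle) (β : CircleAction B) (γ : CircleAction C) (δ : CircleAction D)

/-- The canonical embedding of the first factor. -/
def k₁ : B →⋆ₐ[ℂ] BraidedTensor₃ ζ β γ δ :=
  UnivAlg.leg _ (bddAbove_tripleSeminorms ζ β γ δ) Sum.inl (by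
    rintro p ⟨R, S, T, rfl⟩
    exact ⟨_, _, tripleHom ζ R S T, (leg₁ T.ι).comp ((leg₁ S.ι).comp R.rep), rfl,
      fun b => FreeStarAlg.lift_gen _ _⟩)

/-- The canonical embedding of the second factor. -/
def k₂ : C →⋆ₐ[ℂ] BraidedTensor₃ ζ β γ δ :=
  UnivAlg.leg _ (bddAbove_tripleSeminorms ζ β γ δ) (fun c => Sum.inr (Sum.inl c)) (by
    rintro p ⟨R, S, T, rfl⟩
    exact ⟨_, _, tripleHom ζ R S T, (leg₁ T.ι).comp ((leg₂ ζ R.deg S.deg).comp S.rep), rfl,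
      fun b => FreeStarAlg.lift_gen _ _⟩)

/-- The canonical embedding of the third factor. -/
def k₃ : D →⋆ₐ[ℂ] BraidedTensor₃ ζ β γ δ :=
  UnivAlg.leg _ (bddAbove_tripleSeminorms ζ β γ δ) (fun d => Sum.inr (Sum.inr d)) (by
    rintro p ⟨R, S, T, rfl⟩
    exact ⟨_, _, tripleHom ζ R S T,
      (leg₂ ζ (fun x : R.ι × S.ι => R.deg x.1 + S.deg x.2) T.deg).comp T.rep, rfl,
      fun b => FreeStarAlg.lift_gen _ _⟩)

end BraidedTensor₃

end BraidedTensor₃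

/-! ### Braided compact quantum groups over the circle -/

open BraidedTensor BraidedTensor₃

/-- Coassociativity `(Δ ⊠ id) ∘ Δ = (id ⊠ Δ) ∘ Δ` as maps from `B` to `B ⊠ B ⊠ B`. Here `j₁₂`,
`j₂₃`, `Δ ⊠ id` and `id ⊠ Δ` are the `*`-homomorphisms `B ⊠ B → B ⊠ B ⊠ B` with the indicated
values on the two factors. These values determine them because the factors generate `B ⊠ B`. -/
def Coassociative (ζ : Circle) {B : Type u} [CStarAlgebra B] (β : CircleAction B)
    (Δ : B →⋆ₐ[ℂ] BraidedTensor ζ β β) : Prop :=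
  ∃ j₁₂ j₂₃ Δid idΔ : BraidedTensor ζ β β →⋆ₐ[ℂ] BraidedTensor₃ ζ β β β,
    ((∀ b, j₁₂ (j₁ ζ β β b) = k₁ ζ β β β b) ∧ (∀ b, j₁₂ (j₂ ζ β β b) = k₂ ζ β β β b)) ∧
    ((∀ b, j₂₃ (j₁ ζ β β b) = k₂ ζ β β β b) ∧ (∀ b, j₂₃ (j₂ ζ β β b) = k₃ ζ β β β b)) ∧
    ((∀ b, Δid (j₁ ζ β β b) = j₁₂ (Δ b)) ∧ (∀ b, Δid (j₂ ζ β β b) = k₃ ζ β β β b)) ∧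
    ((∀ b, idΔ (j₁ ζ β β b) = k₁ ζ β β β b) ∧ (∀ b, idΔ (j₂ ζ β β b) = j₂₃ (Δ b))) ∧
    ∀ b, Δid (Δ b) = idΔ (Δ b)

/-- The structure of a braided compact quantum group over the circle on a unital `C*`-algebra `B`:
a continuous circle action and an equivariant, coassociative comultiplication `B → B ⊠_ζ B` that
satisfies the Podleś conditions. -/
structure BraidedQG (ζ : Circle) (B : Type u) [CStarAlgebra B] where
  /-- The circle action. -/
  action : CircleAction B
  /-- The comultiplication. -/
  comul : B →⋆ₐ[ℂ] BraidedTensor ζ action action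
  equivariant : ∀ z b, comul (action.act z b) =
    map ζ (action.act z) (action.equivariant_act z) (action.act z) (action.equivariant_act z)
      (comul b)
  coassoc : Coassociative ζ action comul
  podles₁ : Dense (Submodule.span ℂ
    {x | ∃ a b, x = comul a * j₂ ζ action action b} : Set (BraidedTensor ζ action action))
  podles₂ : Dense (Submodule.span ℂ
    {x | ∃ a b, x = j₁ ζ action action a * comul b} : Set (BraidedTensor ζ action action))

/-- A circle-equivariant Hopf `*`-homomorphism between braided quantum groups. -/
def IsHopfHom {ζ : Circle} {B C : Type u} [CStarAlgebra B] [CStarAlgebra C] (G : BraidedQG ζ B)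
    (H : BraidedQG ζ C) (f : B →⋆ₐ[ℂ] C) : Prop :=
  ∃ hf : Equivariant G.action H.action f, ∀ b, H.comul (f b) = map ζ f hf f hf (G.comul b)

/-! ### Representations -/

section Representations

variable {V : Type v} [NormedAddCommGroup V] [InnerProductSpace ℂ V] [FiniteDimensional ℂ V]

/-- A continuous unitary representation of the circle on a finite-dimensional Hilbert space. -/
structure CircleRep (V : Type v) [NormedAddCommGroup V] [InnerProductSpace ℂ V] where
  /-- The unitaries of the representation. -/
  toHom : Circle →* (V ≃ₗᵢ[ℂ] V)
  continuous_toHom : ∀ v, Continuous fun z => toHom z v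

/-- The unitary `π_z` as a linear automorphism. -/
def CircleRep.op (π : CircleRep V) (z : Circle) : V ≃ₗ[ℂ] V := (π.toHom z).toLinearEquiv

/-- The subspace of `k`-homogeneous vectors. -/
def CircleRep.homog (π : CircleRep V) (k : ℤ) : Submodule ℂ V where
  carrier := {v | ∀ z : Circle, π.op z v = ((z ^ k : Circle) : ℂ) • v}
  add_mem' ha hb z := by rw [map_add, ha z, hb z, smul_add]
  zero_mem' z := by rw [map_zero, smul_zero]
  smul_mem' c v hv z := by rw [map_smul, hv z, smul_comm]

/-- The orthogonal projection onto the subspace of `k`-homogeneous vectors. -/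
def CircleRep.proj (π : CircleRep V) (k : ℤ) : Module.End ℂ V :=
  ((π.homog k).starProjection : V →L[ℂ] V)

/-- A vector in `V ⊗ V` is `d`-homogeneous. -/
def IsHomogeneous (π : CircleRep V) (d : ℤ) (ω : V ⊗[ℂ] V) : Prop :=
  ∀ z : Circle, TensorProduct.map (π.op z).toLinearMap (π.op z).toLinearMap ω =
    ((z ^ d : Circle) : ℂ) • ω

variable {B C : Type u} [CStarAlgebra B] [CStarAlgebra C]

/-- The map `id ⊗ f : 𝔹(V) ⊗ B → 𝔹(V) ⊗ C`. -/
def idTensor (V : Type v) [NormedAddCommGroup V] [InnerProductSpace ℂ V] (f : B →⋆ₐ[ℂ] C) :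
    Module.End ℂ V ⊗[ℂ] B →ₗ[ℂ] Module.End ℂ V ⊗[ℂ] C :=
  LinearMap.lTensor (Module.End ℂ V) f.toAlgHom.toLinearMap

/-- `U` in `𝔹(V) ⊗ B` is a representation on `(V, π)` of the braided quantum group `G`: it is
unitary, circle-invariant, and `(id ⊗ Δ)(U) = (id ⊗ j₁)(U) (id ⊗ j₂)(U)`. -/
structure IsRep {ζ : Circle} (π : CircleRep V) (G : BraidedQG ζ B)
    (U : Module.End ℂ V ⊗[ℂ] B) : Prop where
  isometry : star U * U = 1
  coisometry : U * star U = 1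
  invariant : ∀ z, TensorProduct.map (π.op z).conj.toLinearMap
    (G.action.act z).toAlgHom.toLinearMap U = U
  comul : idTensor V G.comul U =
    idTensor V (j₁ ζ G.action G.action) U * idTensor V (j₂ ζ G.action G.action) U

/-- The element `U₂₃` of `𝔹(V ⊗ V) ⊗ B`: it sends `T ⊗ b` to `(1 ⊗ T) ⊗ b`. -/
def leg₂₃ (U : Module.End ℂ V ⊗[ℂ] B) : Module.End ℂ (V ⊗[ℂ] V) ⊗[ℂ] B :=
  TensorProduct.map (TensorProduct.mapBilinear (.id ℂ) V V V V LinearMap.id) LinearMap.id U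

/-- The element `𝓑₂₃ U₁₂ 𝓑₂₃*` of `𝔹(V ⊗ V) ⊗ B`, where `𝓑` is the braiding unitary
`L ⊗ V → V ⊗ L`, `λ ⊗ v ↦ ζ ^ (deg v * deg λ) • v ⊗ λ` for a covariant representation of `B` on
`L`. On `k`-homogeneous vectors `v`, it is `λ ⊗ v ↦ v ⊗ ρ_{ζ ^ k} λ`; so `𝓑 (b ⊗ 1) 𝓑*` is
`∑ₖ Pₖ ⊗ β_{ζ ^ k}(b)` with the orthogonal projections `Pₖ` onto the homogeneous subspaces
(see `leg₂_rep_apply`). Thus `T ⊗ b` is sent to `∑ₖ (T ⊗ Pₖ) ⊗ β_{ζ ^ k}(b)`. Only finitely many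
summands are non-zero. -/
def braidedLeg₁₃ (ζ : Circle) (π : CircleRep V) (β : CircleAction B)
    (U : Module.End ℂ V ⊗[ℂ] B) : Module.End ℂ (V ⊗[ℂ] V) ⊗[ℂ] B :=
  ∑ᶠ k : ℤ, TensorProduct.map
    ((TensorProduct.mapBilinear (.id ℂ) V V V V).flip (π.proj k))
    (β.act (ζ ^ k)).toAlgHom.toLinearMap U

/-- The tensor product representation `U ⊤ U = 𝓑₂₃ U₁₂ 𝓑₂₃* U₂₃` on `V ⊗ V`. -/
def tensorRep {ζ : Circle} (π : CircleRep V) (G : BraidedQG ζ B) (U : Module.End ℂ V ⊗[ℂ] B) :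
    Module.End ℂ (V ⊗[ℂ] V) ⊗[ℂ] B :=
  braidedLeg₁₃ ζ π G.action U * leg₂₃ U

/-- `ω` in `V ⊗ V` is a `d`-homogeneous invariant vector for the representation `U` of `G`: it is
`d`-homogeneous and `(U ⊤ U)(ω ⊗ 1) = ω ⊗ 1` in `(V ⊗ V) ⊗ B`. -/
structure IsInvariantVector {ζ : Circle} (π : CircleRep V) (G : BraidedQG ζ B)
    (U : Module.End ℂ V ⊗[ℂ] B) (d : ℤ) (ω : V ⊗[ℂ] V) : Prop where
  homogeneous : IsHomogeneous π d ω
  invariant : LinearMap.rTensor B (LinearMap.applyₗ ω : Module.End ℂ (V ⊗[ℂ] V) →ₗ[ℂ] V ⊗[ℂ] V)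
    (tensorRep π G U) = ω ⊗ₜ[ℂ] (1 : B)

/-! ### Braided free orthogonal quantum groups -/

/-- An orthonormal basis of eigenvectors for a representation of the circle. -/
structure Eigenbasis (π : CircleRep V) (ι : Type u) [Fintype ι] where
  /-- The orthonormal basis. -/
  basis : OrthonormalBasis ι ℂ V
  /-- The degrees of the basis vectors. -/
  deg : ι → ℤ
  eigen : ∀ (z : Circle) (i : ι), π.op z (basis i) = ((z ^ deg i : Circle) : ℂ) • basis i

/-- The coefficient matrix of a vector `ω = ∑ ω i j • e i ⊗ e j`. -/
def Eigenbasis.coeff {π : CircleRep V} {ι : Type u} [Fintype ι] (E : Eigenbasis π ι)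
    (ω : V ⊗[ℂ] V) : Matrix ι ι ℂ :=
  Matrix.of fun i j => (E.basis.toBasis.tensorProduct E.basis.toBasis).repr ω (i, j)

/-- The data `(V, π, ω)`: a finite-dimensional unitary representation of the circle and a
`d`-homogeneous vector `ω` whose coefficient matrix `Ω` satisfies `conj Ω * Ω = c • π_{ζ ^ d}` with
a non-zero scalar `c`. -/
structure OrthDatum (ζ : Circle) (V : Type v) [NormedAddCommGroup V] [InnerProductSpace ℂ V]
    [FiniteDimensional ℂ V] where
  /-- The representation of the circle. -/
  π : CircleRep V
  /-- The degree of `ω`. -/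
  d : ℤ
  /-- The vector in `V ⊗ V`. -/
  ω : V ⊗[ℂ] V
  homogeneous : IsHomogeneous π d ω
  nondegenerate : ∃ (n : ℕ) (E : Eigenbasis π (Fin n)) (c : ℂ), c ≠ 0 ∧
    (E.coeff ω).map (starRingEnd ℂ) * E.coeff ω =
      c • Matrix.diagonal fun i => ((ζ ^ (d * E.deg i) : Circle) : ℂ)

/-- In a `C*`-algebra, the entries of an isometric matrix are contractions. -/
theorem norm_le_one_of_isometry {κ : Type u} [Fintype κ] {A : Type u} [CStarAlgebra A] (a : κ → A)
    (h : ∑ k, star (a k) * a k = 1) (k : κ) : ‖a k‖ ≤ 1 := by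
  let _ : PartialOrder A := CStarAlgebra.spectralOrder A
  have : StarOrderedRing A := CStarAlgebra.spectralOrderedRing A
  have h1 : star (a k) * a k ≤ 1 := by
    rw [← h]
    exact Finset.single_le_sum (f := fun k => star (a k) * a k)
      (fun i _ => star_mul_self_nonneg (a i)) (Finset.mem_univ k)
  have h2 : ‖star (a k) * a k‖ ≤ 1 :=
    (CStarAlgebra.norm_le_one_iff_of_nonneg _ (star_mul_self_nonneg (a k))).2 h1
  rw [CStarRing.norm_star_mul_self] at h2
  nlinarith [norm_nonneg (a k)]

variable {ζ : Circle} {ι : Type u} [Fintype ι] [DecidableEq ι]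

/-- The `C*`-seminorms on the free `*`-algebra on symbols `u i j` for which the matrix `u` is
unitary and
`ζ ^ (d_j d_i) ∑ₖ ω i k • u j k = ζ ^ (d_j (d - d_j)) ∑ₖ ω k j • (u k i)*`. -/
def aoSeminorms (D : OrthDatum ζ V) (E : Eigenbasis D.π ι) :
    Set (CStarSeminorm (FreeStarAlg (ι × ι))) :=
  let u : ι → ι → FreeStarAlg (ι × ι) := fun i j => FreeStarAlg.gen (i, j)
  let w : Matrix ι ι ℂ := E.coeff D.ω
  {p | (∀ i j, p ((∑ k, star (u k i) * u k j) - if i = j then 1 else 0) = 0) ∧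
    (∀ i j, p ((∑ k, u i k * star (u j k)) - if i = j then 1 else 0) = 0) ∧
    ∀ i j, p (((ζ ^ (E.deg j * E.deg i) : Circle) : ℂ) • (∑ k, w i k • u j k) -
      ((ζ ^ (E.deg j * (D.d - E.deg j)) : Circle) : ℂ) • ∑ k, w k j • star (u k i)) = 0}

theorem bddAbove_aoSeminorms (D : OrthDatum ζ V) (E : Eigenbasis D.π ι) :
    ∀ a, BddAbove (Set.range fun p : aoSeminorms D E => p.1 a) := by
  refine CStarSeminorm.bddAbove_of_gen (fun _ => 1) ?_
  rintro p ⟨h, -, -⟩ ⟨i, j⟩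
  rw [← CStarCompletion.norm_of p]
  refine norm_le_one_of_isometry (fun k => CStarCompletion.of p (FreeStarAlg.gen (k, j))) ?_ i
  have h1 := h j j
  rw [← CStarCompletion.norm_of p, norm_eq_zero, map_sub, sub_eq_zero, if_pos rfl, map_one] at h1
  rw [← h1, map_sum]
  simp only [map_mul, map_star]

/-- The `C*`-algebra of the braided free orthogonal quantum group `A_o(V, π, ω)`, built from an
eigenbasis: the completion of the `*`-algebra with the given generators and relations in its
largest `C*`-seminorm. -/
abbrev AoAlg (D : OrthDatum ζ V) (E : Eigenbasis D.π ι) : Type u :=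
  UnivAlg (aoSeminorms D E) (bddAbove_aoSeminorms D E)

/-- The generators `u i j`. -/
def aoGen (D : OrthDatum ζ V) (E : Eigenbasis D.π ι) (i j : ι) : AoAlg D E :=
  UnivAlg.of _ (bddAbove_aoSeminorms D E) (FreeStarAlg.gen (i, j))

/-- The matrix unit `v ↦ ⟪e j, v⟫ • e i`. -/
def Eigenbasis.unit {π : CircleRep V} (E : Eigenbasis π ι) (i j : ι) : Module.End ℂ V :=
  (innerₛₗ ℂ (E.basis j)).smulRight (E.basis i)

/-- The fundamental representation `u = ∑ e_{ij} ⊗ u i j` in `𝔹(V) ⊗ A_o(V, π, ω)`. -/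
def aoRep (D : OrthDatum ζ V) (E : Eigenbasis D.π ι) : Module.End ℂ V ⊗[ℂ] AoAlg D E :=
  ∑ i, ∑ j, E.unit i j ⊗ₜ[ℂ] aoGen D E i j

/-- `A` is the braided quantum group structure of `A_o(V, π, ω)` on its `C*`-algebra: the action and
the comultiplication are given by `β_z(u i k) = z ^ (d_k - d_i) • u i k` and
`Δ(u i k) = ∑ₗ j₁(u i l) j₂(u l k)`. -/
structure IsAo (D : OrthDatum ζ V) (E : Eigenbasis D.π ι) (A : BraidedQG ζ (AoAlg D E)) :
    Prop where
  action_gen : ∀ (z : Circle) (i k : ι), A.action.act z (aoGen D E i k) =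
    ((z ^ (E.deg k - E.deg i) : Circle) : ℂ) • aoGen D E i k
  comul_gen : ∀ i k : ι, A.comul (aoGen D E i k) =
    ∑ l, j₁ ζ A.action A.action (aoGen D E i l) * j₂ ζ A.action A.action (aoGen D E l k)

end Representations

end BraidedOrth

end

open BraidedOrth
open scoped TensorProduct

open scoped TensorProduct ComplexConjugate

noncomputable section

namespace BraidedOrth

/-! ### Monomial unitaries and the legs of `ℓ²(ι) ⊗ ℓ²(κ)` -/

namespace Ell2

variable {ι κ μ : Type u}

/-! The third defining relation of `A_o(V, π, ω)` is the invariance of `ω`, written in matrix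
entries. The `(i, a)` coefficient of `(u ⊤ u)(ω ⊗ 1) = ω ⊗ 1` says `∑ⱼ β_{ζ^{d_a}}(u_ij) ∑_b ω_jb
u_ab = ω_ia`. Since `u_ij` has degree `d_j - d_i`, the action contributes only a phase.
Multiplication by `u*` then isolates `∑_b ω_ib u_ab` on one side and adjoints on the other; the
exponents match because `ω_ka ≠ 0` forces `d_k + d_a = d`. Unitarity makes the step reversible. This
is `isInvariantVector_iff`, `OrthRel.of_invariant` and `OrthRel.invariant`. Consequently the entries
of an arbitrary representation with invariant vector `ω` satisfy the defining relations, and the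
universal property of the `C*`-algebra produces the Hopf homomorphism.

The structure maps come from the same universal property: the relations survive the rescaling of
`u_ik` by `z^{d_k - d_i}` (`OrthRel.twist`) and the product of the matrices `j₁(u)` and `j₂(u)`
(`OrthRel.mul`). The product needs to move `j₂(u_ki)*` past `j₁(u_mk)*`, and homogeneous elements of
the two legs commute up to the action (`leg₂_mul_leg₁`, `leg₂_mul_leg₁_of_left`).

Coassociativity is a comparison of double sums on generators once `Δ ⊠ id` and `id ⊠ Δ` exist. Their
existence in the spatial norm is the analytic point: an equivariant map into `B ⊠ C` turns a pair of
covariant representations into a single one (`CovRep.pair`), so each triple of representations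
restricts to a pair (`BraidedTensor₃.ofPair`). The hexagon identities for the braiding
(`assoc_conj_leg₂_leg₁`, `assoc_conj_leg₂_leg₂`) match the legs.

For the Podleś conditions, unitarity of `u` expresses `j₁(u_il)` through `Δ` and `j₂`, and
`j₂(u_lk)` through `j₁` and `Δ`. The elements that stabilize the closed span form a closed
subalgebra, a priori not closed under adjoints. Here the condition on `Ω` enters: `Ω` is invertible,
so the adjoints `u_ij*` are linear combinations of the `u_kl` (`ao_mem_of_isClosed`).

A unitary `φ` as in part (4) carries `u₂` back to a representation on `V₁` that leaves `ω₁`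
invariant. Universality in both directions yields mutually inverse Hopf homomorphisms, and part (3)
is the case `φ = id`. -/

theorem conj_monomial_apply (e : ι ≃ κ) (w : κ → Circle) (T : BEll2 ι) (f : Ell2 κ) (k : κ) :
    (monomial e w).conjStarAlgEquiv T f k = (w k : ℂ) * T ((monomial e w).symm f) (e.symm k) :=
  rfl

theorem monomial_symm_apply (e : ι ≃ κ) (w : κ → Circle) (f : Ell2 κ) (i : ι) :
    (monomial e w).symm f i = ((w (e i))⁻¹ : Circle) * f (e i) := rfl

/-- All identities between legs below compare the same operator `T` applied to two vectors that
differ by a phase constant along the index on which `T` acts. Linearity pulls this phase out, and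
only arithmetic of exponents remains. -/
theorem coe_mul_apply_eq (T : BEll2 ι) {a b c : Circle} {g g' : Ell2 ι} (k : ι)
    (hg : ∀ i, g i = (c : ℂ) * g' i) (h : a * c = b) : (a : ℂ) * T g k = (b : ℂ) * T g' k := by
  have hg' : g = (c : ℂ) • g' := by
    ext i
    exact hg i
  have h1 : T g k = (c : ℂ) * T g' k := by
    rw [hg', map_smul]
    rfl
  rw [h1, ← mul_assoc, ← Circle.coe_mul, h]

/-- The unitary `ℓ²(ι) ⊗ (ℓ²(κ) ⊗ ℓ²(μ)) → (ℓ²(ι) ⊗ ℓ²(κ)) ⊗ ℓ²(μ)`. -/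
def assoc (ι κ μ : Type u) : Ell2 (ι × κ × μ) ≃ₗᵢ[ℂ] Ell2 ((ι × κ) × μ) :=
  monomial (Equiv.prodAssoc ι κ μ).symm fun _ => 1

theorem conj_assoc_apply (T : BEll2 (ι × κ × μ)) (f : Ell2 ((ι × κ) × μ)) (i : ι) (k : κ)
    (m : μ) : (assoc ι κ μ).conjStarAlgEquiv T f ((i, k), m) =
      T ((assoc ι κ μ).symm f) (i, k, m) :=
  (conj_monomial_apply _ _ _ _ _).trans (by rw [Circle.coe_one, one_mul]; rfl)

theorem assoc_symm_apply (f : Ell2 ((ι × κ) × μ)) (i : ι) (k : κ) (m : μ) :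
    (assoc ι κ μ).symm f (i, k, m) = f ((i, k), m) :=
  (monomial_symm_apply _ _ _ _).trans (by rw [inv_one, Circle.coe_one, one_mul]; rfl)

end Ell2

open Ell2

section Legs

variable {ι κ μ : Type u}

theorem leg₁_apply (T : BEll2 ι) (f : Ell2 (ι × κ)) (i : ι) (k : κ) :
    leg₁ κ T f (i, k) = T (slice k f) i := amp_apply T f i k

theorem leg₂_apply (ζ : Circle) (l : ι → ℤ) (m : κ → ℤ) (T : BEll2 κ) (f : Ell2 (ι × κ)) (i : ι)
    (k : κ) : leg₂ ζ l m T f (i, k) =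
      ((ζ ^ (m k * l i) : Circle) : ℂ) * T (slice i ((braiding ζ l m).symm f)) k := rfl

theorem braiding_symm_apply (ζ : Circle) (l : ι → ℤ) (m : κ → ℤ) (f : Ell2 (ι × κ)) (i : ι)
    (k : κ) : (braiding ζ l m).symm f (k, i) =
      (((ζ ^ (m k * l i))⁻¹ : Circle) : ℂ) * f (i, k) := rfl

theorem rotation_conj_apply (l : ι → ℤ) (z : Circle) (T : BEll2 ι) (f : Ell2 ι) (i : ι) :
    (rotation l z).conjStarAlgEquiv T f i =
      ((z ^ l i : Circle) : ℂ) * T ((rotation l z).symm f) i := rfl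

theorem rotation_symm_apply (l : ι → ℤ) (z : Circle) (f : Ell2 ι) (i : ι) :
    (rotation l z).symm f i = (((z ^ l i)⁻¹ : Circle) : ℂ) * f i := rfl

theorem assoc_conj_leg₁ (T : BEll2 ι) :
    (assoc ι κ μ).conjStarAlgEquiv (leg₁ (κ × μ) T) = leg₁ μ (leg₁ κ T) := by
  ext f ⟨⟨i, k⟩, m⟩
  rw [conj_assoc_apply, leg₁_apply, leg₁_apply, leg₁_apply]
  refine congrArg (fun g : Ell2 ι => T g i) ?_
  ext j
  rw [slice_apply, assoc_symm_apply]
  rfl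

/-- One hexagon identity. Braiding `ℓ²(κ) ⊗ ℓ²(μ)` past `ℓ²(ι)` also braids the factor `ℓ²(μ)`, on
which the operator is trivial; that phase cancels in the conjugation. -/
theorem assoc_conj_leg₂_leg₁ (ζ : Circle) (l : ι → ℤ) (m : κ → ℤ) (n : μ → ℤ) (T : BEll2 κ) :
    (assoc ι κ μ).conjStarAlgEquiv (leg₂ ζ l (fun x : κ × μ => m x.1 + n x.2) (leg₁ μ T)) =
      leg₁ μ (leg₂ ζ l m T) := by
  ext f ⟨⟨i, k⟩, s⟩
  rw [conj_assoc_apply, leg₂_apply, leg₁_apply, leg₁_apply, leg₂_apply]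
  -- The inverse braiding phase of `ℓ²(μ)` past `ℓ²(ι)` does not depend on the `κ`-index `j`.
  refine coe_mul_apply_eq T (c := ζ ^ (-(n s * l i))) k (fun j => ?_) ?_
  · rw [slice_apply, slice_apply, braiding_symm_apply, assoc_symm_apply, slice_apply,
      braiding_symm_apply, slice_apply, ← mul_assoc, ← Circle.coe_mul, ← zpow_neg, ← zpow_neg,
      ← zpow_add]
    congr 4
    ring
  · rw [← zpow_add]
    congr 1
    ring

/-- The other hexagon identity. Moving `ℓ²(μ)` past `ℓ²(κ)` and then past `ℓ²(ι)` is the braiding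
past the product with added degrees. The phase `ζ ^ (m k * l i)` between `ℓ²(κ)` and `ℓ²(ι)`
cancels. -/
theorem assoc_conj_leg₂_leg₂ (ζ : Circle) (l : ι → ℤ) (m : κ → ℤ) (n : μ → ℤ) (T : BEll2 μ) :
    (assoc ι κ μ).conjStarAlgEquiv (leg₂ ζ l (fun x : κ × μ => m x.1 + n x.2) (leg₂ ζ m n T)) =
      leg₂ ζ (fun x : ι × κ => l x.1 + m x.2) n T := by
  ext f ⟨⟨i, k⟩, s⟩
  rw [conj_assoc_apply, leg₂_apply, leg₂_apply, leg₂_apply, ← mul_assoc, ← Circle.coe_mul]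
  refine coe_mul_apply_eq T (c := ζ ^ (-(m k * l i))) s (fun j => ?_) ?_
  · rw [slice_apply, slice_apply, braiding_symm_apply, slice_apply, braiding_symm_apply,
      assoc_symm_apply, braiding_symm_apply, ← mul_assoc, ← mul_assoc, ← Circle.coe_mul,
      ← Circle.coe_mul, ← zpow_neg, ← zpow_neg, ← zpow_neg, ← zpow_add, ← zpow_add]
    congr 3
    ring
  · rw [← zpow_add, ← zpow_add]
    congr 1
    ring

theorem rotation_conj_leg₁ (l : ι → ℤ) (m : κ → ℤ) (z : Circle) (T : BEll2 ι) :
    (rotation (fun x : ι × κ => l x.1 + m x.2) z).conjStarAlgEquiv (leg₁ κ T) =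
      leg₁ κ ((rotation l z).conjStarAlgEquiv T) := by
  ext f ⟨i, k⟩
  rw [rotation_conj_apply, leg₁_apply, leg₁_apply, rotation_conj_apply]
  refine coe_mul_apply_eq T (c := z ^ (-m k)) i (fun j => ?_) ?_
  · rw [slice_apply, rotation_symm_apply, rotation_symm_apply, slice_apply, ← mul_assoc,
      ← Circle.coe_mul, ← zpow_neg, ← zpow_neg, ← zpow_add]
    congr 4
    ring
  · rw [← zpow_add]
    congr 1
    ring

/-- The braiding is diagonal up to the flip, so it intertwines the diagonal rotations. With the
analogue for the first leg, this makes the joint representations covariant for the diagonal action.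
-/
theorem rotation_conj_leg₂ (ζ : Circle) (l : ι → ℤ) (m : κ → ℤ) (z : Circle) (T : BEll2 κ) :
    (rotation (fun x : ι × κ => l x.1 + m x.2) z).conjStarAlgEquiv (leg₂ ζ l m T) =
      leg₂ ζ l m ((rotation m z).conjStarAlgEquiv T) := by
  ext f ⟨i, k⟩
  rw [rotation_conj_apply, leg₂_apply, leg₂_apply, rotation_conj_apply, ← mul_assoc, ← mul_assoc,
    ← Circle.coe_mul, ← Circle.coe_mul]
  refine coe_mul_apply_eq T (c := z ^ (-l i)) k (fun j => ?_) ?_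
  · rw [slice_apply, braiding_symm_apply, rotation_symm_apply, rotation_symm_apply, slice_apply,
      braiding_symm_apply, ← mul_assoc, ← mul_assoc, ← mul_assoc, ← Circle.coe_mul,
      ← Circle.coe_mul, ← Circle.coe_mul, ← zpow_neg, ← zpow_neg, ← zpow_neg, mul_comm (ζ ^ _),
      ← zpow_add]
    congr 5
    ring
  · rw [mul_comm (z ^ _), mul_assoc, ← zpow_add]
    congr 2
    ring

/-! ### Elementary tensors and the braided commutation relation -/

/-- The vector `g ⊗ h` of `ℓ²(ι) ⊗ ℓ²(κ)`. -/
def Ell2.tmul (g : Ell2 ι) (h : Ell2 κ) : Ell2 (ι × κ) :=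
  ⟨fun x => g x.1 * h x.2, (memℓp_iff _).2 (by
    simp only [norm_mul, mul_pow]
    exact (summable_sq g).mul_of_nonneg (summable_sq h) (fun _ => sq_nonneg _)
      fun _ => sq_nonneg _)⟩

theorem Ell2.tmul_apply (g : Ell2 ι) (h : Ell2 κ) (i : ι) (k : κ) :
    tmul g h (i, k) = g i * h k := rfl

-- The basis vectors of `ℓ²(ι × κ)` are themselves elementary tensors.
open Classical in
theorem Ell2.clm_ext_tmul {S T : BEll2 (ι × κ)} (h : ∀ g k, S (tmul g k) = T (tmul g k)) :
    S = T := by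
  refine lp.ext_continuousLinearMap (by norm_num) fun ⟨i, k⟩ => ?_
  ext1
  have h1 : lp.single (E := fun _ : ι × κ => ℂ) 2 (i, k) (1 : ℂ) =
      tmul (lp.single (E := fun _ : ι => ℂ) 2 i (1 : ℂ))
        (lp.single (E := fun _ : κ => ℂ) 2 k (1 : ℂ)) := by
    ext ⟨j, m⟩
    rw [tmul_apply]
    simp only [lp.single_apply, Pi.single_apply, Prod.mk.injEq]
    by_cases h1 : j = i <;> by_cases h2 : m = k <;> simp [h1, h2]
  have h2 := h (lp.single (E := fun _ : ι => ℂ) 2 i (1 : ℂ))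
    (lp.single (E := fun _ : κ => ℂ) 2 k (1 : ℂ))
  rw [← h1] at h2
  simpa using h2

theorem leg₁_tmul (T : BEll2 ι) (g : Ell2 ι) (h : Ell2 κ) :
    leg₁ κ T (tmul g h) = tmul (T g) h := by
  ext ⟨i, k⟩
  rw [leg₁_apply, tmul_apply]
  have h1 : slice k (tmul g h) = h k • g := by
    ext j
    exact mul_comm _ _
  rw [h1, map_smul]
  exact mul_comm _ _

/-- An operator that is homogeneous of degree `k` on the second factor acts on elementary tensors
by the rotation by `ζ ^ k` on the first factor. -/
theorem leg₂_tmul (ζ : Circle) (l : ι → ℤ) (m : κ → ℤ) {T : BEll2 κ} {k : ℤ}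
    (hT : ∀ z, (rotation m z).conjStarAlgEquiv T = ((z ^ k : Circle) : ℂ) • T) (g : Ell2 ι)
    (h : Ell2 κ) : leg₂ ζ l m T (tmul g h) = tmul (rotation l (ζ ^ k) g) (T h) := by
  ext ⟨i, s⟩
  rw [leg₂_apply, tmul_apply]
  have h1 : slice i ((braiding ζ l m).symm (tmul g h)) =
      g i • (rotation m (ζ ^ l i)).symm h := by
    ext j
    rw [slice_apply, braiding_symm_apply, tmul_apply, mul_left_comm, mul_comm (m j), zpow_mul]
    rfl
  have h2 : ((rotation m (ζ ^ l i)).conjStarAlgEquiv T) h s =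
      (((ζ ^ l i) ^ k : Circle) : ℂ) * T h s := by
    rw [hT]
    rfl
  rw [rotation_conj_apply] at h2
  rw [h1, map_smul]
  change ((ζ ^ (m s * l i) : Circle) : ℂ) * (g i * T ((rotation m (ζ ^ l i)).symm h) s) =
    (((ζ ^ k) ^ l i : Circle) : ℂ) * g i * T h s
  rw [mul_left_comm, mul_comm (m s), zpow_mul, h2, ← zpow_mul, ← zpow_mul, mul_comm k]
  ring

/-- On `g ⊗ h`, the second leg of `T` rotates `g` by `ζ ^ k` and applies `T` to `h`. Exchanging this
with `S` on the first factor conjugates `S` by the rotation. -/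
theorem leg₂_mul_leg₁ (ζ : Circle) (l : ι → ℤ) (m : κ → ℤ) {T : BEll2 κ} {k : ℤ}
    (hT : ∀ z, (rotation m z).conjStarAlgEquiv T = ((z ^ k : Circle) : ℂ) • T) (S : BEll2 ι) :
    leg₂ ζ l m T * leg₁ κ S = leg₁ κ ((rotation l (ζ ^ k)).conjStarAlgEquiv S) * leg₂ ζ l m T := by
  refine clm_ext_tmul fun g h => ?_
  rw [mul_apply_eq_comp, mul_apply_eq_comp, leg₁_tmul, leg₂_tmul ζ l m hT, leg₂_tmul ζ l m hT,
    leg₁_tmul, LinearIsometryEquiv.conjStarAlgEquiv_apply_apply,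
    LinearIsometryEquiv.symm_apply_apply]

end Legs

/-! ### Norms in universal `C*`-algebras -/

/-- The norm is defined as a supremum only on the image of the free algebra. When the seminorms are
realized by homomorphisms on the completion, an approximation argument carries the estimate to all
elements. -/
theorem UnivAlg.norm_le {X : Type u} {S : Set (CStarSeminorm (FreeStarAlg X))}
    {hS : ∀ a, BddAbove (Set.range fun p : S => p.1 a)} {x : UnivAlg S hS} {M : ℝ} (hM : 0 ≤ M)
    (h : ∀ p ∈ S, ∃ (D : Type v) (_ : CStarAlgebra D) (H : UnivAlg S hS →⋆ₐ[ℂ] D),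
      (∀ a, p a = ‖H (of S hS a)‖) ∧ ‖H x‖ ≤ M) : ‖x‖ ≤ M := by
  refine le_of_forall_pos_le_add fun ε hε => ?_
  obtain ⟨a, ha⟩ := (CStarCompletion.denseRange_of (CStarSeminorm.sup S hS)).exists_dist_lt x
    (half_pos hε)
  change dist x (of S hS a) < ε / 2 at ha
  rw [dist_eq_norm] at ha
  have h1 : ‖of S hS a‖ ≤ M + ε / 2 := by
    rw [norm_of]
    refine CStarSeminorm.sup_le hS (by positivity) fun p hp => ?_
    obtain ⟨D, _, H, hH, hx⟩ := h p hp
    rw [hH]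
    have h2 : H (of S hS a) = H x - H (x - of S hS a) := by
      rw [map_sub, sub_sub_cancel]
    have h3 : ‖H (x - of S hS a)‖ ≤ ‖x - of S hS a‖ := NonUnitalStarAlgHom.norm_apply_le H _
    calc ‖H (of S hS a)‖ ≤ ‖H x‖ + ‖H (x - of S hS a)‖ := by rw [h2]; exact norm_sub_le _ _
      _ ≤ M + ε / 2 := by linarith
  calc ‖x‖ = ‖(x - of S hS a) + of S hS a‖ := by rw [sub_add_cancel]
    _ ≤ ‖x - of S hS a‖ + ‖of S hS a‖ := norm_add_le _ _
    _ ≤ M + ε := by linarith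

/-! ### Braided tensor products -/

section Pair

variable {B C : Type u} [CStarAlgebra B] [CStarAlgebra C] {ζ : Circle} {β : CircleAction B}
  {γ : CircleAction C}

namespace BraidedTensor

theorem hom_ext {D : Type v} [CStarAlgebra D] {f g : BraidedTensor ζ β γ →⋆ₐ[ℂ] D}
    (h₁ : ∀ b, f (j₁ ζ β γ b) = g (j₁ ζ β γ b)) (h₂ : ∀ c, f (j₂ ζ β γ c) = g (j₂ ζ β γ c)) :
    f = g :=
  UnivAlg.hom_ext fun x => by
    rcases x with b | c
    · exact h₁ b
    · exact h₂ c

theorem norm_pairHom_le (R : CovRep β) (S : CovRep γ) (a : FreeStarAlg (B ⊕ C)) :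
    ‖pairHom ζ R S a‖ ≤ CStarSeminorm.sup _ (bddAbove_pairSeminorms ζ β γ) a :=
  CStarSeminorm.le_sup (p := CStarSeminorm.ofHom (pairHom ζ R S)) (bddAbove_pairSeminorms ζ β γ)
    ⟨R, S, rfl⟩ a

/-- The representation of `B ⊠ C` that comes from two covariant representations. -/
def rep (R : CovRep β) (S : CovRep γ) : BraidedTensor ζ β γ →⋆ₐ[ℂ] BEll2 (R.ι × S.ι) :=
  UnivAlg.lift (S := pairSeminorms ζ β γ) (hS := bddAbove_pairSeminorms ζ β γ)
    (Sum.elim (fun b => leg₁ S.ι (R.rep b)) fun c => leg₂ ζ R.deg S.deg (S.rep c))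
    (norm_pairHom_le R S)

theorem rep_of (R : CovRep β) (S : CovRep γ) (a : FreeStarAlg (B ⊕ C)) :
    rep R S (UnivAlg.of _ (bddAbove_pairSeminorms ζ β γ) a) = pairHom ζ R S a :=
  CStarCompletion.lift_of _ (norm_pairHom_le R S) _

theorem rep_j₁ (R : CovRep β) (S : CovRep γ) (b : B) :
    rep R S (j₁ ζ β γ b) = leg₁ S.ι (R.rep b) :=
  UnivAlg.lift_gen (S := pairSeminorms ζ β γ) (hS := bddAbove_pairSeminorms ζ β γ) _ _ (Sum.inl b)

theorem rep_j₂ (R : CovRep β) (S : CovRep γ) (c : C) :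
    rep R S (j₂ ζ β γ c) = leg₂ ζ R.deg S.deg (S.rep c) :=
  UnivAlg.lift_gen (S := pairSeminorms ζ β γ) (hS := bddAbove_pairSeminorms ζ β γ) _ _ (Sum.inr c)

/-- The spatial norm is the supremum over these representations, so they separate points, and
identities in `B ⊠ C` reduce to identities between operators. -/
theorem ext_rep {x y : BraidedTensor ζ β γ}
    (h : ∀ (R : CovRep β) (S : CovRep γ), rep R S x = rep R S y) : x = y := by
  rw [← sub_eq_zero, ← norm_le_zero_iff]
  refine UnivAlg.norm_le le_rfl ?_
  rintro p ⟨R, S, rfl⟩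
  exact ⟨_, _, rep R S, fun a => by rw [rep_of]; rfl, by rw [map_sub, h, sub_self, norm_zero]⟩

/-- This makes the joint representation covariant for the diagonal action, with degrees added;
`CovRep.pair` needs it. -/
theorem rep_map_act (R : CovRep β) (S : CovRep γ) (z : Circle) (x : BraidedTensor ζ β γ) :
    rep R S (map ζ (β.act z) (β.equivariant_act z) (γ.act z) (γ.equivariant_act z) x) =
      (rotation (fun x : R.ι × S.ι => R.deg x.1 + S.deg x.2) z).conjStarAlgEquiv (rep R S x) := by
  have h : (rep R S).comp
      (map ζ (β.act z) (β.equivariant_act z) (γ.act z) (γ.equivariant_act z)) =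
      ((rotation (fun x : R.ι × S.ι => R.deg x.1 + S.deg x.2) z).conjStarAlgEquiv :
        BEll2 (R.ι × S.ι) →⋆ₐ[ℂ] BEll2 (R.ι × S.ι)).comp (rep R S) := by
    refine hom_ext (fun b => ?_) fun c => ?_
    · rw [StarAlgHom.comp_apply, StarAlgHom.comp_apply, map_j₁, rep_j₁, rep_j₁, R.covariant]
      exact (rotation_conj_leg₁ _ _ _ _).symm
    · rw [StarAlgHom.comp_apply, StarAlgHom.comp_apply, map_j₂, rep_j₂, rep_j₂, S.covariant]
      exact (rotation_conj_leg₂ _ _ _ _ _).symm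
  exact DFunLike.congr_fun h x

/-- The braided commutation relation for a homogeneous element of the second factor. -/
theorem j₂_mul_j₁_of_right {c : C} {k : ℤ}
    (hc : ∀ z, γ.act z c = ((z ^ k : Circle) : ℂ) • c) (b : B) :
    j₂ ζ β γ c * j₁ ζ β γ b = j₁ ζ β γ (β.act (ζ ^ k) b) * j₂ ζ β γ c := by
  refine ext_rep fun R S => ?_
  rw [map_mul, map_mul, rep_j₁, rep_j₁, rep_j₂, R.covariant]
  refine leg₂_mul_leg₁ _ _ _ (fun z => ?_) _
  rw [← S.covariant, hc, map_smul]

end BraidedTensor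

/-- The braiding for `ζ⁻¹` with the factors exchanged is the inverse of the braiding for `ζ`. So, up
to conjugation, `T ⊗ 1` is a braided second leg for `ζ⁻¹`: the two legs play symmetric roles. -/
theorem leg₁_eq_conj_braiding (ζ : Circle) {ι κ : Type u} (l : ι → ℤ) (m : κ → ℤ) (T : BEll2 ι) :
    leg₁ κ T = (braiding ζ l m).conjStarAlgEquiv (leg₂ ζ⁻¹ m l T) := by
  have h : ∀ f, (braiding ζ⁻¹ m l).symm ((braiding ζ l m).symm f) = f := fun f => by
    ext ⟨i, k⟩
    rw [braiding_symm_apply, braiding_symm_apply, ← mul_assoc, ← Circle.coe_mul, inv_zpow,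
      inv_inv, mul_comm (l i), mul_inv_cancel, Circle.coe_one, one_mul]
  have h' : ∀ f, braiding ζ l m (braiding ζ⁻¹ m l f) = f := fun f => by
    rw [← LinearIsometryEquiv.eq_symm_apply, ← LinearIsometryEquiv.eq_symm_apply, h]
  ext1 f
  change _ = braiding ζ l m (braiding ζ⁻¹ m l (leg₁ κ T _))
  rw [h']
  exact congrArg (leg₁ κ T) (h f).symm

/-- This is `leg₂_mul_leg₁` for `ζ⁻¹` with the factors exchanged, conjugated by the braiding. It is
applied to the rotated operator, so that the rotation by `ζ⁻¹ ^ k` cancels and `T` reappears. -/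
theorem leg₂_mul_leg₁_of_left (ζ : Circle) {ι κ : Type u} (l : ι → ℤ) (m : κ → ℤ) {S : BEll2 ι}
    {k : ℤ} (hS : ∀ z, (rotation l z).conjStarAlgEquiv S = ((z ^ k : Circle) : ℂ) • S)
    (T : BEll2 κ) : leg₂ ζ l m T * leg₁ κ S =
      leg₁ κ S * leg₂ ζ l m ((rotation m (ζ ^ k)).conjStarAlgEquiv T) := by
  have h := leg₂_mul_leg₁ ζ⁻¹ m l hS ((rotation m (ζ ^ k)).conjStarAlgEquiv T)
  have h1 : (rotation m (ζ⁻¹ ^ k)).conjStarAlgEquiv ((rotation m (ζ ^ k)).conjStarAlgEquiv T) =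
      T := by
    ext f i
    rw [rotation_conj_apply, rotation_conj_apply, ← mul_assoc, ← Circle.coe_mul, ← mul_zpow,
      inv_zpow, inv_mul_cancel, one_zpow, Circle.coe_one, one_mul]
    refine congrArg (fun g : Ell2 κ => T g i) ?_
    ext j
    rw [rotation_symm_apply, rotation_symm_apply, ← mul_assoc, ← Circle.coe_mul, ← mul_inv,
      ← mul_zpow, mul_inv_cancel, one_zpow, inv_one, Circle.coe_one, one_mul]
  rw [h1] at h
  rw [leg₁_eq_conj_braiding ζ l m]
  change (braiding ζ l m).conjStarAlgEquiv (leg₁ ι T) * _ =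
    _ * (braiding ζ l m).conjStarAlgEquiv (leg₁ ι _)
  rw [← map_mul, ← map_mul, h]

/-- The braided commutation relation for a homogeneous element of the first factor. -/
theorem BraidedTensor.j₂_mul_j₁_of_left {b : B} {k : ℤ}
    (hb : ∀ z, β.act z b = ((z ^ k : Circle) : ℂ) • b) (c : C) :
    j₂ ζ β γ c * j₁ ζ β γ b = j₁ ζ β γ b * j₂ ζ β γ (γ.act (ζ ^ k) c) := by
  refine ext_rep fun R S => ?_
  rw [map_mul, map_mul, rep_j₁, rep_j₂, rep_j₂, S.covariant]
  refine leg₂_mul_leg₁_of_left _ _ _ (fun z => ?_) _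
  rw [← R.covariant, hb, map_smul]

/-- The covariant representation on `ℓ²(ι) ⊗ ℓ²(κ)` that a homomorphism to `B ⊠ C`, equivariant for
the diagonal action, induces. -/
def CovRep.pair {A : Type u} [CStarAlgebra A] {α : CircleAction A} (R : CovRep β) (S : CovRep γ)
    (f : A →⋆ₐ[ℂ] BraidedTensor ζ β γ)
    (hf : ∀ z a, f (α.act z a) =
      BraidedTensor.map ζ (β.act z) (β.equivariant_act z) (γ.act z) (γ.equivariant_act z) (f a)) :
    CovRep α where
  ι := R.ι × S.ι
  deg x := R.deg x.1 + S.deg x.2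
  rep := (BraidedTensor.rep R S).comp f
  covariant z a := by
    rw [StarAlgHom.comp_apply, StarAlgHom.comp_apply, hf, BraidedTensor.rep_map_act]

end Pair

/-! ### Threefold braided tensor products and the maps that express coassociativity. -/

section Triple

variable {B C D : Type u} [CStarAlgebra B] [CStarAlgebra C] [CStarAlgebra D] {ζ : Circle}
  {β : CircleAction B} {γ : CircleAction C} {δ : CircleAction D}

open BraidedTensor

namespace BraidedTensor₃

theorem norm_tripleHom_le (R : CovRep β) (S : CovRep γ) (T : CovRep δ)
    (a : FreeStarAlg (B ⊕ C ⊕ D)) :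
    ‖tripleHom ζ R S T a‖ ≤ CStarSeminorm.sup _ (bddAbove_tripleSeminorms ζ β γ δ) a :=
  CStarSeminorm.le_sup (p := CStarSeminorm.ofHom (tripleHom ζ R S T))
    (bddAbove_tripleSeminorms ζ β γ δ) ⟨R, S, T, rfl⟩ a

/-- The representation of `B ⊠ C ⊠ D` that comes from three covariant representations. -/
def rep (R : CovRep β) (S : CovRep γ) (T : CovRep δ) :
    BraidedTensor₃ ζ β γ δ →⋆ₐ[ℂ] BEll2 ((R.ι × S.ι) × T.ι) :=
  UnivAlg.lift (S := tripleSeminorms ζ β γ δ) (hS := bddAbove_tripleSeminorms ζ β γ δ)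
    (Sum.elim (fun b => leg₁ T.ι (leg₁ S.ι (R.rep b)))
      (Sum.elim (fun c => leg₁ T.ι (leg₂ ζ R.deg S.deg (S.rep c)))
        fun d => leg₂ ζ (fun x : R.ι × S.ι => R.deg x.1 + S.deg x.2) T.deg (T.rep d)))
    (norm_tripleHom_le R S T)

theorem rep_of (R : CovRep β) (S : CovRep γ) (T : CovRep δ) (a : FreeStarAlg (B ⊕ C ⊕ D)) :
    rep R S T (UnivAlg.of _ (bddAbove_tripleSeminorms ζ β γ δ) a) = tripleHom ζ R S T a :=
  CStarCompletion.lift_of _ (norm_tripleHom_le R S T) _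

theorem rep_k₁ (R : CovRep β) (S : CovRep γ) (T : CovRep δ) (b : B) :
    rep R S T (k₁ ζ β γ δ b) = leg₁ T.ι (leg₁ S.ι (R.rep b)) :=
  UnivAlg.lift_gen (S := tripleSeminorms ζ β γ δ) (hS := bddAbove_tripleSeminorms ζ β γ δ) _ _
    (Sum.inl b)

theorem rep_k₂ (R : CovRep β) (S : CovRep γ) (T : CovRep δ) (c : C) :
    rep R S T (k₂ ζ β γ δ c) = leg₁ T.ι (leg₂ ζ R.deg S.deg (S.rep c)) :=
  UnivAlg.lift_gen (S := tripleSeminorms ζ β γ δ) (hS := bddAbove_tripleSeminorms ζ β γ δ) _ _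
    (Sum.inr (Sum.inl c))

theorem rep_k₃ (R : CovRep β) (S : CovRep γ) (T : CovRep δ) (d : D) :
    rep R S T (k₃ ζ β γ δ d) =
      leg₂ ζ (fun x : R.ι × S.ι => R.deg x.1 + S.deg x.2) T.deg (T.rep d) :=
  UnivAlg.lift_gen (S := tripleSeminorms ζ β γ δ) (hS := bddAbove_tripleSeminorms ζ β γ δ) _ _
    (Sum.inr (Sum.inr d))

variable {P Q : Type u} [CStarAlgebra P] [CStarAlgebra Q] {ρ : CircleAction P}
  {σ : CircleAction Q}

/-- A map on the generators of `P ⊠ Q` with values in `B ⊠ C ⊠ D` induces a `*`-homomorphism if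
in each triple of covariant representations it factors through a pair. -/
def ofPair (f : P ⊕ Q → BraidedTensor₃ ζ β γ δ)
    (h : ∀ (R : CovRep β) (S : CovRep γ) (T : CovRep δ), ∃ (R' : CovRep ρ) (S' : CovRep σ)
      (Φ : BEll2 (R'.ι × S'.ι) →⋆ₐ[ℂ] BEll2 ((R.ι × S.ι) × T.ι)),
      ∀ x, rep R S T (f x) = Φ (Sum.elim (fun b => leg₁ S'.ι (R'.rep b))
        (fun c => leg₂ ζ R'.deg S'.deg (S'.rep c)) x)) :
    BraidedTensor ζ ρ σ →⋆ₐ[ℂ] BraidedTensor₃ ζ β γ δ :=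
  UnivAlg.lift (S := pairSeminorms ζ ρ σ) (hS := bddAbove_pairSeminorms ζ ρ σ) f fun a => by
    refine UnivAlg.norm_le (apply_nonneg (CStarSeminorm.sup _ _).toSeminorm a) ?_
    rintro p ⟨R, S, T, rfl⟩
    obtain ⟨R', S', Φ, hΦ⟩ := h R S T
    refine ⟨_, _, rep R S T, fun a => by rw [rep_of]; rfl, ?_⟩
    have h1 : (rep R S T).comp (FreeStarAlg.lift f) = Φ.comp (pairHom ζ R' S') := by
      refine FreeStarAlg.hom_ext fun x => ?_
      rw [StarAlgHom.comp_apply, StarAlgHom.comp_apply, pairHom, FreeStarAlg.lift_gen,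
        FreeStarAlg.lift_gen, hΦ]
    have h2 : rep R S T (FreeStarAlg.lift f a) = Φ (pairHom ζ R' S' a) := DFunLike.congr_fun h1 a
    rw [h2]
    exact (NonUnitalStarAlgHom.norm_apply_le Φ _).trans
      (norm_pairHom_le R' S' a)

theorem ofPair_j₁ (f : P ⊕ Q → BraidedTensor₃ ζ β γ δ) (h) (b : P) :
    ofPair (ρ := ρ) (σ := σ) f h (j₁ ζ ρ σ b) = f (Sum.inl b) :=
  UnivAlg.lift_gen (S := pairSeminorms ζ ρ σ) (hS := bddAbove_pairSeminorms ζ ρ σ) _ _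
    (Sum.inl b)

theorem ofPair_j₂ (f : P ⊕ Q → BraidedTensor₃ ζ β γ δ) (h) (c : Q) :
    ofPair (ρ := ρ) (σ := σ) f h (j₂ ζ ρ σ c) = f (Sum.inr c) :=
  UnivAlg.lift_gen (S := pairSeminorms ζ ρ σ) (hS := bddAbove_pairSeminorms ζ ρ σ) _ _
    (Sum.inr c)

variable (ζ β γ δ)

/-- The canonical homomorphism `B ⊠ C → B ⊠ C ⊠ D`. -/
def incl₁₂ : BraidedTensor ζ β γ →⋆ₐ[ℂ] BraidedTensor₃ ζ β γ δ :=
  ofPair (Sum.elim (k₁ ζ β γ δ) (k₂ ζ β γ δ)) fun R S T => ⟨R, S, leg₁ T.ι, by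
    rintro (b | c)
    · exact rep_k₁ R S T b
    · exact rep_k₂ R S T c⟩

/-- The canonical homomorphism `C ⊠ D → B ⊠ C ⊠ D`. -/
def incl₂₃ : BraidedTensor ζ γ δ →⋆ₐ[ℂ] BraidedTensor₃ ζ β γ δ :=
  -- The pair is `S, T`, amplified past the space of `R` by the braided second leg and rebracketed;
  -- the two hexagon identities identify the result with the second and third legs.
  ofPair (Sum.elim (k₂ ζ β γ δ) (k₃ ζ β γ δ)) fun R S T => ⟨S, T,
    ((assoc R.ι S.ι T.ι).conjStarAlgEquiv : BEll2 (R.ι × S.ι × T.ι) →⋆ₐ[ℂ] _).comp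
      (leg₂ ζ R.deg fun x : S.ι × T.ι => S.deg x.1 + T.deg x.2), by
    rintro (c | d)
    · exact (rep_k₂ R S T c).trans (assoc_conj_leg₂_leg₁ _ _ _ _ _).symm
    · exact (rep_k₃ R S T d).trans (assoc_conj_leg₂_leg₂ _ _ _ _ _).symm⟩

theorem rep_incl₁₂ (R : CovRep β) (S : CovRep γ) (T : CovRep δ) (x : BraidedTensor ζ β γ) :
    rep R S T (incl₁₂ ζ β γ δ x) = leg₁ T.ι (BraidedTensor.rep R S x) := by
  have h : (rep R S T).comp (incl₁₂ ζ β γ δ) = (leg₁ T.ι).comp (BraidedTensor.rep R S) := by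
    refine hom_ext (fun b => ?_) fun c => ?_
    · rw [StarAlgHom.comp_apply, StarAlgHom.comp_apply, incl₁₂, ofPair_j₁, rep_j₁]
      exact rep_k₁ R S T b
    · rw [StarAlgHom.comp_apply, StarAlgHom.comp_apply, incl₁₂, ofPair_j₂, rep_j₂]
      exact rep_k₂ R S T c
  exact DFunLike.congr_fun h x

theorem rep_incl₂₃ (R : CovRep β) (S : CovRep γ) (T : CovRep δ) (x : BraidedTensor ζ γ δ) :
    rep R S T (incl₂₃ ζ β γ δ x) = (assoc R.ι S.ι T.ι).conjStarAlgEquiv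
      (leg₂ ζ R.deg (fun x : S.ι × T.ι => S.deg x.1 + T.deg x.2) (BraidedTensor.rep S T x)) := by
  have h : (rep R S T).comp (incl₂₃ ζ β γ δ) =
      (((assoc R.ι S.ι T.ι).conjStarAlgEquiv : BEll2 (R.ι × S.ι × T.ι) →⋆ₐ[ℂ] _).comp
        (leg₂ ζ R.deg fun x : S.ι × T.ι => S.deg x.1 + T.deg x.2)).comp
          (BraidedTensor.rep S T) := by
    refine hom_ext (fun b => ?_) fun c => ?_
    · rw [StarAlgHom.comp_apply, StarAlgHom.comp_apply, incl₂₃, ofPair_j₁, rep_j₁]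
      exact (rep_k₂ R S T b).trans (assoc_conj_leg₂_leg₁ _ _ _ _ _).symm
    · rw [StarAlgHom.comp_apply, StarAlgHom.comp_apply, incl₂₃, ofPair_j₂, rep_j₂]
      exact (rep_k₃ R S T c).trans (assoc_conj_leg₂_leg₂ _ _ _ _ _).symm
  exact DFunLike.congr_fun h x

variable {ζ β γ δ} {A : Type u} [CStarAlgebra A] {α : CircleAction A}

/-- The homomorphism `f ⊠ id : A ⊠ D → B ⊠ C ⊠ D` for an equivariant `f : A → B ⊠ C`. -/
def mapLeft (f : A →⋆ₐ[ℂ] BraidedTensor ζ β γ)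
    (hf : ∀ z a, f (α.act z a) =
      map ζ (β.act z) (β.equivariant_act z) (γ.act z) (γ.equivariant_act z) (f a)) :
    BraidedTensor ζ α δ →⋆ₐ[ℂ] BraidedTensor₃ ζ β γ δ :=
  ofPair (Sum.elim (fun a => incl₁₂ ζ β γ δ (f a)) (k₃ ζ β γ δ)) fun R S T =>
    ⟨R.pair S f hf, T, StarAlgHom.id ℂ _, by
      rintro (a | d)
      · exact rep_incl₁₂ _ _ _ _ R S T (f a)
      · exact rep_k₃ R S T d⟩

/-- The homomorphism `id ⊠ f : B ⊠ A → B ⊠ C ⊠ D` for an equivariant `f : A → C ⊠ D`. -/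
def mapRight (f : A →⋆ₐ[ℂ] BraidedTensor ζ γ δ)
    (hf : ∀ z a, f (α.act z a) =
      map ζ (γ.act z) (γ.equivariant_act z) (δ.act z) (δ.equivariant_act z) (f a)) :
    BraidedTensor ζ β α →⋆ₐ[ℂ] BraidedTensor₃ ζ β γ δ :=
  ofPair (Sum.elim (k₁ ζ β γ δ) fun a => incl₂₃ ζ β γ δ (f a)) fun R S T =>
    ⟨R, S.pair T f hf,
      ((assoc R.ι S.ι T.ι).conjStarAlgEquiv : BEll2 (R.ι × S.ι × T.ι) →⋆ₐ[ℂ] _), by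
      rintro (b | a)
      · exact (rep_k₁ R S T b).trans (assoc_conj_leg₁ _).symm
      · exact rep_incl₂₃ _ _ _ _ R S T (f a)⟩

end BraidedTensor₃

open BraidedTensor₃

/-- The existential in `Coassociative` is witnessed by the maps built above, whose values on the two
legs are those required. Only equality of the two composites remains. -/
theorem Coassociative.of_mapLeft_eq_mapRight {Δ : B →⋆ₐ[ℂ] BraidedTensor ζ β β}
    (hΔ : ∀ z b, Δ (β.act z b) =
      map ζ (β.act z) (β.equivariant_act z) (β.act z) (β.equivariant_act z) (Δ b))
    (h : (mapLeft (δ := β) Δ hΔ).comp Δ = (mapRight (β := β) Δ hΔ).comp Δ) :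
    Coassociative ζ β Δ :=
  ⟨incl₁₂ ζ β β β, incl₂₃ ζ β β β, mapLeft Δ hΔ, mapRight Δ hΔ,
    ⟨fun _ => ofPair_j₁ _ _ _, fun _ => ofPair_j₂ _ _ _⟩,
    ⟨fun _ => ofPair_j₁ _ _ _, fun _ => ofPair_j₂ _ _ _⟩,
    ⟨fun _ => ofPair_j₁ _ _ _, fun _ => ofPair_j₂ _ _ _⟩,
    ⟨fun _ => ofPair_j₁ _ _ _, fun _ => ofPair_j₂ _ _ _⟩, fun b => DFunLike.congr_fun h b⟩

end Triple

open BraidedTensor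

/-! ### Coefficients of homogeneous vectors -/

section Coefficients

variable {V : Type v} [NormedAddCommGroup V] [InnerProductSpace ℂ V] {π : CircleRep V}
  {ι : Type u} [Fintype ι]

theorem exists_zpow_ne {m n : ℤ} (h : m ≠ n) : ∃ z : Circle, z ^ m ≠ z ^ n := by
  have h0 : ((m - n : ℤ) : ℝ) ≠ 0 := Int.cast_ne_zero.2 (sub_ne_zero.2 h)
  -- This `z` satisfies `z ^ (m - n) = exp (i π) = -1 ≠ 1`.
  refine ⟨Circle.exp (Real.pi / (m - n : ℤ)), fun h1 => ?_⟩
  have h2 : Circle.exp (Real.pi / (m - n : ℤ)) ^ (m - n) = 1 := by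
    rw [zpow_sub, h1, mul_inv_cancel]
  rw [← Circle.exp_zsmul, zsmul_eq_mul, mul_div_cancel₀ _ h0] at h2
  have h3 := congrArg (fun z : Circle => (z : ℂ)) h2
  simp only [Circle.coe_exp, Complex.exp_pi_mul_I, Circle.coe_one] at h3
  norm_num at h3

namespace Eigenbasis

theorem repr_op (E : Eigenbasis π ι) (z : Circle) (v : V) (i : ι) :
    E.basis.toBasis.repr (π.op z v) i =
      ((z ^ E.deg i : Circle) : ℂ) * E.basis.toBasis.repr v i := by
  classical
  have h : (E.basis.toBasis.coord i).comp (π.op z).toLinearMap =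
      ((z ^ E.deg i : Circle) : ℂ) • E.basis.toBasis.coord i := by
    refine E.basis.toBasis.ext fun j => ?_
    simp only [LinearMap.comp_apply, LinearEquiv.coe_coe, OrthonormalBasis.coe_toBasis, E.eigen,
      map_smul, LinearMap.smul_apply, smul_eq_mul]
    rw [← OrthonormalBasis.coe_toBasis, Module.Basis.coord_apply, Module.Basis.repr_self,
      Finsupp.single_apply]
    split_ifs with hj
    · rw [hj]
    · rw [mul_zero, mul_zero]
  exact DFunLike.congr_fun h v

theorem coeff_map (E : Eigenbasis π ι) (z : Circle) (ω : V ⊗[ℂ] V) (i j : ι) :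
    E.coeff (TensorProduct.map (π.op z).toLinearMap (π.op z).toLinearMap ω) i j =
      ((z ^ (E.deg i + E.deg j) : Circle) : ℂ) * E.coeff ω i j := by
  simp only [coeff, Matrix.of_apply]
  induction ω using TensorProduct.induction_on with
  | zero => simp
  | tmul x y =>
    rw [TensorProduct.map_tmul, Module.Basis.tensorProduct_repr_tmul_apply,
      Module.Basis.tensorProduct_repr_tmul_apply, LinearEquiv.coe_coe, repr_op, repr_op, zpow_add,
      Circle.coe_mul, smul_eq_mul, smul_eq_mul]
    ring
  | add x y hx hy => rw [map_add, map_add, map_add, Finsupp.add_apply, Finsupp.add_apply, hx, hy,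
      mul_add]

/-- The basis vector `e_i ⊗ e_j` has degree `d_i + d_j`, and distinct characters of the circle are
distinguished by some `z`. All comparisons of phases in the relations depend on this. -/
theorem deg_add_deg (E : Eigenbasis π ι) {d : ℤ} {ω : V ⊗[ℂ] V} (hω : IsHomogeneous π d ω)
    {i j : ι} (h : E.coeff ω i j ≠ 0) : E.deg i + E.deg j = d := by
  by_contra hd
  obtain ⟨z, hz⟩ := exists_zpow_ne hd
  have h1 := E.coeff_map z ω i j
  rw [hω z] at h1
  have h2 : E.coeff (((z ^ d : Circle) : ℂ) • ω) i j = ((z ^ d : Circle) : ℂ) * E.coeff ω i j := by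
    simp [coeff]
  rw [h2] at h1
  exact hz (Circle.ext (mul_right_cancel₀ h h1)).symm

/-- The matrix of `ω` represents the basis-free map `V* → V`, `ξ ↦ (id ⊗ ξ)(ω)`. This lets
invertibility pass from one eigenbasis to another. -/
theorem coeff_mulVec (E : Eigenbasis π ι) (ω : V ⊗[ℂ] V) (ξ : Module.Dual ℂ V) (i : ι) :
    (E.coeff ω).mulVec (fun j => ξ (E.basis j)) i =
      E.basis.toBasis.repr (TensorProduct.rid ℂ V (LinearMap.lTensor V ξ ω)) i := by
  simp only [coeff, Matrix.mulVec, dotProduct, Matrix.of_apply]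
  induction ω using TensorProduct.induction_on with
  | zero => simp
  | tmul x y =>
    simp only [Module.Basis.tensorProduct_repr_tmul_apply, LinearMap.lTensor_tmul,
      TensorProduct.rid_tmul, map_smul, Finsupp.smul_apply, smul_eq_mul]
    have h := congrArg ξ (E.basis.sum_repr y)
    rw [map_sum] at h
    simp only [map_smul, smul_eq_mul] at h
    rw [← h, Finset.sum_mul]
    refine Finset.sum_congr rfl fun j _ => ?_
    rw [OrthonormalBasis.coe_toBasis_repr_apply, OrthonormalBasis.coe_toBasis_repr_apply]
    ring
  | add x y hx hy =>
    simp only [map_add, Finsupp.add_apply, add_mul, Finset.sum_add_distrib, hx, hy]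

end Eigenbasis

variable [FiniteDimensional ℂ V] [DecidableEq ι] {ζ : Circle}

/-- The coefficient matrix of `ω` is invertible for each eigenbasis. -/
theorem OrthDatum.isUnit_coeff (D : OrthDatum ζ V) (E : Eigenbasis D.π ι) :
    IsUnit (E.coeff D.ω) := by
  obtain ⟨n, F, c, hc, hF⟩ := D.nondegenerate
  have hF' : IsUnit (F.coeff D.ω) := by
    rw [Matrix.isUnit_iff_isUnit_det, isUnit_iff_ne_zero]
    -- Taking determinants in the hypothesis on `Ω`, the right-hand side is a power of `c` times
    -- phases, hence non-zero.
    intro h0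
    have h1 := congrArg Matrix.det hF
    rw [Matrix.det_mul, h0, mul_zero, Matrix.det_smul, Matrix.det_diagonal] at h1
    refine mul_ne_zero (pow_ne_zero _ hc) (Finset.prod_ne_zero_iff.2 fun i _ => ?_) h1.symm
    exact Circle.coe_ne_zero _
  -- Invertibility in the basis `F`, rephrased without a basis: slicing `ω` by a functional is
  -- injective.
  have hinj : ∀ ξ : Module.Dual ℂ V,
      TensorProduct.rid ℂ V (LinearMap.lTensor V ξ D.ω) = 0 → ξ = 0 := fun ξ hξ => by
    have h1 : (F.coeff D.ω).mulVec (fun j => ξ (F.basis j)) = (F.coeff D.ω).mulVec 0 := by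
      rw [Matrix.mulVec_zero]
      funext i
      rw [F.coeff_mulVec, hξ]
      simp
    have h2 := Matrix.mulVec_injective_of_isUnit hF' h1
    refine F.basis.toBasis.ext fun j => ?_
    rw [OrthonormalBasis.coe_toBasis]
    exact congrFun h2 j
  rw [← Matrix.mulVec_injective_iff_isUnit]
  refine (injective_iff_map_eq_zero (Matrix.mulVecLin (E.coeff D.ω))).2 fun x hx => ?_
  -- A kernel vector of the matrix for `E` is read as the functional with these values on the basis.
  let ξ : Module.Dual ℂ V := E.basis.toBasis.constr ℂ x
  have hξ : (fun j => ξ (E.basis j)) = x := funext fun j => by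
    rw [← OrthonormalBasis.coe_toBasis]
    exact Module.Basis.constr_basis _ _ _ _
  have h0 : ξ = 0 := by
    refine hinj ξ ?_
    rw [← E.basis.toBasis.repr.map_eq_zero_iff]
    ext i
    rw [← E.coeff_mulVec, hξ]
    exact congrFun hx i
  rw [← hξ, h0]
  rfl

end Coefficients

/-! ### The relations of the braided free orthogonal quantum groups -/

section Relations

variable {ι : Type u} [Fintype ι] [DecidableEq ι]

/-- The matrix `x` over a `*`-algebra is unitary and satisfies
`ζ ^ (d_j d_i) ∑ₖ w i k • x j k = ζ ^ (d_j (d - d_j)) ∑ₖ w k j • (x k i)*`. -/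
structure OrthRel (ζ : Circle) (deg : ι → ℤ) (d : ℤ) (w : Matrix ι ι ℂ) {A : Type v} [Ring A]
    [StarRing A] [Algebra ℂ A] (x : ι → ι → A) : Prop where
  isometry : ∀ i j, ∑ k, star (x k i) * x k j = if i = j then 1 else 0
  coisometry : ∀ i j, ∑ k, x i k * star (x j k) = if i = j then 1 else 0
  orth : ∀ i j, ((ζ ^ (deg j * deg i) : Circle) : ℂ) • (∑ k, w i k • x j k) =
    ((ζ ^ (deg j * (d - deg j)) : Circle) : ℂ) • ∑ k, w k j • star (x k i)

namespace OrthRel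

variable {ζ : Circle} {deg : ι → ℤ} {d : ℤ} {w : Matrix ι ι ℂ} {A : Type v} [Ring A] [StarRing A]
  [Algebra ℂ A] {x y : ι → ι → A}

theorem map {A' : Type*} [Ring A'] [StarRing A'] [Algebra ℂ A'] (h : OrthRel ζ deg d w x)
    (f : A →⋆ₐ[ℂ] A') : OrthRel ζ deg d w fun i j => f (x i j) where
  isometry i j := by
    have := congrArg f (h.isometry i j)
    simpa only [map_sum, map_mul, map_star, apply_ite f, map_one, map_zero] using this
  coisometry i j := by
    have := congrArg f (h.coisometry i j)
    simpa only [map_sum, map_mul, map_star, apply_ite f, map_one, map_zero] using this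
  orth i j := by
    have := congrArg f (h.orth i j)
    simpa only [map_sum, map_smul, map_star] using this

/-- Solving for the sum without adjoints allows the relation to be substituted for one factor of a
matrix product. -/
theorem sum_right (h : OrthRel ζ deg d w x) (i j : ι) : ∑ k, w i k • x j k =
    ((ζ ^ (deg j * (d - deg j) - deg j * deg i) : Circle) : ℂ) • ∑ k, w k j • star (x k i) := by
  rw [sub_eq_neg_add, zpow_add, Circle.coe_mul, mul_smul, ← h.orth, smul_smul, ← Circle.coe_mul,
    ← zpow_add, neg_add_cancel, zpow_zero, Circle.coe_one, one_smul]

/-- The product of two matrices that satisfy the relations satisfies them if the entries satisfy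
the braided commutation relations. -/
theorem mul (hx : OrthRel ζ deg d w x) (hy : OrthRel ζ deg d w y)
    (hw : ∀ i j, w i j ≠ 0 → deg i + deg j = d)
    (hxy : ∀ i k m, star (y k i) * star (x m k) =
      ((ζ ^ ((deg k - deg i) * (deg m - deg k)) : Circle) : ℂ) • (star (x m k) * star (y k i))) :
    OrthRel ζ deg d w fun i k => ∑ l, x i l * y l k where
  isometry i j := by
    have h1 : ∀ k, star (∑ l, x k l * y l i) * ∑ l, x k l * y l j =
        ∑ l, ∑ m, star (y l i) * (star (x k l) * x k m) * y m j := fun k => by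
      rw [star_sum, Finset.sum_mul_sum]
      simp only [star_mul, mul_assoc]
    simp only [h1]
    rw [Finset.sum_comm, ← hy.isometry i j]
    refine Finset.sum_congr rfl fun l _ => ?_
    rw [Finset.sum_comm]
    simp only [← Finset.sum_mul, ← Finset.mul_sum, hx.isometry]
    simp
  coisometry i j := by
    have h1 : ∀ k, (∑ l, x i l * y l k) * star (∑ l, x j l * y l k) =
        ∑ l, ∑ m, x i l * (y l k * star (y m k)) * star (x j m) := fun k => by
      rw [star_sum, Finset.sum_mul_sum]
      simp only [star_mul, mul_assoc]
    simp only [h1]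
    rw [Finset.sum_comm, ← hx.coisometry i j]
    refine Finset.sum_congr rfl fun l _ => ?_
    rw [Finset.sum_comm]
    simp only [← Finset.sum_mul, ← Finset.mul_sum, hy.coisometry]
    simp
  orth i j := by
    -- The relation for `y` replaces `∑ₖ w i k • y l k` by adjoints. Where `w k l ≠ 0`, substituting
    -- `deg l = d - deg k` makes the phase independent of `l`, so the sum over `l` becomes a
    -- left-hand side for `x`.
    have h1 : ∑ k, w i k • ∑ l, x j l * y l k =
        ∑ k, ((ζ ^ ((d - deg k) * (deg k - deg i)) : Circle) : ℂ) •
          ((∑ l, w k l • x j l) * star (y k i)) := by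
      calc ∑ k, w i k • ∑ l, x j l * y l k = ∑ l, x j l * ∑ k, w i k • y l k := by
            simp only [Finset.smul_sum, Finset.mul_sum]
            rw [Finset.sum_comm]
            simp only [mul_smul_comm]
        _ = ∑ l, ∑ k, ((ζ ^ (deg l * (d - deg l) - deg l * deg i) : Circle) : ℂ) • w k l •
            (x j l * star (y k i)) := by
            simp only [hy.sum_right, Finset.smul_sum, Finset.mul_sum, mul_smul_comm]
        _ = _ := by
            rw [Finset.sum_comm]
            refine Finset.sum_congr rfl fun k _ => ?_
            rw [Finset.sum_mul, Finset.smul_sum]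
            refine Finset.sum_congr rfl fun l _ => ?_
            rw [smul_mul_assoc]
            rcases eq_or_ne (w k l) 0 with h0 | h0
            · rw [h0, zero_smul, smul_zero, smul_zero]
            · rw [← hw k l h0]
              congr 3
              ring
    -- Taking adjoints reverses the factors, and the commutation relation restores the order. Where
    -- `w m j ≠ 0`, substituting `deg m = d - deg j` makes the resulting phase independent of `m`.
    have h2 : ∑ m, w m j • star (∑ k, x m k * y k i) =
        ∑ k, ((ζ ^ ((deg k - deg i) * (d - deg j - deg k)) : Circle) : ℂ) •
          ((∑ m, w m j • star (x m k)) * star (y k i)) := by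
      simp only [star_sum, star_mul, Finset.smul_sum, Finset.sum_mul, hxy]
      rw [Finset.sum_comm]
      refine Finset.sum_congr rfl fun k _ => Finset.sum_congr rfl fun m _ => ?_
      rw [smul_mul_assoc, smul_comm]
      rcases eq_or_ne (w m j) 0 with h0 | h0
      · rw [h0, zero_smul, smul_zero, smul_zero]
      · rw [← hw m j h0]
        congr 4
        ring
    -- Both sides are now sums over `k` with right factor `star (y k i)`, and the relation for `x`
    -- matches them term by term.
    rw [h1, h2, Finset.smul_sum, Finset.smul_sum]
    refine Finset.sum_congr rfl fun k _ => ?_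
    rw [hx.sum_right, smul_mul_assoc, smul_smul, smul_smul, smul_smul, ← Circle.coe_mul,
      ← Circle.coe_mul, ← Circle.coe_mul, ← zpow_add, ← zpow_add, ← zpow_add]
    congr 3
    ring

variable [StarModule ℂ A]

theorem circle_star (z : Circle) (n : ℤ) :
    star ((z ^ n : Circle) : ℂ) = ((z ^ (-n) : Circle) : ℂ) := by
  rw [zpow_neg, Circle.coe_inv_eq_conj]
  rfl

/-- The relations are invariant under the circle action of degree `deg k - deg i` on the entries
`x i k`. -/
theorem twist (h : OrthRel ζ deg d w x) (hw : ∀ i j, w i j ≠ 0 → deg i + deg j = d)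
    (z : Circle) :
    OrthRel ζ deg d w fun i k => ((z ^ (deg k - deg i) : Circle) : ℂ) • x i k where
  isometry i j := by
    have h1 : ∀ k, star (((z ^ (deg i - deg k) : Circle) : ℂ) • x k i) *
        ((z ^ (deg j - deg k) : Circle) : ℂ) • x k j =
        ((z ^ (deg j - deg i) : Circle) : ℂ) • (star (x k i) * x k j) := fun k => by
      rw [star_smul, circle_star, smul_mul_smul_comm, ← Circle.coe_mul, ← zpow_add]
      congr 3
      ring
    simp only [h1]
    rw [← Finset.smul_sum, h.isometry]
    split_ifs with hij
    · rw [hij, sub_self, zpow_zero, Circle.coe_one, one_smul]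
    · rw [smul_zero]
  coisometry i j := by
    have h1 : ∀ k, ((z ^ (deg k - deg i) : Circle) : ℂ) • x i k *
        star (((z ^ (deg k - deg j) : Circle) : ℂ) • x j k) =
        ((z ^ (deg j - deg i) : Circle) : ℂ) • (x i k * star (x j k)) := fun k => by
      rw [star_smul, circle_star, smul_mul_smul_comm, ← Circle.coe_mul, ← zpow_add]
      congr 3
      ring
    simp only [h1]
    rw [← Finset.smul_sum, h.coisometry]
    split_ifs with hij
    · rw [hij, sub_self, zpow_zero, Circle.coe_one, one_smul]
    · rw [smul_zero]
  orth i j := by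
    -- Both sides of the relation are homogeneous of the same degree `d - deg i - deg j`, so the
    -- twist multiplies the whole equation by one scalar.
    have h1 : ∀ k, w i k • ((z ^ (deg k - deg j) : Circle) : ℂ) • x j k =
        ((z ^ (d - deg i - deg j) : Circle) : ℂ) • w i k • x j k := fun k => by
      rw [smul_comm]
      rcases eq_or_ne (w i k) 0 with h0 | h0
      · rw [h0, zero_smul, smul_zero, smul_zero]
      · rw [← hw i k h0]
        congr 4
        ring
    have h2 : ∀ k, w k j • star (((z ^ (deg i - deg k) : Circle) : ℂ) • x k i) =
        ((z ^ (d - deg i - deg j) : Circle) : ℂ) • w k j • star (x k i) := fun k => by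
      rw [star_smul, circle_star, smul_comm]
      rcases eq_or_ne (w k j) 0 with h0 | h0
      · rw [h0, zero_smul, smul_zero, smul_zero]
      · rw [← hw k j h0]
        congr 4
        ring
    simp only [h1, h2]
    rw [← Finset.smul_sum, ← Finset.smul_sum, smul_comm, h.orth, smul_comm]

end OrthRel

end Relations

/-! ### Stabilizers of closed subspaces -/

section Stabilizer

variable {A : Type u} [NormedRing A] [NormedAlgebra ℂ A]

/-- The elements that map a subspace into itself by right multiplication. -/
def rightStabilizer (X : Submodule ℂ A) : Subalgebra ℂ A where
  carrier := {y | ∀ x ∈ X, x * y ∈ X}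
  mul_mem' ha hb x hx := by rw [← mul_assoc]; exact hb _ (ha x hx)
  add_mem' ha hb x hx := by rw [mul_add]; exact X.add_mem (ha x hx) (hb x hx)
  algebraMap_mem' c x hx := by
    rw [← Algebra.commutes, ← Algebra.smul_def]; exact X.smul_mem c hx

/-- The elements that map a subspace into itself by left multiplication. -/
def leftStabilizer (X : Submodule ℂ A) : Subalgebra ℂ A where
  carrier := {y | ∀ x ∈ X, y * x ∈ X}
  mul_mem' ha hb x hx := by rw [mul_assoc]; exact ha _ (hb x hx)
  add_mem' ha hb x hx := by rw [add_mul]; exact X.add_mem (ha x hx) (hb x hx)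
  algebraMap_mem' c x hx := by rw [← Algebra.smul_def]; exact X.smul_mem c hx

theorem isClosed_rightStabilizer {X : Submodule ℂ A} (hX : IsClosed (X : Set A)) :
    IsClosed (rightStabilizer X : Set A) := by
  have h : (rightStabilizer X : Set A) = ⋂ x ∈ X, (fun y => x * y) ⁻¹' (X : Set A) := by
    ext y
    simp only [Set.mem_iInter]
    rfl
  rw [h]
  exact isClosed_biInter fun x _ => hX.preimage (continuous_const.mul continuous_id)

theorem isClosed_leftStabilizer {X : Submodule ℂ A} (hX : IsClosed (X : Set A)) :
    IsClosed (leftStabilizer X : Set A) := by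
  have h : (leftStabilizer X : Set A) = ⋂ x ∈ X, (fun y => y * x) ⁻¹' (X : Set A) := by
    ext y
    simp only [Set.mem_iInter]
    rfl
  rw [h]
  exact isClosed_biInter fun x _ => hX.preimage (continuous_id.mul continuous_const)

/-- Right multiplication by `y` is linear and continuous, so its effect on the closed span is
controlled by the spanning set. -/
theorem mem_rightStabilizer_closure_span {G : Set A} {y : A}
    (h : ∀ g ∈ G, g * y ∈ (Submodule.span ℂ G).topologicalClosure) :
    y ∈ rightStabilizer (Submodule.span ℂ G).topologicalClosure := by
  have h1 : (Submodule.span ℂ G).topologicalClosure ≤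
      (Submodule.span ℂ G).topologicalClosure.comap (LinearMap.mulRight ℂ y) := by
    refine Submodule.topologicalClosure_minimal _ (Submodule.span_le.2 h) ?_
    exact (Submodule.isClosed_topologicalClosure _).preimage (continuous_id.mul continuous_const)
  exact fun x hx => h1 hx

theorem mem_leftStabilizer_closure_span {G : Set A} {y : A}
    (h : ∀ g ∈ G, y * g ∈ (Submodule.span ℂ G).topologicalClosure) :
    y ∈ leftStabilizer (Submodule.span ℂ G).topologicalClosure := by
  have h1 : (Submodule.span ℂ G).topologicalClosure ≤
      (Submodule.span ℂ G).topologicalClosure.comap (LinearMap.mulLeft ℂ y) := by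
    refine Submodule.topologicalClosure_minimal _ (Submodule.span_le.2 h) ?_
    exact (Submodule.isClosed_topologicalClosure _).preimage (continuous_const.mul continuous_id)
  exact fun x hx => h1 hx

end Stabilizer

/-- `M` need not be closed under adjoints, so membership of the adjoints of the generators has to be
assumed separately. -/
theorem UnivAlg.mem_of_isClosed {X : Type u} {S : Set (CStarSeminorm (FreeStarAlg X))}
    {hS : ∀ a, BddAbove (Set.range fun p : S => p.1 a)} {M : Subalgebra ℂ (UnivAlg S hS)}
    (hM : IsClosed (M : Set (UnivAlg S hS))) (h : ∀ x, of S hS (FreeStarAlg.gen x) ∈ M)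
    (h' : ∀ x, star (of S hS (FreeStarAlg.gen x)) ∈ M) (a : UnivAlg S hS) : a ∈ M := by
  induction a using CStarCompletion.induct with
  | hc => exact hM
  | h a =>
    change of S hS a ∈ M
    induction a using FreeStarAlg.induction with
    | hc c => rw [AlgHomClass.commutes]; exact M.algebraMap_mem c
    | hs s =>
      rcases s with x | x
      · exact h x
      · rw [FreeStarAlg.sym_inr, map_star]; exact h' x
    | hmul a b ha hb => rw [map_mul]; exact M.mul_mem ha hb
    | hadd a b ha hb => rw [map_add]; exact M.add_mem ha hb

theorem BraidedTensor.mem_of_isClosed {B C : Type u} [CStarAlgebra B] [CStarAlgebra C]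
    {ζ : Circle} {β : CircleAction B} {γ : CircleAction C}
    {M : Subalgebra ℂ (BraidedTensor ζ β γ)} (hM : IsClosed (M : Set (BraidedTensor ζ β γ)))
    (h₁ : ∀ b, j₁ ζ β γ b ∈ M) (h₂ : ∀ c, j₂ ζ β γ c ∈ M) (a : BraidedTensor ζ β γ) : a ∈ M := by
  refine UnivAlg.mem_of_isClosed hM ?_ ?_ a
  · rintro (b | c)
    · exact h₁ b
    · exact h₂ c
  · rintro (b | c)
    · have h := h₁ (star b)
      rw [map_star] at h
      exact h
    · have h := h₂ (star c)
      rw [map_star] at h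
      exact h

/-! ### The `C*`-algebra `A_o(V, π, ω)` -/

section Ao

variable {V : Type v} [NormedAddCommGroup V] [InnerProductSpace ℂ V] [FiniteDimensional ℂ V]
  {ζ : Circle} {ι : Type u} [Fintype ι] [DecidableEq ι] (D : OrthDatum ζ V)
  (E : Eigenbasis D.π ι)

theorem aoGen_orthRel : OrthRel ζ E.deg D.d (E.coeff D.ω) (aoGen D E) where
  isometry i j := by
    have h := UnivAlg.of_eq_of _ (bddAbove_aoSeminorms D E) fun p hp => hp.1 i j
    simpa only [aoGen, map_sum, map_mul, map_star,
      apply_ite (UnivAlg.of _ (bddAbove_aoSeminorms D E)), map_one, map_zero] using h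
  coisometry i j := by
    have h := UnivAlg.of_eq_of _ (bddAbove_aoSeminorms D E) fun p hp => hp.2.1 i j
    simpa only [aoGen, map_sum, map_mul, map_star,
      apply_ite (UnivAlg.of _ (bddAbove_aoSeminorms D E)), map_one, map_zero] using h
  orth i j := by
    have h := UnivAlg.of_eq_of _ (bddAbove_aoSeminorms D E) fun p hp => hp.2.2 i j
    simpa only [aoGen, map_sum, map_smul, map_star] using h

variable {D E}

theorem ao_hom_ext {A : Type w} [CStarAlgebra A] {f g : AoAlg D E →⋆ₐ[ℂ] A}
    (h : ∀ i j, f (aoGen D E i j) = g (aoGen D E i j)) : f = g :=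
  UnivAlg.hom_ext fun x => h x.1 x.2

/-- The `*`-homomorphism on `A_o(V, π, ω)` with given values on the generators. -/
def aoLift {A : Type w} [CStarAlgebra A] {x : ι → ι → A}
    (hx : OrthRel ζ E.deg D.d (E.coeff D.ω) x) : AoAlg D E →⋆ₐ[ℂ] A :=
  UnivAlg.lift (S := aoSeminorms D E) (hS := bddAbove_aoSeminorms D E) (fun p => x p.1 p.2)
    (by
      refine fun a => CStarSeminorm.le_sup
        (p := CStarSeminorm.ofHom (FreeStarAlg.lift fun p : ι × ι => x p.1 p.2))
        (bddAbove_aoSeminorms D E) ⟨fun i j => ?_, fun i j => ?_, fun i j => ?_⟩ a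
      · rw [CStarSeminorm.ofHom_apply, norm_eq_zero, map_sub, sub_eq_zero]
        simpa only [map_sum, map_mul, map_star, FreeStarAlg.lift_gen,
          apply_ite (FreeStarAlg.lift fun p : ι × ι => x p.1 p.2), map_one, map_zero]
          using hx.isometry i j
      · rw [CStarSeminorm.ofHom_apply, norm_eq_zero, map_sub, sub_eq_zero]
        simpa only [map_sum, map_mul, map_star, FreeStarAlg.lift_gen,
          apply_ite (FreeStarAlg.lift fun p : ι × ι => x p.1 p.2), map_one, map_zero]
          using hx.coisometry i j
      · rw [CStarSeminorm.ofHom_apply, norm_eq_zero, map_sub, sub_eq_zero]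
        simpa only [map_sum, map_smul, map_star, FreeStarAlg.lift_gen] using hx.orth i j)

theorem aoLift_gen {A : Type w} [CStarAlgebra A] {x : ι → ι → A}
    (hx : OrthRel ζ E.deg D.d (E.coeff D.ω) x) (i j : ι) : aoLift hx (aoGen D E i j) = x i j :=
  UnivAlg.lift_gen (S := aoSeminorms D E) (hS := bddAbove_aoSeminorms D E) _ _ (i, j)

/-- The adjoints of the generators are linear combinations of the generators, so that a closed
subalgebra that contains the generators is everything. -/
theorem ao_mem_of_isClosed {M : Subalgebra ℂ (AoAlg D E)} (hM : IsClosed (M : Set (AoAlg D E)))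
    (h : ∀ i j, aoGen D E i j ∈ M) (a : AoAlg D E) : a ∈ M := by
  refine UnivAlg.mem_of_isClosed hM (fun x => h x.1 x.2) ?_ a
  rintro ⟨m, i⟩
  change star (aoGen D E m i) ∈ M
  -- The third relation expresses these combinations of adjoints through the generators themselves.
  have hsum : ∀ j, ∑ k, E.coeff D.ω k j • star (aoGen D E k i) ∈ M := fun j => by
    have h1 := (aoGen_orthRel D E).orth i j
    rw [← inv_smul_eq_iff₀ (Circle.coe_ne_zero _)] at h1
    rw [← h1]
    exact M.smul_mem (M.smul_mem (M.sum_mem fun k _ => M.smul_mem (h j k) _) _) _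
  -- The inverse matrix recovers each single adjoint from these combinations.
  have hinv : E.coeff D.ω * (E.coeff D.ω)⁻¹ = 1 :=
    Matrix.mul_nonsing_inv _ ((Matrix.isUnit_iff_isUnit_det _).1 (D.isUnit_coeff E))
  have h2 : star (aoGen D E m i) = ∑ j, (E.coeff D.ω)⁻¹ j m •
      ∑ k, E.coeff D.ω k j • star (aoGen D E k i) := by
    have h3 : ∀ k, ∑ j, E.coeff D.ω k j * (E.coeff D.ω)⁻¹ j m = if k = m then 1 else 0 :=
      fun k => by rw [← Matrix.mul_apply, hinv, Matrix.one_apply]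
    simp only [Finset.smul_sum, smul_smul]
    rw [Finset.sum_comm]
    simp only [← Finset.sum_smul, mul_comm ((E.coeff D.ω)⁻¹ _ m), h3]
    simp
  rw [h2]
  exact M.sum_mem fun j _ => M.smul_mem (hsum j) _

variable (D E)

/-- The circle action on `A_o(V, π, ω)`. -/
def aoAction : CircleAction (AoAlg D E) where
  act z := aoLift ((aoGen_orthRel D E).twist (fun _ _ => E.deg_add_deg D.homogeneous) z)
  act_one b := by
    have h : aoLift ((aoGen_orthRel D E).twist (fun _ _ => E.deg_add_deg D.homogeneous) 1) =
        StarAlgHom.id ℂ _ :=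
      ao_hom_ext fun i j => by
        rw [aoLift_gen, one_zpow, Circle.coe_one, one_smul]
        rfl
    exact DFunLike.congr_fun h b
  act_mul z w b := by
    have h : aoLift ((aoGen_orthRel D E).twist (fun _ _ => E.deg_add_deg D.homogeneous) (z * w)) =
        (aoLift ((aoGen_orthRel D E).twist (fun _ _ => E.deg_add_deg D.homogeneous) z)).comp
          (aoLift ((aoGen_orthRel D E).twist (fun _ _ => E.deg_add_deg D.homogeneous) w)) :=
      ao_hom_ext fun i j => by
        rw [StarAlgHom.comp_apply, aoLift_gen, aoLift_gen, map_smul, aoLift_gen, smul_smul,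
          ← Circle.coe_mul, mul_zpow, mul_comm]
    exact DFunLike.congr_fun h b
  continuous_act b := by
    let F : Circle → AoAlg D E →⋆ₐ[ℂ] AoAlg D E := fun z =>
      aoLift ((aoGen_orthRel D E).twist (fun _ _ => E.deg_add_deg D.homogeneous) z)
    let M : Subalgebra ℂ (AoAlg D E) :=
      { carrier := {b | Continuous fun z => F z b}
        mul_mem' := fun {a b} ha hb => by
          simp only [Set.mem_ofPred_eq, map_mul] at ha hb ⊢
          exact ha.mul hb
        add_mem' := fun {a b} ha hb => by
          simp only [Set.mem_ofPred_eq, map_add] at ha hb ⊢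
          exact ha.add hb
        algebraMap_mem' := fun c => by
          simp only [Set.mem_ofPred_eq, AlgHomClass.commutes]
          exact continuous_const }
    -- The homomorphisms `F z` are contractive, so approximating `b` approximates its orbit
    -- uniformly in `z`, and a uniform limit of continuous functions is continuous.
    have hM : IsClosed (M : Set (AoAlg D E)) := by
      refine isClosed_of_closure_subset fun b hb => ?_
      refine continuous_of_uniform_approx_of_continuous fun s hs => ?_
      obtain ⟨ε, hε, hs⟩ := Metric.mem_uniformity_dist.1 hs
      obtain ⟨a, ha, hab⟩ := Metric.mem_closure_iff.1 hb ε hε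
      refine ⟨fun z => F z a, ha, fun z => ?_⟩
      refine hs ?_
      rw [dist_eq_norm, ← map_sub]
      refine (NonUnitalStarAlgHom.norm_apply_le (F z) _).trans_lt ?_
      rwa [← dist_eq_norm]
    refine ao_mem_of_isClosed hM (fun i j => ?_) b
    change Continuous fun z => F z (aoGen D E i j)
    simp only [F, aoLift_gen]
    exact (continuous_zpow (G := Circle) (E.deg j - E.deg i)).smul
      (continuous_const (y := aoGen D E i j))

theorem aoAction_gen (z : Circle) (i k : ι) : (aoAction D E).act z (aoGen D E i k) =
    ((z ^ (E.deg k - E.deg i) : Circle) : ℂ) • aoGen D E i k :=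
  aoLift_gen ((aoGen_orthRel D E).twist (fun _ _ => E.deg_add_deg D.homogeneous) z) i k

theorem aoAction_star_gen (z : Circle) (i k : ι) :
    (aoAction D E).act z (star (aoGen D E i k)) =
      ((z ^ (E.deg i - E.deg k) : Circle) : ℂ) • star (aoGen D E i k) := by
  rw [map_star, aoAction_gen, star_smul, OrthRel.circle_star, neg_sub]

/-- The matrix is the product of `j₁(u)` and `j₂(u)`. The commutation hypothesis of `OrthRel.mul`
holds because `star (u k i)` and `star (u m k)` are homogeneous of degrees `d_k - d_i` and `d_m -
d_k`. -/
theorem aoComul_orthRel : OrthRel ζ E.deg D.d (E.coeff D.ω) fun i k =>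
    ∑ l, j₁ ζ (aoAction D E) (aoAction D E) (aoGen D E i l) *
      j₂ ζ (aoAction D E) (aoAction D E) (aoGen D E l k) := by
  refine ((aoGen_orthRel D E).map (j₁ ζ (aoAction D E) (aoAction D E))).mul
    ((aoGen_orthRel D E).map (j₂ ζ (aoAction D E) (aoAction D E)))
    (fun _ _ => E.deg_add_deg D.homogeneous) fun i k m => ?_
  rw [← map_star, ← map_star, j₂_mul_j₁_of_right fun z => aoAction_star_gen D E z k i,
    aoAction_star_gen, map_smul, smul_mul_assoc, ← zpow_mul]

/-- The comultiplication of `A_o(V, π, ω)`. -/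
def aoComul : AoAlg D E →⋆ₐ[ℂ] BraidedTensor ζ (aoAction D E) (aoAction D E) :=
  aoLift (aoComul_orthRel D E)

theorem aoComul_gen (i k : ι) : aoComul D E (aoGen D E i k) =
    ∑ l, j₁ ζ (aoAction D E) (aoAction D E) (aoGen D E i l) *
      j₂ ζ (aoAction D E) (aoAction D E) (aoGen D E l k) :=
  aoLift_gen (aoComul_orthRel D E) i k

/-- The degrees telescope: `(d_l - d_i) + (d_k - d_l) = d_k - d_i`. -/
theorem aoComul_equivariant (z : Circle) (b : AoAlg D E) :
    aoComul D E ((aoAction D E).act z b) =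
      map ζ ((aoAction D E).act z) ((aoAction D E).equivariant_act z) ((aoAction D E).act z)
        ((aoAction D E).equivariant_act z) (aoComul D E b) := by
  have h : (aoComul D E).comp ((aoAction D E).act z) =
      (map ζ ((aoAction D E).act z) ((aoAction D E).equivariant_act z) ((aoAction D E).act z)
        ((aoAction D E).equivariant_act z)).comp (aoComul D E) := by
    refine ao_hom_ext fun i k => ?_
    rw [StarAlgHom.comp_apply, StarAlgHom.comp_apply, aoAction_gen, map_smul, aoComul_gen, map_sum,
      Finset.smul_sum]
    refine Finset.sum_congr rfl fun l _ => ?_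
    rw [map_mul, map_j₁, map_j₂, aoAction_gen, aoAction_gen, map_smul, map_smul,
      smul_mul_smul_comm, ← Circle.coe_mul, ← zpow_add]
    congr 3
    ring
  exact DFunLike.congr_fun h b

-- On `u i k`, both composites become the double sum of `k₁(u i l) k₂(u l m) k₃(u m k)`.
open BraidedTensor₃ in
theorem aoComul_coassociative : Coassociative ζ (aoAction D E) (aoComul D E) := by
  refine Coassociative.of_mapLeft_eq_mapRight (aoComul_equivariant D E)
    (ao_hom_ext fun i k => ?_)
  rw [StarAlgHom.comp_apply, StarAlgHom.comp_apply, aoComul_gen, map_sum, map_sum]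
  simp only [map_mul, mapLeft, mapRight, ofPair_j₁, ofPair_j₂, Sum.elim_inl, Sum.elim_inr,
    aoComul_gen, map_sum, incl₁₂, incl₂₃, Finset.sum_mul, Finset.mul_sum]
  rw [Finset.sum_comm]
  simp only [mul_assoc]

-- The closed span `X` contains `1`, so it suffices that right multiplication by both legs preserves
-- it. For `j₂` this is clear. For `j₁(u i l)`, the braided commutation relation moves it past
-- `j₂(b)`, and `hgen` rewrites it through `Δ` and `j₂`.
open scoped CStarAlgebra in
theorem aoComul_podles₁ : Dense (Submodule.span ℂ
    {x | ∃ a b, x = aoComul D E a * j₂ ζ (aoAction D E) (aoAction D E) b} :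
      Set (BraidedTensor ζ (aoAction D E) (aoAction D E))) := by
  set X := (Submodule.span ℂ
    {x | ∃ a b, x = aoComul D E a * j₂ ζ (aoAction D E) (aoAction D E) b}).topologicalClosure
    with hX
  have hXc : IsClosed (X : Set (BraidedTensor ζ (aoAction D E) (aoAction D E))) :=
    Submodule.isClosed_topologicalClosure _
  have hmem : ∀ a b, aoComul D E a * j₂ ζ (aoAction D E) (aoAction D E) b ∈ X := fun a b =>
    Submodule.le_topologicalClosure _ (Submodule.subset_span ⟨a, b, rfl⟩)
  have hj₂ : ∀ c, j₂ ζ (aoAction D E) (aoAction D E) c ∈ rightStabilizer X := fun c => by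
    refine mem_rightStabilizer_closure_span ?_
    rintro _ ⟨a, b, rfl⟩
    rw [mul_assoc, ← map_mul]
    exact hmem _ _
  -- Multiplying `Δ(u) = j₁(u) j₂(u)` by `j₂(u*)` on the right and using `u u* = 1`.
  have hgen : ∀ i l, j₁ ζ (aoAction D E) (aoAction D E) (aoGen D E i l) =
      ∑ k, aoComul D E (aoGen D E i k) *
        j₂ ζ (aoAction D E) (aoAction D E) (star (aoGen D E l k)) := fun i l => by
    simp only [aoComul_gen, Finset.sum_mul, mul_assoc, ← map_mul]
    rw [Finset.sum_comm]
    simp only [← Finset.mul_sum, ← map_sum, (aoGen_orthRel D E).coisometry]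
    simp [apply_ite (j₂ ζ (aoAction D E) (aoAction D E))]
  have hj₁ : ∀ i l, j₁ ζ (aoAction D E) (aoAction D E) (aoGen D E i l) ∈ rightStabilizer X :=
    fun i l => by
    refine mem_rightStabilizer_closure_span ?_
    rintro _ ⟨a, b, rfl⟩
    rw [mul_assoc, j₂_mul_j₁_of_left fun z => aoAction_gen D E z i l, hgen, Finset.sum_mul,
      Finset.mul_sum]
    refine X.sum_mem fun k _ => ?_
    rw [mul_assoc, ← mul_assoc, ← map_mul, ← map_mul]
    exact hmem _ _
  have hc := isClosed_rightStabilizer hXc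
  have hj₁' : ∀ b, j₁ ζ (aoAction D E) (aoAction D E) b ∈ rightStabilizer X := fun b =>
    ao_mem_of_isClosed
      (M := (rightStabilizer X).comap (j₁ ζ (aoAction D E) (aoAction D E)).toAlgHom)
      (hc.preimage (map_continuous (j₁ ζ (aoAction D E) (aoAction D E)))) hj₁ b
  have h1 : (1 : BraidedTensor ζ (aoAction D E) (aoAction D E)) ∈ X := by
    have h := hmem 1 1
    rwa [map_one, map_one, mul_one] at h
  intro x
  have h2 := BraidedTensor.mem_of_isClosed hc hj₁' hj₂ x 1 h1
  rwa [one_mul] at h2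

-- The mirror image of the first Podleś condition, with left multiplication. Now `j₂(u l k)` moves
-- past `j₁(a)`, which is replaced by a rotated element.
open scoped CStarAlgebra in
theorem aoComul_podles₂ : Dense (Submodule.span ℂ
    {x | ∃ a b, x = j₁ ζ (aoAction D E) (aoAction D E) a * aoComul D E b} :
      Set (BraidedTensor ζ (aoAction D E) (aoAction D E))) := by
  set X := (Submodule.span ℂ
    {x | ∃ a b, x = j₁ ζ (aoAction D E) (aoAction D E) a * aoComul D E b}).topologicalClosure
    with hX
  have hXc : IsClosed (X : Set (BraidedTensor ζ (aoAction D E) (aoAction D E))) :=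
    Submodule.isClosed_topologicalClosure _
  have hmem : ∀ a b, j₁ ζ (aoAction D E) (aoAction D E) a * aoComul D E b ∈ X := fun a b =>
    Submodule.le_topologicalClosure _ (Submodule.subset_span ⟨a, b, rfl⟩)
  have hj₁ : ∀ c, j₁ ζ (aoAction D E) (aoAction D E) c ∈ leftStabilizer X := fun c => by
    refine mem_leftStabilizer_closure_span ?_
    rintro _ ⟨a, b, rfl⟩
    rw [← mul_assoc, ← map_mul]
    exact hmem _ _
  -- Multiplying `Δ(u) = j₁(u) j₂(u)` by `j₁(u*)` on the left and using `u* u = 1`.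
  have hgen : ∀ l k, j₂ ζ (aoAction D E) (aoAction D E) (aoGen D E l k) =
      ∑ i, j₁ ζ (aoAction D E) (aoAction D E) (star (aoGen D E i l)) *
        aoComul D E (aoGen D E i k) := fun l k => by
    simp only [aoComul_gen, Finset.mul_sum, ← mul_assoc, ← map_mul]
    rw [Finset.sum_comm]
    simp only [← Finset.sum_mul, ← map_sum, (aoGen_orthRel D E).isometry]
    simp [apply_ite (j₁ ζ (aoAction D E) (aoAction D E))]
  have hj₂ : ∀ l k, j₂ ζ (aoAction D E) (aoAction D E) (aoGen D E l k) ∈ leftStabilizer X :=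
    fun l k => by
    refine mem_leftStabilizer_closure_span ?_
    rintro _ ⟨a, b, rfl⟩
    rw [← mul_assoc, j₂_mul_j₁_of_right fun z => aoAction_gen D E z l k, hgen, Finset.mul_sum,
      Finset.sum_mul]
    refine X.sum_mem fun i _ => ?_
    rw [mul_assoc, mul_assoc, ← map_mul, ← mul_assoc, ← map_mul]
    exact hmem _ _
  have hc := isClosed_leftStabilizer hXc
  have hj₂' : ∀ b, j₂ ζ (aoAction D E) (aoAction D E) b ∈ leftStabilizer X := fun b =>
    ao_mem_of_isClosed
      (M := (leftStabilizer X).comap (j₂ ζ (aoAction D E) (aoAction D E)).toAlgHom)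
      (hc.preimage (map_continuous (j₂ ζ (aoAction D E) (aoAction D E)))) hj₂ b
  have h1 : (1 : BraidedTensor ζ (aoAction D E) (aoAction D E)) ∈ X := by
    have h := hmem 1 1
    rwa [map_one, map_one, mul_one] at h
  intro x
  have h2 := BraidedTensor.mem_of_isClosed hc hj₁ hj₂' x 1 h1
  rwa [mul_one] at h2

/-- The braided compact quantum group `A_o(V, π, ω)`. -/
def aoQG : BraidedQG ζ (AoAlg D E) where
  action := aoAction D E
  comul := aoComul D E
  equivariant := aoComul_equivariant D E
  coassoc := aoComul_coassociative D E
  podles₁ := aoComul_podles₁ D E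
  podles₂ := aoComul_podles₂ D E

theorem aoQG_isAo : IsAo D E (aoQG D E) := ⟨aoAction_gen D E, aoComul_gen D E⟩

variable {D E}

/-- Action and comultiplication are determined on generators; all other fields are propositions. The
actions are identified first because the codomain of the comultiplication depends on them. -/
theorem IsAo.eq {A A' : BraidedQG ζ (AoAlg D E)} (h : IsAo D E A) (h' : IsAo D E A') :
    A = A' := by
  obtain ⟨⟨act, h1, h2, h3⟩, Δ, h4, h5, h6, h7⟩ := A
  obtain ⟨⟨act', h1', h2', h3'⟩, Δ', h4', h5', h6', h7'⟩ := A'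
  obtain rfl : act = act' := funext fun z => ao_hom_ext fun i k =>
    (h.action_gen z i k).trans (h'.action_gen z i k).symm
  obtain rfl : Δ = Δ' := ao_hom_ext fun i k => (h.comul_gen i k).trans (h'.comul_gen i k).symm
  rfl

end Ao

/-! ### Matrix entries with respect to an eigenbasis -/

section Entries

variable {V : Type v} [NormedAddCommGroup V] [InnerProductSpace ℂ V] {π : CircleRep V}
  {ι : Type u} [Fintype ι] {B C : Type u} [CStarAlgebra B] [CStarAlgebra C]

namespace Eigenbasis

/-- The matrix entry `⟪e i, T (e j)⟫` of an operator `T`. -/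
def matrixCoeff (E : Eigenbasis π ι) (i j : ι) : Module.End ℂ V →ₗ[ℂ] ℂ :=
  (innerₛₗ ℂ (E.basis i)).comp (LinearMap.applyₗ (E.basis j))

theorem matrixCoeff_apply (E : Eigenbasis π ι) (i j : ι) (T : Module.End ℂ V) :
    E.matrixCoeff i j T = inner ℂ (E.basis i) (T (E.basis j)) := rfl

/-- The matrix entry in `B` of an element of `𝔹(V) ⊗ B`. -/
def entry (E : Eigenbasis π ι) (i j : ι) : Module.End ℂ V ⊗[ℂ] B →ₗ[ℂ] B :=
  (TensorProduct.lid ℂ B).toLinearMap.comp (LinearMap.rTensor B (E.matrixCoeff i j))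

theorem entry_tmul (E : Eigenbasis π ι) (i j : ι) (T : Module.End ℂ V) (b : B) :
    E.entry i j (T ⊗ₜ[ℂ] b) = (inner ℂ (E.basis i) (T (E.basis j)) : ℂ) • b := by
  simp [entry, matrixCoeff_apply]

theorem inner_op (E : Eigenbasis π ι) (z : Circle) (i : ι) (v : V) :
    inner ℂ (E.basis i) (π.op z v) = ((z ^ E.deg i : Circle) : ℂ) * inner ℂ (E.basis i) v := by
  have h := E.repr_op z v i
  rwa [OrthonormalBasis.coe_toBasis_repr_apply, OrthonormalBasis.coe_toBasis_repr_apply,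
    OrthonormalBasis.repr_apply_apply, OrthonormalBasis.repr_apply_apply] at h

theorem op_symm_basis (E : Eigenbasis π ι) (z : Circle) (i : ι) :
    (π.op z).symm (E.basis i) = ((z ^ (-E.deg i) : Circle) : ℂ) • E.basis i := by
  rw [LinearEquiv.symm_apply_eq, map_smul, E.eigen, smul_smul, ← Circle.coe_mul, ← zpow_add,
    neg_add_cancel, zpow_zero, Circle.coe_one, one_smul]

theorem entry_idTensor (E : Eigenbasis π ι) (f : B →⋆ₐ[ℂ] C) (i j : ι)
    (U : Module.End ℂ V ⊗[ℂ] B) : E.entry i j (idTensor V f U) = f (E.entry i j U) := by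
  induction U using TensorProduct.induction_on with
  | zero => simp
  | tmul T b =>
    change E.entry i j (T ⊗ₜ[ℂ] f b) = _
    rw [entry_tmul, entry_tmul, map_smul]
  | add x y hx hy => rw [map_add, map_add, hx, hy, map_add, map_add]

theorem entry_act (E : Eigenbasis π ι) (f : B →⋆ₐ[ℂ] C) (z : Circle) (i j : ι)
    (U : Module.End ℂ V ⊗[ℂ] B) :
    E.entry i j (TensorProduct.map (π.op z).conj.toLinearMap f.toAlgHom.toLinearMap U) =
      ((z ^ (E.deg i - E.deg j) : Circle) : ℂ) • f (E.entry i j U) := by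
  induction U using TensorProduct.induction_on with
  | zero => simp
  | tmul T b =>
    change E.entry i j ((π.op z).conj T ⊗ₜ[ℂ] f b) = _
    rw [entry_tmul, entry_tmul, map_smul, LinearEquiv.conj_apply_apply, op_symm_basis, map_smul,
      map_smul, inner_smul_right, inner_op, smul_smul, ← mul_assoc, ← Circle.coe_mul, ← zpow_add]
    congr 4
    ring
  | add x y hx hy => rw [map_add, map_add, hx, hy, map_add, map_add, smul_add]

theorem entry_mul (E : Eigenbasis π ι) (i j : ι) (U W : Module.End ℂ V ⊗[ℂ] B) :
    E.entry i j (U * W) = ∑ k, E.entry i k U * E.entry k j W := by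
  induction U using TensorProduct.induction_on with
  | zero => simp
  | add x y hx hy => simp only [add_mul, map_add, hx, hy, Finset.sum_add_distrib]
  | tmul S b =>
    induction W using TensorProduct.induction_on with
    | zero => simp
    | add x y hx hy => simp only [mul_add, map_add, hx, hy, Finset.sum_add_distrib]
    | tmul T c =>
      rw [Algebra.TensorProduct.tmul_mul_tmul]
      simp only [entry_tmul, smul_mul_smul_comm]
      rw [← Finset.sum_smul]
      congr 1
      have h := congrArg (fun v => inner ℂ (E.basis i) (S v)) (E.basis.sum_repr (T (E.basis j)))
      simp only [map_sum, map_smul, inner_sum, inner_smul_right,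
        OrthonormalBasis.repr_apply_apply] at h
      rw [Module.End.mul_apply, ← h]
      exact Finset.sum_congr rfl fun k _ => mul_comm _ _

theorem entry_star (E : Eigenbasis π ι) [FiniteDimensional ℂ V] (i j : ι)
    (U : Module.End ℂ V ⊗[ℂ] B) :
    E.entry i j (star U) = star (E.entry j i U) := by
  induction U using TensorProduct.induction_on with
  | zero => simp
  | tmul T b =>
    rw [TensorProduct.star_tmul, entry_tmul, entry_tmul, star_smul, LinearMap.star_eq_adjoint,
      LinearMap.adjoint_inner_right, ← inner_conj_symm]
    rfl
  | add x y hx hy => rw [star_add, map_add, hx, hy, map_add, star_add]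

theorem unit_apply (E : Eigenbasis π ι) (i j : ι) (v : V) :
    E.unit i j v = (inner ℂ (E.basis j) v : ℂ) • E.basis i := rfl

theorem map_unit_unit (E : Eigenbasis π ι) (i j a b : ι) (ω : V ⊗[ℂ] V) :
    TensorProduct.map (E.unit i j) (E.unit a b) ω =
      E.coeff ω j b • (E.basis i ⊗ₜ[ℂ] E.basis a) := by
  simp only [coeff, Matrix.of_apply]
  induction ω using TensorProduct.induction_on with
  | zero => simp
  | tmul x y =>
    rw [TensorProduct.map_tmul, unit_apply, unit_apply, TensorProduct.smul_tmul_smul,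
      Module.Basis.tensorProduct_repr_tmul_apply, OrthonormalBasis.coe_toBasis_repr_apply,
      OrthonormalBasis.coe_toBasis_repr_apply, OrthonormalBasis.repr_apply_apply,
      OrthonormalBasis.repr_apply_apply, smul_eq_mul, mul_comm]
  | add x y hx hy => rw [map_add, hx, hy, map_add, Finsupp.add_apply, add_smul]

variable [DecidableEq ι]

theorem entry_one (E : Eigenbasis π ι) (i j : ι) :
    E.entry i j (1 : Module.End ℂ V ⊗[ℂ] B) = if i = j then 1 else 0 := by
  rw [Algebra.TensorProduct.one_def, entry_tmul, Module.End.one_apply,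
    OrthonormalBasis.inner_eq_ite, ite_smul, one_smul, zero_smul]

theorem sum_unit (E : Eigenbasis π ι) (T : Module.End ℂ V) :
    ∑ i, ∑ j, (inner ℂ (E.basis i) (T (E.basis j)) : ℂ) • E.unit i j = T := by
  refine E.basis.toBasis.ext fun k => ?_
  simp only [OrthonormalBasis.coe_toBasis, LinearMap.sum_apply, LinearMap.smul_apply, unit_apply,
    OrthonormalBasis.inner_eq_ite]
  simpa [OrthonormalBasis.repr_apply_apply] using E.basis.sum_repr (T (E.basis k))

theorem sum_entry (E : Eigenbasis π ι) (U : Module.End ℂ V ⊗[ℂ] B) :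
    U = ∑ i, ∑ j, E.unit i j ⊗ₜ[ℂ] E.entry i j U := by
  induction U using TensorProduct.induction_on with
  | zero => simp
  | tmul T b =>
    simp only [entry_tmul, TensorProduct.tmul_smul]
    simp only [← TensorProduct.sum_tmul, TensorProduct.smul_tmul']
    rw [E.sum_unit]
  | add x y hx hy =>
    nth_rewrite 1 [hx, hy]
    simp only [map_add, TensorProduct.tmul_add, Finset.sum_add_distrib]

theorem ext_entry (E : Eigenbasis π ι) {U W : Module.End ℂ V ⊗[ℂ] B}
    (h : ∀ i j, E.entry i j U = E.entry i j W) : U = W := by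
  rw [E.sum_entry U, E.sum_entry W]
  simp only [h]

theorem entry_sum (E : Eigenbasis π ι) (x : ι → ι → B) (i j : ι) :
    E.entry i j (∑ k, ∑ l, E.unit k l ⊗ₜ[ℂ] x k l) = x i j := by
  simp only [map_sum, entry_tmul, unit_apply, inner_smul_right, OrthonormalBasis.inner_eq_ite]
  simp

theorem unit_mul_unit (E : Eigenbasis π ι) (i j k l : ι) :
    E.unit i j * E.unit k l = if j = k then E.unit i l else 0 := by
  ext v
  rw [Module.End.mul_apply, unit_apply, unit_apply, inner_smul_right,
    OrthonormalBasis.inner_eq_ite]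
  split_ifs
  · rw [mul_one, unit_apply]
  · rw [mul_zero, zero_smul, LinearMap.zero_apply]

variable [FiniteDimensional ℂ V]

/-- A basis vector of degree `k` is fixed by the projection. One of another degree is orthogonal to
all `k`-homogeneous vectors, because some `z` separates the two characters. -/
theorem proj_eq (E : Eigenbasis π ι) (k : ℤ) :
    π.proj k = ∑ a, if E.deg a = k then E.unit a a else 0 := by
  refine E.basis.toBasis.ext fun j => ?_
  have h1 : (∑ a, if E.deg a = k then E.unit a a else 0) (E.basis j) =
      if E.deg j = k then E.basis j else 0 := by
    rw [LinearMap.sum_apply, Finset.sum_eq_single j]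
    · split_ifs
      · rw [unit_apply, OrthonormalBasis.inner_eq_one, one_smul]
      · rfl
    · intro a _ ha
      split_ifs
      · rw [unit_apply, OrthonormalBasis.inner_eq_ite, if_neg ha, zero_smul]
      · rfl
    · exact fun h => (h (Finset.mem_univ j)).elim
  rw [OrthonormalBasis.coe_toBasis, h1]
  change (π.homog k).starProjection (E.basis j) = _
  split_ifs with hj
  · refine Submodule.starProjection_eq_self_iff.2 fun z => ?_
    rw [E.eigen, hj]
  · rw [Submodule.starProjection_apply_eq_zero_iff, Submodule.mem_orthogonal']
    intro v hv
    obtain ⟨z, hz⟩ := exists_zpow_ne hj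
    have h2 := E.inner_op z j v
    rw [hv z, inner_smul_right] at h2
    by_contra h0
    exact hz (Circle.ext (mul_right_cancel₀ h0 h2)).symm

end Eigenbasis

/-! ### Representations in terms of matrix entries -/

variable [DecidableEq ι] [FiniteDimensional ℂ V] {ζ : Circle}

/-- Matrix entries determine elements of `𝔹(V) ⊗ B` and turn products into matrix products, adjoints
into conjugate transposes. This translates the coordinate-free definition into the form of the
generators and relations. -/
theorem isRep_iff (E : Eigenbasis π ι) (G : BraidedQG ζ B) (U : Module.End ℂ V ⊗[ℂ] B) :
    IsRep π G U ↔
      (∀ i j, ∑ k, star (E.entry k i U) * E.entry k j U = if i = j then 1 else 0) ∧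
      (∀ i j, ∑ k, E.entry i k U * star (E.entry j k U) = if i = j then 1 else 0) ∧
      (∀ z i j, G.action.act z (E.entry i j U) =
        ((z ^ (E.deg j - E.deg i) : Circle) : ℂ) • E.entry i j U) ∧
      ∀ i j, G.comul (E.entry i j U) = ∑ k, j₁ ζ G.action G.action (E.entry i k U) *
        j₂ ζ G.action G.action (E.entry k j U) := by
  have hact : ∀ z i j, (((z ^ (E.deg i - E.deg j) : Circle) : ℂ) •
      G.action.act z (E.entry i j U) = E.entry i j U ↔ G.action.act z (E.entry i j U) =
        ((z ^ (E.deg j - E.deg i) : Circle) : ℂ) • E.entry i j U) := fun z i j => by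
    rw [← neg_sub (E.deg i), zpow_neg, Circle.coe_inv, eq_inv_smul_iff₀ (Circle.coe_ne_zero _)]
  constructor
  · intro h
    refine ⟨fun i j => ?_, fun i j => ?_, fun z i j => ?_, fun i j => ?_⟩
    · have h1 := congrArg (E.entry i j) h.isometry
      simpa only [E.entry_mul, E.entry_star, E.entry_one] using h1
    · have h1 := congrArg (E.entry i j) h.coisometry
      simpa only [E.entry_mul, E.entry_star, E.entry_one] using h1
    · have h1 := congrArg (E.entry i j) (h.invariant z)
      rw [E.entry_act] at h1
      exact (hact z i j).1 h1
    · have h1 := congrArg (E.entry i j) h.comul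
      simpa only [E.entry_mul, E.entry_idTensor] using h1
  · rintro ⟨h1, h2, h3, h4⟩
    refine ⟨E.ext_entry fun i j => ?_, E.ext_entry fun i j => ?_,
      fun z => E.ext_entry fun i j => ?_, E.ext_entry fun i j => ?_⟩
    · simpa only [E.entry_mul, E.entry_star, E.entry_one] using h1 i j
    · simpa only [E.entry_mul, E.entry_star, E.entry_one] using h2 i j
    · rw [E.entry_act]
      exact (hact z i j).2 (h3 z i j)
    · simpa only [E.entry_mul, E.entry_idTensor] using h4 i j

theorem braidedLeg₁₃_eq (E : Eigenbasis π ι) (β : CircleAction B) (U : Module.End ℂ V ⊗[ℂ] B) :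
    braidedLeg₁₃ ζ π β U = ∑ a, TensorProduct.map
      ((TensorProduct.mapBilinear (.id ℂ) V V V V).flip (E.unit a a))
      (β.act (ζ ^ E.deg a)).toAlgHom.toLinearMap U := by
  let F : ι → Module.End ℂ (V ⊗[ℂ] V) ⊗[ℂ] B := fun a => TensorProduct.map
    ((TensorProduct.mapBilinear (.id ℂ) V V V V).flip (E.unit a a))
    (β.act (ζ ^ E.deg a)).toAlgHom.toLinearMap U
  have h1 : ∀ k : ℤ, TensorProduct.map
      ((TensorProduct.mapBilinear (.id ℂ) V V V V).flip (π.proj k))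
      (β.act (ζ ^ k)).toAlgHom.toLinearMap U = ∑ a, if E.deg a = k then F a else 0 := fun k => by
    rw [E.proj_eq, map_sum, ← TensorProduct.mapBilinear_apply (σ₁₂ := .id ℂ), map_sum,
      LinearMap.sum_apply, LinearMap.sum_apply]
    refine Finset.sum_congr rfl fun a _ => ?_
    split_ifs with h
    · rw [← h]
      rfl
    · rw [map_zero, map_zero, LinearMap.zero_apply, LinearMap.zero_apply]
  -- Only the finitely many degrees that occur in the eigenbasis contribute, and each index `a`
  -- contributes to exactly one of them.
  rw [braidedLeg₁₃, finsum_congr h1, finsum_eq_sum_of_support_subset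
    (s := Finset.univ.image E.deg), Finset.sum_comm]
  · refine Finset.sum_congr rfl fun a _ => ?_
    rw [Finset.sum_ite_eq, if_pos (Finset.mem_image_of_mem _ (Finset.mem_univ a))]
  · intro k hk
    obtain ⟨a, -, ha⟩ := Finset.exists_ne_zero_of_sum_ne_zero hk
    rw [Finset.mem_coe, Finset.mem_image]
    exact ⟨a, Finset.mem_univ a, by_contra fun h => ha (if_neg h)⟩

/-- The projection in the braided leg fixes the second index: `E.unit c c * E.unit a b` vanishes
unless `c = a`. This is why the action by `ζ ^ deg a` carries the row index `a` of the second
factor. -/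
theorem tensorRep_apply (E : Eigenbasis π ι) (G : BraidedQG ζ B) (U : Module.End ℂ V ⊗[ℂ] B)
    (ω : V ⊗[ℂ] V) :
    LinearMap.rTensor B (LinearMap.applyₗ ω : Module.End ℂ (V ⊗[ℂ] V) →ₗ[ℂ] V ⊗[ℂ] V)
      (tensorRep π G U) = ∑ i, ∑ a, (E.basis i ⊗ₜ[ℂ] E.basis a) ⊗ₜ[ℂ]
        ∑ j, G.action.act (ζ ^ E.deg a) (E.entry i j U) *
          ∑ b, E.coeff ω j b • E.entry a b U := by
  have h1 : braidedLeg₁₃ ζ π G.action U = ∑ c, ∑ i, ∑ j,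
      TensorProduct.map (E.unit i j) (E.unit c c) ⊗ₜ[ℂ]
        G.action.act (ζ ^ E.deg c) (E.entry i j U) := by
    rw [braidedLeg₁₃_eq E]
    refine Finset.sum_congr rfl fun c _ => ?_
    nth_rewrite 1 [E.sum_entry U]
    simp only [map_sum]
    rfl
  have h2 : leg₂₃ U = ∑ a, ∑ b,
      TensorProduct.map (LinearMap.id : V →ₗ[ℂ] V) (E.unit a b) ⊗ₜ[ℂ] E.entry a b U := by
    rw [leg₂₃]
    nth_rewrite 1 [E.sum_entry U]
    simp only [map_sum]
    rfl
  have h3 : ∀ c i j a b, LinearMap.rTensor B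
      (LinearMap.applyₗ ω : Module.End ℂ (V ⊗[ℂ] V) →ₗ[ℂ] V ⊗[ℂ] V)
      (TensorProduct.map (E.unit i j) (E.unit c c) ⊗ₜ[ℂ]
        G.action.act (ζ ^ E.deg c) (E.entry i j U) *
      TensorProduct.map (LinearMap.id : V →ₗ[ℂ] V) (E.unit a b) ⊗ₜ[ℂ] E.entry a b U) =
      if c = a then (E.basis i ⊗ₜ[ℂ] E.basis a) ⊗ₜ[ℂ] (G.action.act (ζ ^ E.deg a)
        (E.entry i j U) * E.coeff ω j b • E.entry a b U) else 0 := fun c i j a b => by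
    rw [Algebra.TensorProduct.tmul_mul_tmul, ← TensorProduct.map_mul, LinearMap.rTensor_tmul,
      E.unit_mul_unit]
    change TensorProduct.map (E.unit i j) _ ω ⊗ₜ[ℂ] _ = _
    split_ifs with h
    · rw [E.map_unit_unit, h, TensorProduct.smul_tmul, mul_smul_comm]
    · rw [TensorProduct.map_zero_right, LinearMap.zero_apply, TensorProduct.zero_tmul]
  rw [tensorRep, h1, h2]
  simp only [Finset.sum_mul, Finset.mul_sum, map_sum, h3, TensorProduct.tmul_sum]
  refine Eq.trans ?_ Finset.sum_comm
  refine Finset.sum_congr rfl fun a _ => ?_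
  have h4 : ∀ F : ι → ι → (V ⊗[ℂ] V) ⊗[ℂ] B,
      (∑ c, ∑ i, ∑ j, if c = a then F i j else 0) = ∑ i, ∑ j, F i j := fun F => by
    rw [Finset.sum_eq_single a (fun c _ hc => by simp [hc])
      fun h => (h (Finset.mem_univ a)).elim]
    simp
  refine (Finset.sum_congr rfl fun b _ => h4 fun i j => _).trans ?_
  rw [Finset.sum_comm]
  exact Finset.sum_congr rfl fun i _ => Finset.sum_comm

theorem isInvariantVector_iff (E : Eigenbasis π ι) (G : BraidedQG ζ B)
    (U : Module.End ℂ V ⊗[ℂ] B) (ω : V ⊗[ℂ] V) :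
    LinearMap.rTensor B (LinearMap.applyₗ ω : Module.End ℂ (V ⊗[ℂ] V) →ₗ[ℂ] V ⊗[ℂ] V)
      (tensorRep π G U) = ω ⊗ₜ[ℂ] (1 : B) ↔
    ∀ i a, ∑ j, G.action.act (ζ ^ E.deg a) (E.entry i j U) *
      ∑ b, E.coeff ω j b • E.entry a b U = E.coeff ω i a • (1 : B) := by
  have hω : ω ⊗ₜ[ℂ] (1 : B) =
      ∑ i, ∑ a, (E.basis i ⊗ₜ[ℂ] E.basis a) ⊗ₜ[ℂ] (E.coeff ω i a • (1 : B)) := by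
    nth_rewrite 1 [← (E.basis.toBasis.tensorProduct E.basis.toBasis).sum_repr ω]
    rw [Fintype.sum_prod_type, TensorProduct.sum_tmul]
    refine Finset.sum_congr rfl fun i _ => ?_
    rw [TensorProduct.sum_tmul]
    refine Finset.sum_congr rfl fun a _ => ?_
    rw [TensorProduct.smul_tmul, Module.Basis.tensorProduct_apply, OrthonormalBasis.coe_toBasis]
    rfl
  rw [tensorRep_apply E, hω]
  refine ⟨fun h i a => ?_, fun h => by simp only [h]⟩
  -- The `B`-valued coefficient of `e i ⊗ e a`.
  let φ : (V ⊗[ℂ] V) ⊗[ℂ] B →ₗ[ℂ] B := (TensorProduct.lid ℂ B).toLinearMap.comp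
    (LinearMap.rTensor B ((E.basis.toBasis.tensorProduct E.basis.toBasis).coord (i, a)))
  have hφ : ∀ x : ι → ι → B,
      φ (∑ i, ∑ a, (E.basis i ⊗ₜ[ℂ] E.basis a) ⊗ₜ[ℂ] x i a) = x i a := fun x => by
    have h1 : ∀ k b, φ ((E.basis k ⊗ₜ[ℂ] E.basis b) ⊗ₜ[ℂ] x k b) =
        if k = i then if b = a then x k b else 0 else 0 := fun k b => by
      have h2 : E.basis k ⊗ₜ[ℂ] E.basis b =
          E.basis.toBasis.tensorProduct E.basis.toBasis (k, b) := by
        rw [Module.Basis.tensorProduct_apply, OrthonormalBasis.coe_toBasis]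
      simp only [φ, LinearMap.comp_apply, LinearMap.rTensor_tmul, LinearEquiv.coe_coe,
        TensorProduct.lid_tmul, Module.Basis.coord_apply, h2, Module.Basis.repr_self,
        Finsupp.single_apply, Prod.mk.injEq]
      by_cases hk : k = i <;> by_cases hb : b = a <;> simp [hk, hb]
    simp only [map_sum, h1]
    simp
  have h1 := congrArg φ h
  rwa [hφ, hφ] at h1

end Entries

/-! ### Invariance and the orthogonality relation -/

section Invariance

/-- Converts between the exponent in the defining relation and the one that invariance produces. -/
theorem zpow_smul_eq_of_deg {ι : Type u} {ζ : Circle} {deg : ι → ℤ} {d : ℤ} {w : Matrix ι ι ℂ}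
    {A : Type v} [Ring A] [Algebra ℂ A] (hw : ∀ i j, w i j ≠ 0 → deg i + deg j = d) (i a : ι)
    (y : A) :
    ((ζ ^ (deg a * (d - deg a)) : Circle) : ℂ) • w i a • y =
      ((ζ ^ (deg a * deg i) : Circle) : ℂ) • w i a • y := by
  rcases eq_or_ne (w i a) 0 with h0 | h0
  · rw [h0, zero_smul, smul_zero, smul_zero]
  · rw [← hw i a h0, add_sub_cancel_right]

variable {ι : Type u} [Fintype ι] [DecidableEq ι] {ζ : Circle} {deg : ι → ℤ} {d : ℤ}
  {w : Matrix ι ι ℂ} {A : Type v} [Ring A] [StarRing A] [Algebra ℂ A] {x : ι → ι → A}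

/-- For a unitary matrix with entries of the right degrees, the orthogonality relation says that
`∑ w i j • e i ⊗ e j` is an invariant vector. -/
theorem OrthRel.of_invariant (hw : ∀ i j, w i j ≠ 0 → deg i + deg j = d)
    (h₁ : ∀ i j, ∑ k, star (x k i) * x k j = if i = j then 1 else 0)
    (h₂ : ∀ i j, ∑ k, x i k * star (x j k) = if i = j then 1 else 0)
    (h : ∀ i a, ∑ j, ((ζ ^ (deg a * (deg j - deg i)) : Circle) : ℂ) •
      (x i j * ∑ b, w j b • x a b) = w i a • (1 : A)) : OrthRel ζ deg d w x := by
  refine ⟨h₁, h₂, fun i a => ?_⟩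
  have h3 : ∀ k, ∑ j, ((ζ ^ (deg a * deg j) : Circle) : ℂ) • (x k j * ∑ b, w j b • x a b) =
      ((ζ ^ (deg a * deg k) : Circle) : ℂ) • w k a • (1 : A) := fun k => by
    rw [← h k a, Finset.smul_sum]
    refine Finset.sum_congr rfl fun j _ => ?_
    rw [smul_smul, ← Circle.coe_mul, ← zpow_add]
    congr 3
    ring
  -- Inserting `x* x = 1` on the left brings in the invariance equation `h3`, which leaves only
  -- adjoints.
  calc ((ζ ^ (deg a * deg i) : Circle) : ℂ) • ∑ b, w i b • x a b
      = ∑ j, (∑ k, star (x k i) * x k j) *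
          (((ζ ^ (deg a * deg j) : Circle) : ℂ) • ∑ b, w j b • x a b) := by
        simp only [h₁]
        simp
    _ = ∑ k, star (x k i) *
          ∑ j, ((ζ ^ (deg a * deg j) : Circle) : ℂ) • (x k j * ∑ b, w j b • x a b) := by
        simp only [Finset.sum_mul]
        rw [Finset.sum_comm]
        simp only [Finset.mul_sum (s := Finset.univ) (a := star (x _ i)) (f := fun j =>
          ((ζ ^ (deg a * deg j) : Circle) : ℂ) • (x _ j * ∑ b, w j b • x a b)), mul_assoc,
          mul_smul_comm]
    _ = _ := by
        simp only [h3, Finset.smul_sum, zpow_smul_eq_of_deg hw, mul_smul_comm, mul_one]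

/-- The computation run backwards: the relation turns the inner sums into adjoints, and `x x* = 1`
collapses the product to the diagonal term. -/
theorem OrthRel.invariant (hw : ∀ i j, w i j ≠ 0 → deg i + deg j = d) (h : OrthRel ζ deg d w x)
    (i a : ι) : ∑ j, ((ζ ^ (deg a * (deg j - deg i)) : Circle) : ℂ) •
      (x i j * ∑ b, w j b • x a b) = w i a • (1 : A) := by
  calc ∑ j, ((ζ ^ (deg a * (deg j - deg i)) : Circle) : ℂ) • (x i j * ∑ b, w j b • x a b)
      = ∑ j, ((ζ ^ (-(deg a * deg i)) : Circle) : ℂ) • (x i j *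
          ((ζ ^ (deg a * deg j) : Circle) : ℂ) • ∑ b, w j b • x a b) := by
        refine Finset.sum_congr rfl fun j _ => ?_
        rw [mul_smul_comm, smul_smul, ← Circle.coe_mul, ← zpow_add]
        congr 3
        ring
    _ = ((ζ ^ (-(deg a * deg i)) : Circle) : ℂ) • ∑ k,
          ((ζ ^ (deg a * deg k) : Circle) : ℂ) • w k a • ∑ j, x i j * star (x k j) := by
        rw [← Finset.smul_sum]
        congr 1
        simp only [h.orth, Finset.smul_sum, zpow_smul_eq_of_deg hw, Finset.mul_sum,
          mul_smul_comm]
        exact Finset.sum_comm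
    _ = w i a • (1 : A) := by
        simp only [h.coisometry, smul_ite, smul_zero, Finset.sum_ite_eq, Finset.mem_univ, if_true]
        rw [smul_smul, ← Circle.coe_mul, ← zpow_add, neg_add_cancel, zpow_zero, Circle.coe_one,
          one_smul]

end Invariance

/-! ### The universal property. -/

section Universal

variable {V : Type v} [NormedAddCommGroup V] [InnerProductSpace ℂ V] [FiniteDimensional ℂ V]
  {ζ : Circle} {ι : Type u} [Fintype ι] [DecidableEq ι] {π : CircleRep V}
  {B : Type u} [CStarAlgebra B]

theorem orthRel_entry (E : Eigenbasis π ι) {G : BraidedQG ζ B} {U : Module.End ℂ V ⊗[ℂ] B}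
    {d : ℤ} {ω : V ⊗[ℂ] V} (hU : IsRep π G U) (hω : IsInvariantVector π G U d ω) :
    OrthRel ζ E.deg d (E.coeff ω) fun i j => E.entry i j U := by
  obtain ⟨h1, h2, h3, -⟩ := (isRep_iff E G U).1 hU
  refine OrthRel.of_invariant (fun i j => E.deg_add_deg hω.homogeneous) h1 h2 fun i a => ?_
  have h := (isInvariantVector_iff E G U ω).1 hω.invariant i a
  simpa only [h3, smul_mul_assoc, ← zpow_mul] using h

theorem invariant_of_orthRel (E : Eigenbasis π ι) {G : BraidedQG ζ B}
    {U : Module.End ℂ V ⊗[ℂ] B} {d : ℤ} {ω : V ⊗[ℂ] V} (hU : IsRep π G U)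
    (hw : ∀ i j, E.coeff ω i j ≠ 0 → E.deg i + E.deg j = d)
    (h : OrthRel ζ E.deg d (E.coeff ω) fun i j => E.entry i j U) :
    LinearMap.rTensor B (LinearMap.applyₗ ω : Module.End ℂ (V ⊗[ℂ] V) →ₗ[ℂ] V ⊗[ℂ] V)
      (tensorRep π G U) = ω ⊗ₜ[ℂ] (1 : B) := by
  obtain ⟨-, -, h3, -⟩ := (isRep_iff E G U).1 hU
  refine (isInvariantVector_iff E G U ω).2 fun i a => ?_
  simpa only [h3, smul_mul_assoc, ← zpow_mul] using h.invariant hw i a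

variable {D : OrthDatum ζ V} {E : Eigenbasis D.π ι} {A : BraidedQG ζ (AoAlg D E)}

theorem entry_aoRep (i j : ι) : E.entry i j (aoRep D E) = aoGen D E i j :=
  E.entry_sum (aoGen D E) i j

/-- The space and its eigenbasis are allowed to differ from those of the datum so that this also
covers the transport of `u` along a unitary. -/
theorem IsAo.isRep_of_entry (hA : IsAo D E A) {W : Type w} [NormedAddCommGroup W]
    [InnerProductSpace ℂ W] [FiniteDimensional ℂ W] {ρ : CircleRep W} (F : Eigenbasis ρ ι)
    (hdeg : F.deg = E.deg) {U : Module.End ℂ W ⊗[ℂ] AoAlg D E}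
    (hU : ∀ i j, F.entry i j U = aoGen D E i j) : IsRep ρ A U := by
  refine (isRep_iff F A U).2 ?_
  simp only [hU, hdeg]
  exact ⟨(aoGen_orthRel D E).isometry, (aoGen_orthRel D E).coisometry, hA.action_gen,
    hA.comul_gen⟩

theorem IsAo.isRep (hA : IsAo D E A) : IsRep D.π A (aoRep D E) :=
  hA.isRep_of_entry E rfl entry_aoRep

theorem IsAo.isInvariantVector (hA : IsAo D E A) :
    IsInvariantVector D.π A (aoRep D E) D.d D.ω :=
  ⟨D.homogeneous, invariant_of_orthRel E hA.isRep (fun _ _ => E.deg_add_deg D.homogeneous)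
    (by simpa only [entry_aoRep] using aoGen_orthRel D E)⟩

theorem idTensor_aoRep_eq_iff (f : AoAlg D E →⋆ₐ[ℂ] B) (U : Module.End ℂ V ⊗[ℂ] B) :
    idTensor V f (aoRep D E) = U ↔ ∀ i j, f (aoGen D E i j) = E.entry i j U := by
  refine ⟨fun h i j => ?_, fun h => E.ext_entry fun i j => ?_⟩
  · rw [← h, E.entry_idTensor, entry_aoRep]
  · rw [E.entry_idTensor, entry_aoRep, h]

/-- The universal property of `A_o(V, π, ω)`. -/
theorem IsAo.existsUnique_hopfHom (hA : IsAo D E A) {G : BraidedQG ζ B}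
    {U : Module.End ℂ V ⊗[ℂ] B} (hU : IsRep D.π G U) (hω : IsInvariantVector D.π G U D.d D.ω) :
    ∃! f : AoAlg D E →⋆ₐ[ℂ] B, IsHopfHom A G f ∧ idTensor V f (aoRep D E) = U := by
  obtain ⟨-, -, h3, h4⟩ := (isRep_iff E G U).1 hU
  -- The entries of `U` satisfy the defining relations, so `aoLift` gives the homomorphism. On
  -- generators, equivariance and compatibility with `Δ` are the last two conditions in `isRep_iff`.
  have hrel := orthRel_entry E hU hω
  have hf : Equivariant A.action G.action (aoLift hrel) := fun z b => by
    have h : (aoLift hrel).comp (A.action.act z) = (G.action.act z).comp (aoLift hrel) :=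
      ao_hom_ext fun i j => by
        rw [StarAlgHom.comp_apply, StarAlgHom.comp_apply, hA.action_gen, map_smul, aoLift_gen, h3]
    exact DFunLike.congr_fun h b
  refine ⟨aoLift hrel, ⟨⟨hf, fun b => ?_⟩,
    (idTensor_aoRep_eq_iff _ _).2 fun i j => aoLift_gen hrel i j⟩, fun g hg => ?_⟩
  · have h : G.comul.comp (aoLift hrel) = (map ζ _ hf _ hf).comp A.comul :=
      ao_hom_ext fun i j => by
        rw [StarAlgHom.comp_apply, StarAlgHom.comp_apply, hA.comul_gen, aoLift_gen, h4, map_sum]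
        refine Finset.sum_congr rfl fun k _ => ?_
        rw [map_mul, map_j₁, map_j₂, aoLift_gen, aoLift_gen]
    exact DFunLike.congr_fun h b
  · exact ao_hom_ext fun i j => by
      rw [(idTensor_aoRep_eq_iff g U).1 hg.2, aoLift_gen]

end Universal

/-! ### Functoriality in the datum -/

section Functoriality

variable {V : Type v} [NormedAddCommGroup V] [InnerProductSpace ℂ V] {V₂ : Type w}
  [NormedAddCommGroup V₂] [InnerProductSpace ℂ V₂] {ι ι₂ : Type u} [Fintype ι] [Fintype ι₂]
  {B C : Type u} [CStarAlgebra B] [CStarAlgebra C]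

/-- The pullback of an eigenbasis along an equivariant unitary. -/
def Eigenbasis.comap {π : CircleRep V} {π₂ : CircleRep V₂} (E : Eigenbasis π₂ ι)
    (φ : V ≃ₗᵢ[ℂ] V₂) (hφ : ∀ (z : Circle) (v : V), φ (π.op z v) = π₂.op z (φ v)) :
    Eigenbasis π ι where
  basis := E.basis.map φ.symm
  deg := E.deg
  eigen z i := by
    apply φ.injective
    rw [hφ, map_smul, OrthonormalBasis.map_apply, LinearIsometryEquiv.apply_symm_apply, E.eigen]

theorem Eigenbasis.entry_comap {π : CircleRep V} {π₂ : CircleRep V₂} (E : Eigenbasis π₂ ι)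
    (φ : V ≃ₗᵢ[ℂ] V₂) (hφ : ∀ (z : Circle) (v : V), φ (π.op z v) = π₂.op z (φ v))
    (f : B →⋆ₐ[ℂ] C) (U : Module.End ℂ V ⊗[ℂ] B) (i j : ι) :
    E.entry i j (TensorProduct.map φ.toLinearEquiv.conj.toLinearMap f.toAlgHom.toLinearMap U) =
      f ((E.comap φ hφ).entry i j U) := by
  induction U using TensorProduct.induction_on with
  | zero => simp
  | tmul T b =>
    change E.entry i j (φ.toLinearEquiv.conj T ⊗ₜ[ℂ] f b) = _
    rw [entry_tmul, entry_tmul, map_smul]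
    congr 1
    change inner ℂ (E.basis i) (φ (T (φ.symm (E.basis j)))) =
      inner ℂ (E.basis.map φ.symm i) (T (E.basis.map φ.symm j))
    rw [OrthonormalBasis.map_apply, OrthonormalBasis.map_apply,
      ← LinearIsometryEquiv.inner_map_map φ, LinearIsometryEquiv.apply_symm_apply]
  | add x y hx hy => rw [map_add, map_add, hx, hy, map_add, map_add]

theorem Eigenbasis.coeff_comap {π : CircleRep V} {π₂ : CircleRep V₂} (E : Eigenbasis π₂ ι)
    (φ : V ≃ₗᵢ[ℂ] V₂) (hφ : ∀ (z : Circle) (v : V), φ (π.op z v) = π₂.op z (φ v))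
    (ω : V ⊗[ℂ] V) : (E.comap φ hφ).coeff ω =
      E.coeff (TensorProduct.map φ.toLinearEquiv.toLinearMap φ.toLinearEquiv.toLinearMap ω) := by
  ext i j
  simp only [coeff, Matrix.of_apply]
  induction ω using TensorProduct.induction_on with
  | zero => simp
  | tmul x y =>
    have h : ∀ (v : V) (k : ι), (E.comap φ hφ).basis.toBasis.repr v k =
        E.basis.toBasis.repr (φ v) k := fun v k => by
      rw [OrthonormalBasis.coe_toBasis_repr_apply, OrthonormalBasis.coe_toBasis_repr_apply,
        OrthonormalBasis.repr_apply_apply, OrthonormalBasis.repr_apply_apply,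
        ← LinearIsometryEquiv.inner_map_map φ]
      congr 1
      exact LinearIsometryEquiv.apply_symm_apply φ _
    rw [TensorProduct.map_tmul, Module.Basis.tensorProduct_repr_tmul_apply,
      Module.Basis.tensorProduct_repr_tmul_apply, h, h]
    rfl
  | add x y hx hy => rw [map_add, map_add, map_add, Finsupp.add_apply, Finsupp.add_apply, hx, hy]

variable [FiniteDimensional ℂ V] [FiniteDimensional ℂ V₂] [DecidableEq ι] [DecidableEq ι₂]
  {ζ : Circle} {D : OrthDatum ζ V} {E : Eigenbasis D.π ι} {A : BraidedQG ζ (AoAlg D E)}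
  {D₂ : OrthDatum ζ V₂} {E₂ : Eigenbasis D₂.π ι₂} {A₂ : BraidedQG ζ (AoAlg D₂ E₂)}

/-- The equation `(Ad φ ⊗ f)(u₁) = u₂`, solved for `(id ⊗ f)(u₁)`. -/
theorem map_conj_aoRep_eq_iff (φ : V ≃ₗᵢ[ℂ] V₂) (f : AoAlg D E →⋆ₐ[ℂ] AoAlg D₂ E₂) :
    TensorProduct.map φ.toLinearEquiv.conj.toLinearMap f.toAlgHom.toLinearMap (aoRep D E) =
        aoRep D₂ E₂ ↔
      idTensor V f (aoRep D E) = TensorProduct.map φ.symm.toLinearEquiv.conj.toLinearMap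
        (StarAlgHom.id ℂ (AoAlg D₂ E₂)).toAlgHom.toLinearMap (aoRep D₂ E₂) := by
  have h1 : ∀ X : Module.End ℂ V ⊗[ℂ] AoAlg D E,
      TensorProduct.map φ.toLinearEquiv.conj.toLinearMap f.toAlgHom.toLinearMap X =
        TensorProduct.map φ.toLinearEquiv.conj.toLinearMap
          (StarAlgHom.id ℂ (AoAlg D₂ E₂)).toAlgHom.toLinearMap (idTensor V f X) := fun X => by
    induction X using TensorProduct.induction_on with
    | zero => simp
    | tmul T b => rfl
    | add x y hx hy => rw [map_add, map_add, map_add, hx, hy]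
  let e : Module.End ℂ V ⊗[ℂ] AoAlg D₂ E₂ ≃ₗ[ℂ] Module.End ℂ V₂ ⊗[ℂ] AoAlg D₂ E₂ :=
    TensorProduct.congr φ.toLinearEquiv.conj (LinearEquiv.refl ℂ _)
  rw [h1]
  exact (LinearEquiv.eq_symm_apply e).symm

/-- Transporting `u₂` back along `φ` gives a representation `U` of the second quantum group on the
first space. In the pulled-back eigenbasis, `U` has the entries of `u₂` and `ω₁` has the
coefficients of `ω₂`, so universality applies to `U`. -/
theorem IsAo.existsUnique_hopfHom_of_unitary (hA : IsAo D E A) (hA₂ : IsAo D₂ E₂ A₂)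
    (φ : V ≃ₗᵢ[ℂ] V₂) (hφ : ∀ (z : Circle) (v : V), φ (D.π.op z v) = D₂.π.op z (φ v))
    (hω : TensorProduct.map φ.toLinearEquiv.toLinearMap φ.toLinearEquiv.toLinearMap D.ω = D₂.ω) :
    ∃! f : AoAlg D E →⋆ₐ[ℂ] AoAlg D₂ E₂, IsHopfHom A A₂ f ∧
      TensorProduct.map φ.toLinearEquiv.conj.toLinearMap f.toAlgHom.toLinearMap (aoRep D E) =
        aoRep D₂ E₂ := by
  simp only [map_conj_aoRep_eq_iff]
  set U : Module.End ℂ V ⊗[ℂ] AoAlg D₂ E₂ :=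
    TensorProduct.map φ.symm.toLinearEquiv.conj.toLinearMap
      (StarAlgHom.id ℂ (AoAlg D₂ E₂)).toAlgHom.toLinearMap (aoRep D₂ E₂) with hU
  have hentry : ∀ i j, (E₂.comap φ hφ).entry i j U = aoGen D₂ E₂ i j := fun i j => by
    have h := E₂.entry_comap φ hφ (StarAlgHom.id ℂ (AoAlg D₂ E₂)) U i j
    have h' : TensorProduct.map φ.toLinearEquiv.conj.toLinearMap
        (StarAlgHom.id ℂ (AoAlg D₂ E₂)).toAlgHom.toLinearMap U = aoRep D₂ E₂ :=
      LinearEquiv.apply_symm_apply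
        (TensorProduct.congr φ.toLinearEquiv.conj (LinearEquiv.refl ℂ (AoAlg D₂ E₂))) _
    rw [h', entry_aoRep] at h
    exact h.symm
  have hrep : IsRep D.π A₂ U := hA₂.isRep_of_entry (E₂.comap φ hφ) rfl hentry
  have hcoeff : (E₂.comap φ hφ).coeff D.ω = E₂.coeff D₂.ω := by rw [E₂.coeff_comap, hω]
  refine hA.existsUnique_hopfHom hrep ⟨D.homogeneous, ?_⟩
  -- The degree is that of the second datum, whose relations the entries satisfy. For `V = 0` the
  -- vector `ω` vanishes and the two degrees may differ; invariance itself does not mention a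
  -- degree.
  refine invariant_of_orthRel (E₂.comap φ hφ) (d := D₂.d) hrep (fun i j h => ?_) ?_
  · rw [hcoeff] at h
    exact E₂.deg_add_deg D₂.homogeneous h
  · simp only [hentry, hcoeff]
    exact aoGen_orthRel D₂ E₂

/-- The conjugations by `φ` and its inverse cancel, so `id ⊗ (g ∘ f)` fixes `u`, and hence `g ∘ f`
fixes every generator. -/
theorem comp_eq_id_of_map_aoRep {φ : V ≃ₗᵢ[ℂ] V₂} {f : AoAlg D E →⋆ₐ[ℂ] AoAlg D₂ E₂}
    {g : AoAlg D₂ E₂ →⋆ₐ[ℂ] AoAlg D E}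
    (hf : TensorProduct.map φ.toLinearEquiv.conj.toLinearMap f.toAlgHom.toLinearMap (aoRep D E) =
      aoRep D₂ E₂)
    (hg : TensorProduct.map φ.symm.toLinearEquiv.conj.toLinearMap g.toAlgHom.toLinearMap
      (aoRep D₂ E₂) = aoRep D E) : g.comp f = StarAlgHom.id ℂ _ := by
  have h1 : ∀ X : Module.End ℂ V ⊗[ℂ] AoAlg D E,
      TensorProduct.map φ.symm.toLinearEquiv.conj.toLinearMap g.toAlgHom.toLinearMap
        (TensorProduct.map φ.toLinearEquiv.conj.toLinearMap f.toAlgHom.toLinearMap X) =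
      idTensor V (g.comp f) X := fun X => by
    induction X using TensorProduct.induction_on with
    | zero => simp
    | tmul T b =>
      change (φ.toLinearEquiv.conj.symm (φ.toLinearEquiv.conj T)) ⊗ₜ[ℂ] (g (f b)) =
        T ⊗ₜ[ℂ] (g (f b))
      rw [LinearEquiv.symm_apply_apply]
    | add x y hx hy => rw [map_add, map_add, map_add, hx, hy]
  have h2 := h1 (aoRep D E)
  rw [hf, hg] at h2
  refine ao_hom_ext fun i j => ?_
  rw [(idTensor_aoRep_eq_iff (g.comp f) (aoRep D E)).1 h2.symm i j, entry_aoRep]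
  rfl

theorem IsAo.existsUnique_hopfEquiv (hA : IsAo D E A) (hA₂ : IsAo D₂ E₂ A₂) (φ : V ≃ₗᵢ[ℂ] V₂)
    (hφ : ∀ (z : Circle) (v : V), φ (D.π.op z v) = D₂.π.op z (φ v))
    (hω : TensorProduct.map φ.toLinearEquiv.toLinearMap φ.toLinearEquiv.toLinearMap D.ω = D₂.ω) :
    ∃! Φ : AoAlg D E ≃⋆ₐ[ℂ] AoAlg D₂ E₂,
      IsHopfHom A A₂ (Φ : AoAlg D E →⋆ₐ[ℂ] AoAlg D₂ E₂) ∧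
      TensorProduct.map φ.toLinearEquiv.conj.toLinearMap
        (Φ : AoAlg D E →⋆ₐ[ℂ] AoAlg D₂ E₂).toAlgHom.toLinearMap (aoRep D E) = aoRep D₂ E₂ := by
  obtain ⟨f, ⟨hf, hf'⟩, huniq⟩ := hA.existsUnique_hopfHom_of_unitary hA₂ φ hφ hω
  have hφ' : ∀ (z : Circle) (v : V₂), φ.symm (D₂.π.op z v) = D.π.op z (φ.symm v) := fun z v => by
    rw [LinearIsometryEquiv.symm_apply_eq, hφ, LinearIsometryEquiv.apply_symm_apply]
  have hω' : TensorProduct.map φ.symm.toLinearEquiv.toLinearMap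
      φ.symm.toLinearEquiv.toLinearMap D₂.ω = D.ω := by
    rw [← hω]
    exact LinearEquiv.symm_apply_apply (TensorProduct.congr φ.toLinearEquiv φ.toLinearEquiv) D.ω
  obtain ⟨g, ⟨-, hg⟩, -⟩ := hA₂.existsUnique_hopfHom_of_unitary hA φ.symm hφ' hω'
  have hgf : g.comp f = StarAlgHom.id ℂ _ := comp_eq_id_of_map_aoRep hf' hg
  have hfg : f.comp g = StarAlgHom.id ℂ _ := comp_eq_id_of_map_aoRep (φ := φ.symm) hg hf'
  refine ⟨StarAlgEquiv.ofStarAlgHom f g hgf hfg, ⟨hf, hf'⟩, fun Ψ hΨ => ?_⟩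
  have h := huniq _ hΨ
  exact StarAlgEquiv.ext fun x => DFunLike.congr_fun h x

end Functoriality

end BraidedOrth
end

/-! ### The main theorem. -/

open BraidedOrth
open scoped TensorProduct
theorem mainTheorem3 {ζ : Circle} {V : Type v} [NormedAddCommGroup V] [InnerProductSpace ℂ V]
    [FiniteDimensional ℂ V] (D : OrthDatum ζ V) {ι : Type u} [Fintype ι] [DecidableEq ι]
    (E : Eigenbasis D.π ι) :
    (∃! A : BraidedQG ζ (AoAlg D E), IsAo D E A) ∧
    ∀ A : BraidedQG ζ (AoAlg D E), IsAo D E A →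
      (IsRep D.π A (aoRep D E) ∧ IsInvariantVector D.π A (aoRep D E) D.d D.ω) ∧
      (∀ (B : Type u) [CStarAlgebra B] (G : BraidedQG ζ B) (U : Module.End ℂ V ⊗[ℂ] B),
        IsRep D.π G U → IsInvariantVector D.π G U D.d D.ω →
        ∃! f : AoAlg D E →⋆ₐ[ℂ] B, IsHopfHom A G f ∧ idTensor V f (aoRep D E) = U) ∧
      (∀ (ι' : Type u) [Fintype ι'] [DecidableEq ι'] (E' : Eigenbasis D.π ι')
        (A' : BraidedQG ζ (AoAlg D E')), IsAo D E' A' →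
        ∃! Φ : AoAlg D E ≃⋆ₐ[ℂ] AoAlg D E',
          IsHopfHom A A' (Φ : AoAlg D E →⋆ₐ[ℂ] AoAlg D E') ∧
          idTensor V (Φ : AoAlg D E →⋆ₐ[ℂ] AoAlg D E') (aoRep D E) = aoRep D E') ∧
      (∀ (V₂ : Type w) [NormedAddCommGroup V₂] [InnerProductSpace ℂ V₂] [FiniteDimensional ℂ V₂]
        (D₂ : OrthDatum ζ V₂) (ι₂ : Type u) [Fintype ι₂] [DecidableEq ι₂]
        (E₂ : Eigenbasis D₂.π ι₂) (A₂ : BraidedQG ζ (AoAlg D₂ E₂)), IsAo D₂ E₂ A₂ →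
        ∀ φ : V ≃ₗᵢ[ℂ] V₂, (∀ (z : Circle) (v : V), φ (D.π.op z v) = D₂.π.op z (φ v)) →
        TensorProduct.map φ.toLinearEquiv.toLinearMap φ.toLinearEquiv.toLinearMap D.ω = D₂.ω →
        ∃! Φ : AoAlg D E ≃⋆ₐ[ℂ] AoAlg D₂ E₂,
          IsHopfHom A A₂ (Φ : AoAlg D E →⋆ₐ[ℂ] AoAlg D₂ E₂) ∧
          TensorProduct.map φ.toLinearEquiv.conj.toLinearMap
            (Φ : AoAlg D E →⋆ₐ[ℂ] AoAlg D₂ E₂).toAlgHom.toLinearMap (aoRep D E) =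
              aoRep D₂ E₂) := by
  refine ⟨⟨aoQG D E, aoQG_isAo D E, fun A hA => hA.eq (aoQG_isAo D E)⟩, fun A hA =>
    ⟨⟨hA.isRep, hA.isInvariantVector⟩, fun B _ G U hU hω => hA.existsUnique_hopfHom hU hω,
      fun ι' _ _ E' A' hA' => ?_,
      fun V₂ _ _ _ D₂ ι₂ _ _ E₂ A₂ hA₂ φ hφ hω => hA.existsUnique_hopfEquiv hA₂ φ hφ hω⟩⟩
  -- Independence of the basis is the case `φ = id` for one datum with two eigenbases; conjugation
  -- by the identity then disappears.
  have h := hA.existsUnique_hopfEquiv hA' (LinearIsometryEquiv.refl ℂ V) (fun _ _ => rfl)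
    (DFunLike.congr_fun (TensorProduct.map_id (R := ℂ) (M := V) (N := V)) D.ω)
  have hconj : (LinearIsometryEquiv.refl ℂ V).toLinearEquiv.conj.toLinearMap =
      (LinearMap.id : Module.End ℂ V →ₗ[ℂ] Module.End ℂ V) := rfl
  rw [hconj] at h
  exact h
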